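/- Let $\rho=e^{2\pi i/7}$ and let $X\subset\mathbb{C}^4$ be the Fricke--Macbeath curve in Macbeath's form $$y_1^2=(x-1)(x-\rho^3)(x-\rho^5)(x-\rho^6),\quad y_2^2=(x-\rho^2)(x-\rho^4)(x-\rho^5)(x-\rho^6),\quad y_4^2=(x-\rho)(x-\rho^3)(x-\rho^4)(x-\rho^5).$$ Put $w=\dfrac{y_2y_4}{(x-\rho^4)(x-\rho^5)}$, let $$L_1^*:X\dashrightarrow\mathbb{C}^5,\quad L_1^*(x,y_1,y_2,y_4)=\bigl(3x,\;3y_1,\;y_2+y_4+w,\;y_2^2+y_4^2+w^2,\;y_2^3+y_4^3+w^3\bigr),$$ and let $Z_2=L_1^*(X)$ (images of rational maps are understood to be Zariski closed). Let $S$ be coordinatewise complex conjugation, and let $$J(x,y_1,y_2,y_4)=\left(\frac1{\bar x},\frac{\bar y_1}{\bar x^2},\frac{\rho^5\bar y_2}{\bar x^2},\frac{\rho^3\bar y_4}{\bar x^2}\right).$$ Let $M=\mathrm{Gal}(\mathbb{Q}(\sqrt{-7})/\mathbb{Q})$. A Weil datum for an algebraic set $V$ relative to $\mathbb{Q}(\sqrt{-7})/\mathbb{Q}$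 consists of birational isomorphisms $g_\sigma:V\dashrightarrow V^\sigma$ ($\sigma\in M$) defined over $\mathbb{Q}(\sqrt{-7})$ with $g_{\sigma\tau}=g_\tau^\sigma\circ g_\sigma$ for all $\sigma,\tau\in M$, where $V$ is defined over $\mathbb{Q}(\sqrt{-7})$. 1. $X$ and $Z_2$ are irreducible algebraic curves, and $L_1^*:X\dashrightarrow Z_2$ is a birational isomorphism defined over $\mathbb{Q}(\rho)$. The map $J$ is an anticonformal involution of $X$, and $T=L_1^*\circ J\circ(L_1^*)^{-1}$ is an anticonformal involution of $Z_2$. 2. $M=\{e,\eta\}$ with $\eta\neq e$ the restriction of complex conjugation, and $g_e=I$, $g_\eta=S\circ T$ is a Weil datum for $Z_2$ relative to $\mathbb{Q}(\sqrt{-7})/\mathbb{Q}$. The map $\Phi_2(t)=(t,g_\eta(t))$ is a birational isomorphism, defined over $\mathbb{Q}(\sqrt{-7})$, of $Z_2$ onto a subset $\Phi_2(Z_2)$ of $\mathbb{C}^{10}=\mathbb{C}^5\times\mathbb{C}^5$. 3. Let $M$ act on $\mathbb{C}^{10}$ by $\Theta_2(\eta)(t,s)=(s,t)$, let $\Psi_2:\mathbb{C}^{10}\to\mathbb{C}^{10}$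 be the map $\Psi_2(t,s)=\bigl((t_i+s_i)_i,(t_i^2+s_i^2)_i\bigr)$, where $i$ runs over the five coordinates, and put $W=\Psi_2(\Phi_2(Z_2))$. If the stabilizer $\{\sigma\in M:\Theta_2(\sigma)(\Phi_2(Z_2))=\Phi_2(Z_2)\}$ is trivial, then $W$ is an irreducible algebraic curve that can be defined by polynomials with rational coefficients, $\Psi_2:\Phi_2(Z_2)\dashrightarrow W$ and $L_2=\Psi_2\circ\Phi_2:Z_2\dashrightarrow W$ are birational isomorphisms defined over $\mathbb{Q}(\sqrt{-7})$, and hence $L=L_2\circ L_1^*:X\dashrightarrow W$ is a birational isomorphism, defined over $\mathbb{Q}(\rho)$, of the Fricke--Macbeath curve onto a curve defined over $\mathbb{Q}$. -/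

import Mathlib

open MvPolynomial

noncomputable section

namespace FrickeMacbeath

/-! ## Affine algebraic sets, rational maps, Weil data -/

section General

variable {ι κ : Type}

/-- The Zariski closure of a subset of affine space over `ℂ`. -/
def zariskiClosure (V : Set (ι → ℂ)) : Set (ι → ℂ) :=
  zeroLocus ℂ (vanishingIdeal ℂ V)

/-- An affine algebraic curve: a Zariski closed, irreducible set of dimension one. -/
structure IsAffineCurve (V : Set (ι → ℂ)) : Prop where
  closed : zariskiClosure V = V
  irreducible : (vanishingIdeal ℂ V).IsPrime
  dim_eq_one : ringKrullDim (MvPolynomial ι ℂ ⧸ vanishingIdeal ℂ V) = 1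

/-- `V` can be defined by polynomials with coefficients in `k`. -/
def DefinedOver (k : Type) [Field k] [Algebra k ℂ] (V : Set (ι → ℂ)) : Prop :=
  ∃ I : Ideal (MvPolynomial ι k), V = zeroLocus ℂ I

/-- `P` holds at all points of some Zariski dense, (principal) open subset of `V`. -/
def Generically (V : Set (ι → ℂ)) (P : (ι → ℂ) → Prop) : Prop :=
  ∃ D : MvPolynomial ι ℂ, V ⊆ zariskiClosure {x ∈ V | aeval x D ≠ 0} ∧
    ∀ x ∈ V, aeval x D ≠ 0 → P x

/-- The closed image of a generically defined map `f` on `V`, i.e. the Zariski closure of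
`f(U)` for a small enough dense open subset `U` of `V`: a polynomial vanishes on it as soon as it
vanishes on the image of some dense open subset. Values of `f` outside a dense open set
are irrelevant. -/
def closedImage (V : Set (ι → ℂ)) (f : (ι → ℂ) → (κ → ℂ)) : Set (κ → ℂ) :=
  {y | ∀ q : MvPolynomial κ ℂ, Generically V (fun x => aeval (f x) q = 0) → aeval y q = 0}

/-- A tuple of rational functions with coefficients in `k`, written with a common denominator. -/
structure RatMap (k : Type) [Field k] (ι κ : Type) where
  num : κ → MvPolynomial ι k
  den : MvPolynomial ι k

namespace RatMap

variable {k : Type} [Field k]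

/-- The rational map with `σ` applied to all coefficients. -/
def conj (R : RatMap k ι κ) (σ : k →+* k) : RatMap k ι κ where
  num i := MvPolynomial.map σ (R.num i)
  den := MvPolynomial.map σ R.den

variable [Algebra k ℂ]

/-- `R` is defined at `x` (for the given presentation as a quotient). -/
def DefinedAt (R : RatMap k ι κ) (x : ι → ℂ) : Prop := aeval x R.den ≠ 0

def eval (R : RatMap k ι κ) (x : ι → ℂ) : κ → ℂ :=
  fun i => aeval x (R.num i) / aeval x R.den

/-- `R : V ⇢ W` is a birational isomorphism defined over `k`: it has a rational inverse
`H : W ⇢ V` over `k`. -/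
def IsBirational (R : RatMap k ι κ) (V : Set (ι → ℂ)) (W : Set (κ → ℂ)) : Prop :=
  ∃ H : RatMap k κ ι,
    Generically V (fun x => R.DefinedAt x ∧ R.eval x ∈ W ∧
      H.DefinedAt (R.eval x) ∧ H.eval (R.eval x) = x) ∧
    Generically W (fun y => H.DefinedAt y ∧ H.eval y ∈ V ∧
      R.DefinedAt (H.eval y) ∧ R.eval (H.eval y) = y)

end RatMap

/-- The map `f` agrees, on a dense open subset of `V`, with a birational isomorphism `V ⇢ W`
given by rational functions with coefficients in `k`. -/
def IsBirationalIso (k : Type) [Field k] [Algebra k ℂ] (V : Set (ι → ℂ)) (W : Set (κ → ℂ))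
    (f : (ι → ℂ) → (κ → ℂ)) : Prop :=
  ∃ R : RatMap k ι κ, R.IsBirational V W ∧ Generically V (fun x => f x = R.eval x)

/-- Coordinatewise complex conjugation. -/
def conjPt (x : ι → ℂ) : ι → ℂ := fun i => starRingEnd ℂ (x i)

/-- `T` is (generically on `V`) an involution of `V` whose composition with complex conjugation
is a birational isomorphism from `V` onto the complex conjugate of `V`. -/
structure IsAnticonformalInvolution (V : Set (ι → ℂ)) (T : (ι → ℂ) → (ι → ℂ)) : Prop where
  antibirational : IsBirationalIso ℂ V (conjPt '' V) (conjPt ∘ T)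
  involutive : Generically V (fun x => T x ∈ V ∧ T (T x) = x)

/-- The conjugate `V^σ` of an algebraic set defined over `F ⊆ ℂ`: apply `σ` to the
coefficients of the polynomials over `F` that define `V`. -/
def conjVariety {F : IntermediateField ℚ ℂ} (σ : F ≃ₐ[ℚ] F) (V : Set (ι → ℂ)) : Set (ι → ℂ) :=
  zeroLocus ℂ ((vanishingIdeal F V).map (MvPolynomial.map (σ : F →+* F)))

/-- `g = (g_σ)` is a Weil datum for `V` relative to `F/ℚ`: `V` is defined over `F`, each
`g_σ : V ⇢ V^σ` is a birational isomorphism defined over `F`, and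
`g_{στ} = (g_τ)^σ ∘ g_σ` for all `σ, τ ∈ Gal(F/ℚ)`. -/
structure IsWeilDatum {F : IntermediateField ℚ ℂ} (V : Set (ι → ℂ))
    (g : (F ≃ₐ[ℚ] F) → RatMap F ι ι) : Prop where
  definedOver : DefinedOver F V
  birational : ∀ σ, (g σ).IsBirational V (conjVariety σ V)
  cocycle : ∀ σ τ, Generically V (fun x =>
    (g (σ * τ)).DefinedAt x ∧ (g σ).DefinedAt x ∧
    ((g τ).conj (σ : F →+* F)).DefinedAt ((g σ).eval x) ∧
    (g (σ * τ)).eval x = ((g τ).conj (σ : F →+* F)).eval ((g σ).eval x))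

end General

/-! ## The curve and the explicit maps -/

/-- `ρ = e^{2πi/7}`. -/
def rho : ℂ := Complex.exp (2 * Real.pi * Complex.I / 7)

/-- The field `ℚ(ρ)`. -/
abbrev QRho : IntermediateField ℚ ℂ := IntermediateField.adjoin ℚ {rho}

/-- The field `ℚ(√-7)`. -/
abbrev QSqrtNegSeven : IntermediateField ℚ ℂ :=
  IntermediateField.adjoin ℚ {Complex.I * (Real.sqrt 7 : ℂ)}

/-- Macbeath's equations of the Fricke–Macbeath curve; the coordinates of `p` are
`(x, y₁, y₂, y₄)`. -/
def X : Set (Fin 4 → ℂ) :=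
  {p | p 1 ^ 2 = (p 0 - 1) * (p 0 - rho ^ 3) * (p 0 - rho ^ 5) * (p 0 - rho ^ 6) ∧
    p 2 ^ 2 = (p 0 - rho ^ 2) * (p 0 - rho ^ 4) * (p 0 - rho ^ 5) * (p 0 - rho ^ 6) ∧
    p 3 ^ 2 = (p 0 - rho) * (p 0 - rho ^ 3) * (p 0 - rho ^ 4) * (p 0 - rho ^ 5)}

/-- The anticonformal involution `J` of `X`. -/
def J (p : Fin 4 → ℂ) : Fin 4 → ℂ :=
  let q := conjPt p
  ![1 / q 0, q 1 / q 0 ^ 2, rho ^ 5 * q 2 / q 0 ^ 2, rho ^ 3 * q 3 / q 0 ^ 2]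

/-- The function `y₂ y₄ / ((x - ρ⁴)(x - ρ⁵))` on `X`. -/
def y6 (p : Fin 4 → ℂ) : ℂ := p 2 * p 3 / ((p 0 - rho ^ 4) * (p 0 - rho ^ 5))

/-- The map `L₁*`, with values in `ℂ⁵` with coordinates `(t₁, t₂, t₃, t₇, t₁₁)`. -/
def L1star (p : Fin 4 → ℂ) : Fin 5 → ℂ :=
  ![3 * p 0, 3 * p 1, p 2 + p 3 + y6 p, p 2 ^ 2 + p 3 ^ 2 + y6 p ^ 2,
    p 2 ^ 3 + p 3 ^ 3 + y6 p ^ 3]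

/-- The curve `Z₂ = L₁*(X)`. -/
def Z2 : Set (Fin 5 → ℂ) := closedImage X L1star

/-- The inverse of `L₁* : X ⇢ Z₂` (wherever the latter is injective). -/
def L1starInv : (Fin 5 → ℂ) → (Fin 4 → ℂ) := Function.invFunOn L1star X

/-- `T = L₁* ∘ J ∘ (L₁*)⁻¹`. -/
def T : (Fin 5 → ℂ) → (Fin 5 → ℂ) := L1star ∘ J ∘ L1starInv

/-- `g_η = S ∘ T`, where `S` is coordinatewise complex conjugation. -/
def gEta : (Fin 5 → ℂ) → (Fin 5 → ℂ) := conjPt ∘ T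

/-- `Φ₂(t) = (t, g_η(t))`; affine space `ℂ¹⁰` is written as `Fin 5 ⊕ Fin 5 → ℂ`. -/
def Phi2 (t : Fin 5 → ℂ) : Fin 5 ⊕ Fin 5 → ℂ := Sum.elim t (gEta t)

/-- The curve `Φ₂(Z₂)`. -/
def Phi2Z2 : Set (Fin 5 ⊕ Fin 5 → ℂ) := closedImage Z2 Phi2

open Classical in
/-- The permutation action `Θ₂` of `Gal(ℚ(√-7)/ℚ)` on `ℂ¹⁰`: the identity acts trivially and
the nontrivial element acts by `(t, s) ↦ (s, t)`. -/
def Theta2 (σ : QSqrtNegSeven ≃ₐ[ℚ] QSqrtNegSeven) (x : Fin 5 ⊕ Fin 5 → ℂ) :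
    Fin 5 ⊕ Fin 5 → ℂ :=
  if σ = 1 then x else x ∘ Sum.swap

/-- `Ψ₂(t, s) = (t₁ + s₁, …, t₁₁ + s₁₁, t₁² + s₁², …, t₁₁² + s₁₁²)`. -/
def Psi2 (x : Fin 5 ⊕ Fin 5 → ℂ) : Fin 5 ⊕ Fin 5 → ℂ :=
  Sum.elim (fun i => x (Sum.inl i) + x (Sum.inr i))
    (fun i => x (Sum.inl i) ^ 2 + x (Sum.inr i) ^ 2)

/-- The curve `W = Ψ₂(Φ₂(Z₂))`. -/
def W : Set (Fin 5 ⊕ Fin 5 → ℂ) := closedImage Phi2Z2 Psi2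

/-- `L₂ = Ψ₂ ∘ Φ₂`. -/
def L2 : (Fin 5 → ℂ) → (Fin 5 ⊕ Fin 5 → ℂ) := Psi2 ∘ Phi2

/-- `L = L₂ ∘ L₁*`. -/
def L : (Fin 4 → ℂ) → (Fin 5 ⊕ Fin 5 → ℂ) := L2 ∘ L1star

end FrickeMacbeath

end

/-!
All curves in the statement are images of the Fricke–Macbeath curve `X`: `Z2` of `L1star`,
`Phi2Z2` of `graphPt p = (L1star p, conjL1star p)`, and `W` of `paramW p = Psi2 (graphPt p)`, where
`conjL1star p` is the complex conjugate of `L1star (J p)`. The proof works with the generic point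
`p` of `X`. `IsRatFun k X v g` says that `g p` is a rational expression over `k` in the coordinates
of `v p`; two parametrisations that are rational over `k` in each other give a birational isomorphism
over `k` of the closed images (`isBirational_closedImage`), and generic statements on a closed image
can be tested on `X` (`generically_closedImage_iff`).

*Irreducibility and dimension.* The vanishing ideal of `X` is the kernel of the homomorphism to an
algebraic closure of `ℂ(x)` that sends `y₁, y₂, y₄` to square roots of the three quartics. Each
quartic has a root that the other two do not share, so no product of the quartics is a square, and
the three square roots generate an extension of degree eight (`X_isPrime`). Closed images of `X` are
then irreducible, and they have dimension one because their coordinates are integral over `ℂ[x]`,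
respectively over `ℂ[x + 1 / x]` in the case of `W` (`ringKrullDim_closedImage`).

*Fields of definition.* Let `y(ρ) = y₂`, `y(ρ²) = y₄` and `y(ρ⁴) = y₆`. With the quartic `a r` and
the quadratic polynomial `c r` named `quartic` and `cofactor` below, one has `y(r) ^ 2 = a r` and
`y(r ^ 2) y(r ^ 4) = y(r) c r` for all three `r`. If `s` and `t` are the sums of the `y(r)` and of
their squares, then `y(r) (s + c r) = a r + (s ^ 2 - t) / 2`, so that `y(r)` is one and the same
expression in `r`, `x`, `s`, `t`. This inverts `L1star` over `ℚ(ρ)`. Moreover `ρ, ρ², ρ⁴` are the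
conjugates of `ρ` over `ℚ(√-7)`, hence the sum over `r` of a rational expression in `r` is defined
over `ℚ(√-7)` (`RatFamily.isRatFun_trace_div`). The components of `conjL1star` are such sums
(`isRatFun_conjL1star`), which means that `gEta` is defined over `ℚ(√-7)`. The same works for the
inverse of `L2`, with `y(r)` weighted by `1 + r ^ 2 / x ^ 2`, once `x` is recovered: the coordinates
of `W` give `m = x + 1 / x` and
`y₁ ^ 2 / x ^ 2 = m ^ 2 - 3 - (1 + ω) m + (2 ω + 1) x`, where `ω = ρ + ρ² + ρ⁴` and
`2 ω + 1 = ±√-7 ≠ 0` (`isRatFun_paramW_x`, `isRatFun_paramW_inv`).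

*Descent.* Explicit equations over `ℚ(√-7)`, obtained by the same trace argument, generate the ideal
of `Z2` (`isSpannedOver_Z2`). A linear form `ℂ → ℚ(√-7)` applied to the coefficients of a relation
carries this over to every image of `Z2` under a map over `ℚ(√-7)`, in particular to `W`
(`IsSpannedOver.closedImage`). Since `J` is an involution, `J` exchanges `L1star` and the conjugate
of `conjL1star`. This gives the cocycle condition for the Weil datum, and, as `Psi2` is symmetric,
the stability of `W` under complex conjugation, whence `W` is defined over `ℚ` (`definedOver_rat`).
-/

noncomputable section

namespace FrickeMacbeath

/-! ### Generic properties on irreducible sets -/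

section Generic

variable {ι κ τ : Type} {V : Set (ι → ℂ)} {P Q : (ι → ℂ) → Prop}

/-- On an irreducible set, a dense principal open subset is the same thing as a nonempty one. -/
theorem generically_iff [hV : (vanishingIdeal ℂ V).IsPrime] :
    Generically V P ↔
      ∃ D : MvPolynomial ι ℂ, D ∉ vanishingIdeal ℂ V ∧ ∀ x ∈ V, aeval x D ≠ 0 → P x := by
  constructor
  · rintro ⟨D, hD, h⟩
    refine ⟨D, fun hmem => hV.ne_top ?_, h⟩
    rw [Ideal.eq_top_iff_one]
    intro x hx
    refine hD hx 1 ?_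
    rintro y ⟨hy, hy'⟩
    exact absurd (hmem y hy) hy'
  · rintro ⟨D, hD, h⟩
    refine ⟨D, fun x hx f hf => ?_, h⟩
    have hfD : f * D ∈ vanishingIdeal ℂ V := fun y hy => by
      rw [map_mul]
      by_cases h0 : aeval y D = 0
      · rw [h0, mul_zero]
      · rw [hf y ⟨hy, h0⟩, zero_mul]
    exact ((hV.mem_or_mem hfD).resolve_right hD) x hx

theorem Generically.mono (h : Generically V P) (hPQ : ∀ x ∈ V, P x → Q x) : Generically V Q := by
  obtain ⟨D, hD, h⟩ := h
  exact ⟨D, hD, fun x hx h0 => hPQ x hx (h x hx h0)⟩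

theorem generically_of_forall (h : ∀ x ∈ V, P x) : Generically V P :=
  ⟨1, fun x hx f hf => hf x ⟨hx, by simp⟩, fun x hx _ => h x hx⟩

theorem Generically.and [hV : (vanishingIdeal ℂ V).IsPrime]
    (hP : Generically V P) (hQ : Generically V Q) : Generically V (fun x => P x ∧ Q x) := by
  rw [generically_iff] at *
  obtain ⟨D, hD, hP⟩ := hP
  obtain ⟨E, hE, hQ⟩ := hQ
  refine ⟨D * E, fun h => (hV.mem_or_mem h).elim hD hE, fun x hx h0 => ?_⟩
  rw [map_mul] at h0
  exact ⟨hP x hx (left_ne_zero_of_mul h0), hQ x hx (right_ne_zero_of_mul h0)⟩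

theorem generically_all [(vanishingIdeal ℂ V).IsPrime] {α : Type} [Finite α]
    {R : α → (ι → ℂ) → Prop} (h : ∀ a, Generically V (R a)) :
    Generically V (fun x => ∀ a, R a x) := by
  classical
  have := Fintype.ofFinite α
  have key : ∀ s : Finset α, Generically V (fun x => ∀ a ∈ s, R a x) := by
    intro s
    induction s using Finset.induction_on with
    | empty => exact generically_of_forall (by simp)
    | insert a s _ ih => exact ((h a).and ih).mono fun x _ hx => by simpa using hx
  exact (key Finset.univ).mono fun x _ hx a => hx a (Finset.mem_univ a)

theorem Generically.exists_mem [hV : (vanishingIdeal ℂ V).IsPrime] (h : Generically V P) :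
    ∃ x ∈ V, P x := by
  obtain ⟨D, hD, h⟩ := generically_iff.1 h
  simp only [mem_vanishingIdeal_iff, not_forall] at hD
  obtain ⟨x, hx, h0⟩ := hD
  exact ⟨x, hx, h x hx h0⟩

theorem generically_aeval_ne_zero [(vanishingIdeal ℂ V).IsPrime] {q : MvPolynomial ι ℂ}
    (hq : q ∉ vanishingIdeal ℂ V) : Generically V (fun x => aeval x q ≠ 0) :=
  generically_iff.2 ⟨q, hq, fun _ _ h => h⟩

theorem generically_aeval_eq_zero_iff [(vanishingIdeal ℂ V).IsPrime] {q : MvPolynomial ι ℂ} :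
    Generically V (fun x => aeval x q = 0) ↔ q ∈ vanishingIdeal ℂ V := by
  refine ⟨fun h => ?_, fun h => generically_of_forall h⟩
  by_contra hq
  obtain ⟨x, _, h1, h2⟩ := (h.and (generically_aeval_ne_zero hq)).exists_mem
  exact h2 h1

end Generic

/-! ### Functions that are generically rational in a given map -/

section RatFun

variable {ι κ τ : Type} {V : Set (ι → ℂ)} {k : Type} [Field k] [Algebra k ℂ]

/-- The function `g` agrees, at the generic point `p` of `V`, with a rational expression over `k`
in the coordinates of `v p`. -/
def IsRatFun (k : Type) [Field k] [Algebra k ℂ] (V : Set (ι → ℂ)) (v : (ι → ℂ) → (κ → ℂ))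
    (g : (ι → ℂ) → ℂ) : Prop :=
  ∃ n d : MvPolynomial κ k,
    Generically V (fun p => aeval (v p) d ≠ 0 ∧ g p = aeval (v p) n / aeval (v p) d)

variable {v : (ι → ℂ) → (κ → ℂ)} {g h : (ι → ℂ) → ℂ}

namespace IsRatFun

theorem poly (q : MvPolynomial κ k) : IsRatFun k V v (fun p => aeval (v p) q) :=
  ⟨q, 1, generically_of_forall (by simp)⟩

theorem const (c : k) : IsRatFun k V v (fun _ => algebraMap k ℂ c) := by
  simpa using poly (V := V) (v := v) (C c : MvPolynomial κ k)

theorem natCast (c : ℕ) : IsRatFun k V v (fun _ => (c : ℂ)) := by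
  simpa using const (V := V) (v := v) (c : k)

theorem one : IsRatFun k V v (fun _ => 1) := by
  simpa using natCast (k := k) (V := V) (v := v) 1

theorem coord (i : κ) : IsRatFun k V v (fun p => v p i) := by
  simpa using poly (V := V) (v := v) (MvPolynomial.X i : MvPolynomial κ k)

theorem baseChange {K : Type} [Field K] [Algebra K ℂ] [Algebra k K] [IsScalarTower k K ℂ]
    (hg : IsRatFun k V v g) : IsRatFun K V v g := by
  obtain ⟨n, d, hd⟩ := hg
  exact ⟨map (algebraMap k K) n, map (algebraMap k K) d, by simpa [aeval_map_algebraMap] using hd⟩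

variable [(vanishingIdeal ℂ V).IsPrime]

theorem congr (hg : IsRatFun k V v g) (hgh : Generically V (fun p => h p = g p)) :
    IsRatFun k V v h := by
  obtain ⟨n, d, hd⟩ := hg
  exact ⟨n, d, (hd.and hgh).mono fun p _ hp => ⟨hp.1.1, hp.2.trans hp.1.2⟩⟩

theorem add (hg : IsRatFun k V v g) (hh : IsRatFun k V v h) :
    IsRatFun k V v (fun p => g p + h p) := by
  obtain ⟨n, d, hd⟩ := hg
  obtain ⟨n', d', hd'⟩ := hh
  refine ⟨n * d' + n' * d, d * d', (hd.and hd').mono fun p _ hp => ?_⟩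
  obtain ⟨⟨h1, h2⟩, h3, h4⟩ := hp
  simp only [map_add, map_mul]
  exact ⟨mul_ne_zero h1 h3, by rw [h2, h4]; field_simp⟩

theorem mul (hg : IsRatFun k V v g) (hh : IsRatFun k V v h) :
    IsRatFun k V v (fun p => g p * h p) := by
  obtain ⟨n, d, hd⟩ := hg
  obtain ⟨n', d', hd'⟩ := hh
  refine ⟨n * n', d * d', (hd.and hd').mono fun p _ hp => ?_⟩
  obtain ⟨⟨h1, h2⟩, h3, h4⟩ := hp
  simp only [map_mul]
  exact ⟨mul_ne_zero h1 h3, by rw [h2, h4]; field_simp⟩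

theorem neg (hg : IsRatFun k V v g) : IsRatFun k V v (fun p => -g p) := by
  simpa using (const (V := V) (v := v) (-1 : k)).mul hg

theorem sub (hg : IsRatFun k V v g) (hh : IsRatFun k V v h) :
    IsRatFun k V v (fun p => g p - h p) := by
  simpa [sub_eq_add_neg] using hg.add hh.neg

theorem pow (hg : IsRatFun k V v g) (m : ℕ) : IsRatFun k V v (fun p => g p ^ m) := by
  induction m with
  | zero => simpa using one
  | succ m ih => simpa [pow_succ] using ih.mul hg

theorem inv (hg : IsRatFun k V v g) (h0 : Generically V (fun p => g p ≠ 0)) :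
    IsRatFun k V v (fun p => (g p)⁻¹) := by
  obtain ⟨n, d, hd⟩ := hg
  refine ⟨d, n, (hd.and h0).mono fun p _ hp => ?_⟩
  obtain ⟨⟨h1, h2⟩, h3⟩ := hp
  rw [h2] at h3
  exact ⟨fun h => h3 (by simp [h]), by simp only [h2, inv_div]⟩

theorem div (hg : IsRatFun k V v g) (hh : IsRatFun k V v h)
    (h0 : Generically V (fun p => h p ≠ 0)) : IsRatFun k V v (fun p => g p / h p) := by
  simpa [div_eq_mul_inv] using hg.mul (hh.inv h0)

theorem aeval_comp {w : (ι → ℂ) → (τ → ℂ)} (hw : ∀ i, IsRatFun k V v (fun p => w p i))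
    (q : MvPolynomial τ k) : IsRatFun k V v (fun p => aeval (w p) q) := by
  induction q using MvPolynomial.induction_on with
  | C a => simpa using const a
  | add p q hp hq => simpa using hp.add hq
  | mul_X p i hp => simpa using hp.mul (hw i)

/-- Transitivity: if `g` is rational in `w` and `w` is rational in `v`, then `g` is rational in `v`. -/
theorem trans {w : (ι → ℂ) → (τ → ℂ)} (hg : IsRatFun k V w g)
    (hw : ∀ i, IsRatFun k V v (fun p => w p i)) : IsRatFun k V v g := by
  obtain ⟨n, d, hd⟩ := hg
  exact ((aeval_comp hw n).div (aeval_comp hw d) (hd.mono fun p _ hp => hp.1)).congr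
    (hd.mono fun p _ hp => hp.2)

/-- The dichotomy at the generic point: a rational function vanishes identically or is invertible
on a dense open subset. -/
theorem eq_zero_or_ne_zero (hv : ∀ i, IsRatFun ℂ V id (fun p => v p i)) (hg : IsRatFun k V v g) :
    Generically V (fun p => g p = 0) ∨ Generically V (fun p => g p ≠ 0) := by
  obtain ⟨n, d, hd⟩ := (hg.baseChange (K := ℂ)).trans hv
  by_cases hn : n ∈ vanishingIdeal ℂ V
  · exact Or.inl (hd.mono fun p hp h => by rw [h.2]; simp [hn p hp])
  · refine Or.inr ((hd.and (generically_aeval_ne_zero hn)).mono fun p hp h => ?_)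
    rw [h.1.2]
    exact div_ne_zero h.2 h.1.1

end IsRatFun

/-- The rational expressions for the components of `w` can be put over a common denominator. -/
theorem exists_ratMap [Finite τ] [(vanishingIdeal ℂ V).IsPrime] {w : (ι → ℂ) → (τ → ℂ)}
    (hw : ∀ i, IsRatFun k V v (fun p => w p i)) :
    ∃ R : RatMap k κ τ, Generically V (fun p => R.DefinedAt (v p) ∧ w p = R.eval (v p)) := by
  classical
  have := Fintype.ofFinite τ
  choose n d hd using hw
  refine ⟨⟨fun i => n i * ∏ j ∈ Finset.univ.erase i, d j, ∏ j, d j⟩,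
    (generically_all hd).mono fun p _ hp => ⟨?_, ?_⟩⟩
  · simp only [RatMap.DefinedAt, map_prod]
    exact Finset.prod_ne_zero_iff.2 fun j _ => (hp j).1
  · funext i
    have h1 : ∏ j ∈ Finset.univ.erase i, aeval (v p) (d j) ≠ 0 :=
      Finset.prod_ne_zero_iff.2 fun j _ => (hp j).1
    simp only [RatMap.eval, map_mul, map_prod]
    rw [show w p i = _ from (hp i).2, ← Finset.mul_prod_erase _ _ (Finset.mem_univ i),
      mul_div_mul_right _ _ h1]

/-- Clearing denominators in a polynomial composed with a rational map. -/
theorem RatMap.exists_clear (R : RatMap k κ τ) (q : MvPolynomial τ k) :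
    ∃ (N : MvPolynomial κ k) (n : ℕ), ∀ x : κ → ℂ, R.DefinedAt x →
      aeval x N = aeval x R.den ^ n * aeval (R.eval x) q := by
  induction q using MvPolynomial.induction_on with
  | C a => exact ⟨C a, 0, fun x _ => by simp⟩
  | add p q hp hq =>
    obtain ⟨N, n, h⟩ := hp
    obtain ⟨N', n', h'⟩ := hq
    refine ⟨R.den ^ n' * N + R.den ^ n * N', n + n', fun x hx => ?_⟩
    simp only [map_add, map_mul, map_pow, h x hx, h' x hx]
    ring
  | mul_X p i hp =>
    obtain ⟨N, n, h⟩ := hp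
    refine ⟨N * R.num i, n + 1, fun x hx => ?_⟩
    have hx' : aeval x R.den ≠ 0 := hx
    simp only [map_mul, h x hx, aeval_X, RatMap.eval]
    field_simp
    ring

/-- A polynomial relation between the values of a rational map that holds generically holds at all
points where the map is defined. -/
theorem RatMap.aeval_eval_eq_zero [(vanishingIdeal ℂ V).IsPrime] (R : RatMap ℂ ι τ)
    {q : MvPolynomial τ ℂ}
    (hq : Generically V (fun x => R.DefinedAt x → aeval (R.eval x) q = 0)) {x : ι → ℂ}
    (hx : x ∈ V) (hdef : R.DefinedAt x) : aeval (R.eval x) q = 0 := by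
  obtain ⟨N, n, hN⟩ := R.exists_clear q
  have hN0 : R.den * N ∈ vanishingIdeal ℂ V := by
    rw [← generically_aeval_eq_zero_iff]
    refine hq.mono fun y _ hy => ?_
    rw [map_mul]
    by_cases h : aeval y R.den = 0
    · rw [h, zero_mul]
    · rw [hN y h, hy h, mul_zero, mul_zero]
  have h0 := hN0 x hx
  rw [map_mul, hN x hdef, ← mul_assoc, ← pow_succ'] at h0
  exact (mul_eq_zero.1 h0).resolve_left (pow_ne_zero _ hdef)

end RatFun

/-! ### Closed images -/

section ClosedImage

variable {ι κ τ : Type} {V : Set (ι → ℂ)}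

theorem closedImage_congr [(vanishingIdeal ℂ V).IsPrime] {f g : (ι → ℂ) → (κ → ℂ)}
    (h : Generically V (fun p => f p = g p)) : closedImage V f = closedImage V g := by
  have key : ∀ q : MvPolynomial κ ℂ, Generically V (fun x => aeval (f x) q = 0) ↔
      Generically V (fun x => aeval (g x) q = 0) := fun q =>
    ⟨fun h' => (h.and h').mono fun p _ hp => by rw [← hp.1]; exact hp.2,
      fun h' => (h.and h').mono fun p _ hp => by rw [hp.1]; exact hp.2⟩
  simp only [closedImage, key]

theorem closedImage_id [(vanishingIdeal ℂ V).IsPrime] (hcl : zariskiClosure V = V) :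
    closedImage V (fun p => p) = V := by
  conv_rhs => rw [← hcl]
  simp only [closedImage, generically_aeval_eq_zero_iff]
  rfl

/-- The polynomials that vanish at `f p` for the generic point `p` of `V`. -/
def genericIdeal (V : Set (ι → ℂ)) [(vanishingIdeal ℂ V).IsPrime] (f : (ι → ℂ) → (κ → ℂ)) :
    Ideal (MvPolynomial κ ℂ) where
  carrier := {q | Generically V (fun x => aeval (f x) q = 0)}
  zero_mem' := generically_of_forall (by simp)
  add_mem' h h' := (h.and h').mono fun x _ hx => by rw [map_add, hx.1, hx.2, add_zero]
  smul_mem' c q h := h.mono fun x _ hx => by rw [smul_eq_mul, map_mul, hx, mul_zero]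

theorem closedImage_eq_zeroLocus [(vanishingIdeal ℂ V).IsPrime] (f : (ι → ℂ) → (κ → ℂ)) :
    closedImage V f = zeroLocus ℂ (genericIdeal V f) := rfl

variable [hV : (vanishingIdeal ℂ V).IsPrime] {f : (ι → ℂ) → (κ → ℂ)}

theorem genericIdeal_isPrime (hf : ∀ i, IsRatFun ℂ V id (fun p => f p i)) :
    (genericIdeal V f).IsPrime := by
  refine ⟨fun h => ?_, fun {p q} hpq => ?_⟩
  · have h1 : (1 : MvPolynomial κ ℂ) ∈ genericIdeal V f := by simp [h]
    obtain ⟨x, _, hx⟩ := Generically.exists_mem h1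
    simp at hx
  · rcases (IsRatFun.aeval_comp hf p).eq_zero_or_ne_zero (fun i => IsRatFun.coord i) with h | h
    · exact Or.inl h
    · refine Or.inr ((h.and hpq).mono fun x _ hx => ?_)
      rw [map_mul] at hx
      exact (mul_eq_zero.1 hx.2).resolve_left hx.1

/-- By the Nullstellensatz, as the ideal on the right-hand side is prime. -/
theorem vanishingIdeal_closedImage [Finite κ] (hf : ∀ i, IsRatFun ℂ V id (fun p => f p i)) :
    vanishingIdeal ℂ (closedImage V f) = genericIdeal V f := by
  have := genericIdeal_isPrime hf
  rw [closedImage_eq_zeroLocus, MvPolynomial.IsPrime.vanishingIdeal_zeroLocus]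

theorem closedImage_isPrime [Finite κ] (hf : ∀ i, IsRatFun ℂ V id (fun p => f p i)) :
    (vanishingIdeal ℂ (closedImage V f)).IsPrime := by
  rw [vanishingIdeal_closedImage hf]
  exact genericIdeal_isPrime hf

theorem zariskiClosure_closedImage [Finite κ] (hf : ∀ i, IsRatFun ℂ V id (fun p => f p i)) :
    zariskiClosure (closedImage V f) = closedImage V f := by
  rw [zariskiClosure, vanishingIdeal_closedImage hf, ← closedImage_eq_zeroLocus]

theorem generically_mem_closedImage [Finite κ] (hf : ∀ i, IsRatFun ℂ V id (fun p => f p i)) :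
    Generically V (fun p => f p ∈ closedImage V f) := by
  obtain ⟨R, hR⟩ := exists_ratMap hf
  refine hR.mono fun p hp h q hq => ?_
  rw [h.2]
  refine R.aeval_eval_eq_zero ((hR.and hq).mono fun x _ hx _ => ?_) hp h.1
  obtain ⟨⟨_, h2⟩, h3⟩ := hx
  rwa [h2] at h3

/-- A generic property of the closed image of a birational map can be tested on the source. -/
theorem generically_closedImage_iff [Finite ι] [Finite κ] (hcl : zariskiClosure V = V)
    (hf : ∀ i, IsRatFun ℂ V id (fun p => f p i)) (hfi : ∀ i, IsRatFun ℂ V f (fun p => p i))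
    {P : (κ → ℂ) → Prop} :
    Generically (closedImage V f) P ↔ Generically V (fun p => P (f p)) := by
  have hW := closedImage_isPrime hf
  have hmemW : ∀ q : MvPolynomial κ ℂ, q ∈ vanishingIdeal ℂ (closedImage V f) ↔
      Generically V (fun x => aeval (f x) q = 0) := fun q => by
    rw [vanishingIdeal_closedImage hf]; rfl
  constructor
  · rw [generically_iff]
    rintro ⟨D, hD, h⟩
    have hD' : Generically V (fun x => aeval (f x) D ≠ 0) := by
      refine ((IsRatFun.aeval_comp hf D).eq_zero_or_ne_zero
        (fun i => IsRatFun.coord i)).resolve_left fun h' => hD ((hmemW D).2 h')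
    exact (hD'.and (generically_mem_closedImage hf)).mono fun x _ hx => h _ hx.2 hx.1
  · intro hP
    obtain ⟨R, hR⟩ := exists_ratMap hf
    obtain ⟨H, hH⟩ := exists_ratMap hfi
    obtain ⟨D, hD, hDP⟩ := generically_iff.1 (hR.and hP)
    simp only [id] at hR hDP
    -- polynomial relations between `f x` and `x` extend to all points where `H` is defined
    have rel : ∀ q : MvPolynomial ι ℂ, q ∈ vanishingIdeal ℂ V →
        ∀ y ∈ closedImage V f, H.DefinedAt y → aeval (H.eval y) q = 0 := by
      intro q hq y hy hdef
      obtain ⟨N, n, hN⟩ := H.exists_clear q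
      have hN0 : aeval y N = 0 := by
        refine (hmemW N).2 (hH.mono fun x hx h => ?_) y hy
        rw [hN _ h.1, ← h.2, hq x hx, mul_zero]
      rw [hN y hdef] at hN0
      exact (mul_eq_zero.1 hN0).resolve_left (pow_ne_zero _ hdef)
    have rel' : ∀ i, ∀ y ∈ closedImage V f, H.DefinedAt y →
        aeval (H.eval y) (R.num i) = y i * aeval (H.eval y) R.den := by
      intro i y hy hdef
      obtain ⟨N, n, hN⟩ := H.exists_clear (R.num i)
      obtain ⟨N', n', hN'⟩ := H.exists_clear R.den
      have h0 : aeval y (H.den ^ n' * N - MvPolynomial.X i * H.den ^ n * N') = 0 := by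
        refine (hmemW _).2 ((hH.and hR).mono fun x hx h => ?_) y hy
        obtain ⟨⟨h1, h2⟩, h3, h4⟩ := h
        have h5 : f x i * aeval x R.den = aeval x (R.num i) := by
          have h3' : aeval x R.den ≠ 0 := h3
          rw [h4, RatMap.eval, div_mul_cancel₀ _ h3']
        simp only [map_sub, map_mul, map_pow, aeval_X, hN _ h1, hN' _ h1, ← h2, ← h5]
        ring
      have hdef' : aeval y H.den ≠ 0 := hdef
      simp only [map_sub, map_mul, map_pow, aeval_X, hN _ hdef, hN' _ hdef] at h0
      have h6 : aeval y H.den ^ (n + n') *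
          (aeval (H.eval y) (R.num i) - y i * aeval (H.eval y) R.den) = 0 := by
        rw [← h0]; ring
      exact sub_eq_zero.1 ((mul_eq_zero.1 h6).resolve_left (pow_ne_zero _ hdef'))
    obtain ⟨N, n, hN⟩ := H.exists_clear D
    obtain ⟨N', n', hN'⟩ := H.exists_clear R.den
    refine generically_iff.2 ⟨H.den * N * N', fun hmem => ?_, fun y hy h0 => ?_⟩
    · obtain ⟨x, hx, ⟨⟨⟨h1, h2⟩, h3⟩, h4⟩, h5⟩ :=
        (((hH.and hR).and (generically_aeval_ne_zero hD)).and ((hmemW _).1 hmem)).exists_mem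
      have h1' : aeval (f x) H.den ≠ 0 := h1
      simp only [map_mul, hN _ h1, hN' _ h1, ← h2] at h5
      refine absurd h5 (mul_ne_zero (mul_ne_zero h1' (mul_ne_zero (pow_ne_zero _ h1') h4))
        (mul_ne_zero (pow_ne_zero _ h1') h3.1))
    · simp only [map_mul] at h0
      have hdef : H.DefinedAt y := left_ne_zero_of_mul (left_ne_zero_of_mul h0)
      rw [hN _ hdef, hN' _ hdef] at h0
      have hD0 := right_ne_zero_of_mul (right_ne_zero_of_mul (left_ne_zero_of_mul h0))
      have hR0 := right_ne_zero_of_mul (right_ne_zero_of_mul h0)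
      have hmem : H.eval y ∈ V := by
        rw [← hcl]
        exact fun q hq => rel q hq y hy hdef
      obtain ⟨⟨_, h2⟩, h3⟩ := hDP _ hmem hD0
      have : f (H.eval y) = y := by
        rw [h2]
        funext i
        rw [RatMap.eval, rel' i y hy hdef, mul_div_cancel_right₀ _ hR0]
      rwa [this] at h3

/-- Two rational parametrisations `v`, `w` of curves by `V`, each of which is rational over `k`
in the other, give a birational isomorphism over `k` between the closed images. -/
theorem isBirational_closedImage [Finite ι] [Finite κ] [Finite τ] {k : Type} [Field k]
    [Algebra k ℂ] (hcl : zariskiClosure V = V) {v : (ι → ℂ) → (κ → ℂ)} {w : (ι → ℂ) → (τ → ℂ)}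
    (hv : ∀ i, IsRatFun ℂ V id (fun p => v p i)) (hvi : ∀ i, IsRatFun ℂ V v (fun p => p i))
    {R : RatMap k κ τ} {H : RatMap k τ κ}
    (hR : Generically V (fun p => R.DefinedAt (v p) ∧ w p = R.eval (v p)))
    (hH : Generically V (fun p => H.DefinedAt (w p) ∧ v p = H.eval (w p))) :
    R.IsBirational (closedImage V v) (closedImage V w) := by
  have hwv : ∀ i, IsRatFun k V v (fun p => w p i) := fun i =>
    ⟨R.num i, R.den, hR.mono fun p _ h => ⟨h.1, congrFun h.2 i⟩⟩
  have hvw : ∀ i, IsRatFun k V w (fun p => v p i) := fun i =>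
    ⟨H.num i, H.den, hH.mono fun p _ h => ⟨h.1, congrFun h.2 i⟩⟩
  have hw : ∀ i, IsRatFun ℂ V id (fun p => w p i) := fun i => ((hwv i).baseChange).trans hv
  have hwi : ∀ i, IsRatFun ℂ V w (fun p => p i) := fun i =>
    (hvi i).trans fun j => (hvw j).baseChange
  have hmv := generically_mem_closedImage hv
  have hmw := generically_mem_closedImage hw
  refine ⟨H, (generically_closedImage_iff hcl hv hvi).2 ?_,
    (generically_closedImage_iff hcl hw hwi).2 ?_⟩
  · refine ((hR.and hH).and (hmv.and hmw)).mono fun p _ h => ?_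
    obtain ⟨⟨⟨h1, h2⟩, h3, h4⟩, h5, h6⟩ := h
    rw [← h2, ← h4]
    exact ⟨h1, h6, h3, rfl⟩
  · refine ((hR.and hH).and (hmv.and hmw)).mono fun p _ h => ?_
    obtain ⟨⟨⟨h1, h2⟩, h3, h4⟩, h5, h6⟩ := h
    rw [← h4, ← h2]
    exact ⟨h3, h5, h1, rfl⟩

/-- The version of `isBirational_closedImage` for a function `f` that carries `v p` to `w p` at the
generic point `p`. -/
theorem isBirationalIso_closedImage [Finite ι] [Finite κ] [Finite τ] {k : Type} [Field k]
    [Algebra k ℂ] (hcl : zariskiClosure V = V) {v : (ι → ℂ) → (κ → ℂ)} {w : (ι → ℂ) → (τ → ℂ)}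
    (hv : ∀ i, IsRatFun ℂ V id (fun p => v p i)) (hvi : ∀ i, IsRatFun ℂ V v (fun p => p i))
    (hwv : ∀ i, IsRatFun k V v (fun p => w p i)) (hvw : ∀ i, IsRatFun k V w (fun p => v p i))
    {f : (κ → ℂ) → (τ → ℂ)} (hf : Generically V (fun p => f (v p) = w p)) :
    IsBirationalIso k (closedImage V v) (closedImage V w) f := by
  obtain ⟨R, hR⟩ := exists_ratMap hwv
  obtain ⟨H, hH⟩ := exists_ratMap hvw
  exact ⟨R, isBirational_closedImage hcl hv hvi hR hH, (generically_closedImage_iff hcl hv hvi).2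
    ((hf.and hR).mono fun p _ h => h.1.trans h.2.2)⟩

theorem closedImage_closedImage [Finite ι] [Finite κ] (hcl : zariskiClosure V = V)
    {v : (ι → ℂ) → (κ → ℂ)} (hv : ∀ i, IsRatFun ℂ V id (fun p => v p i))
    (hvi : ∀ i, IsRatFun ℂ V v (fun p => p i)) (g : (κ → ℂ) → (τ → ℂ)) :
    closedImage (closedImage V v) g = closedImage V (fun p => g (v p)) := by
  refine Set.ext fun y => forall_congr' fun q => ?_
  rw [← generically_closedImage_iff (P := fun t => aeval (g t) q = 0) hcl hv hvi]

end ClosedImage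

/-! ### Complex conjugation of parametrised curves -/

section Conj

variable {ι κ τ : Type} {k : Type} [Field k] [Algebra k ℂ]

theorem conjPt_conjPt (x : ι → ℂ) : conjPt (conjPt x) = x := by
  funext i
  simp [conjPt]

theorem mem_conjPt_image {V : Set (ι → ℂ)} {y : ι → ℂ} : y ∈ conjPt '' V ↔ conjPt y ∈ V :=
  ⟨by rintro ⟨x, hx, rfl⟩; rwa [conjPt_conjPt], fun h => ⟨_, h, conjPt_conjPt y⟩⟩

theorem aeval_conjPt {η : k →+* k}
    (hη : ∀ z, algebraMap k ℂ (η z) = starRingEnd ℂ (algebraMap k ℂ z))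
    (q : MvPolynomial κ k) (x : κ → ℂ) :
    aeval (conjPt x) (map η q) = starRingEnd ℂ (aeval x q) := by
  induction q using MvPolynomial.induction_on with
  | C a => simp [hη]
  | add p q hp hq => simp only [map_add, hp, hq]
  | mul_X p i hp => simp only [map_mul, hp, map_X, aeval_X]; rfl

theorem aeval_conjPt_complex (q : MvPolynomial κ ℂ) (x : κ → ℂ) :
    aeval (conjPt x) (map (starRingEnd ℂ) q) = starRingEnd ℂ (aeval x q) :=
  aeval_conjPt (fun _ => rfl) q x

variable {V : Set (ι → ℂ)} {J : (ι → ℂ) → (ι → ℂ)}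

/-- Conjugation of a rationality statement: the coefficients are conjugated by `η`, and composition
with the anticonformal map `J` turns conjugates of functions into functions. -/
theorem IsRatFun.conj {η : k →+* k}
    (hη : ∀ z, algebraMap k ℂ (η z) = starRingEnd ℂ (algebraMap k ℂ z))
    (hJ : ∀ P : (ι → ℂ) → Prop, Generically V P → Generically V (fun x => P (J x)))
    {v : (ι → ℂ) → (κ → ℂ)} {g : (ι → ℂ) → ℂ} (hg : IsRatFun k V v g) :
    IsRatFun k V (fun x => conjPt (v (J x))) (fun x => starRingEnd ℂ (g (J x))) := by
  obtain ⟨n, d, hd⟩ := hg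
  refine ⟨map η n, map η d, (hJ _ hd).mono fun x _ hx => ?_⟩
  rw [aeval_conjPt hη, aeval_conjPt hη, ← map_div₀, ← hx.2]
  exact ⟨(map_ne_zero _).2 hx.1, rfl⟩

variable [hV : (vanishingIdeal ℂ V).IsPrime]

/-- An involution of a principal open subset, given by the conjugates of rational functions that
are regular there, preserves generic properties. -/
theorem Generically.comp_antirational (R : RatMap ℂ ι ι) {E : MvPolynomial ι ℂ}
    (hE : E ∉ vanishingIdeal ℂ V)
    (hJ : ∀ x ∈ V, aeval x E ≠ 0 → J x ∈ V ∧ aeval (J x) E ≠ 0 ∧ J (J x) = x ∧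
      R.DefinedAt x ∧ conjPt (J x) = R.eval x)
    {P : (ι → ℂ) → Prop} (hP : Generically V P) : Generically V (fun x => P (J x)) := by
  obtain ⟨D, hD, hDP⟩ := generically_iff.1 hP
  obtain ⟨N, n, hN⟩ := R.exists_clear (map (starRingEnd ℂ) D)
  have key : ∀ x ∈ V, aeval x E ≠ 0 →
      aeval x N = aeval x R.den ^ n * starRingEnd ℂ (aeval (J x) D) := fun x hx h0 => by
    obtain ⟨_, _, _, h4, h5⟩ := hJ x hx h0
    rw [hN x h4, ← h5, aeval_conjPt_complex]
  refine generically_iff.2 ⟨N * E, fun hmem => ?_, fun x hx h0 => ?_⟩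
  · obtain ⟨x, hx, h1, h2⟩ :=
      ((generically_aeval_ne_zero hD).and (generically_aeval_ne_zero hE)).exists_mem
    obtain ⟨h3, h4, h5, _, _⟩ := hJ x hx h2
    have h6 := hmem _ h3
    rw [map_mul, key _ h3 h4, h5] at h6
    have h7 : aeval (J x) R.den ≠ 0 := (hJ _ h3 h4).2.2.2.1
    exact mul_ne_zero (mul_ne_zero (pow_ne_zero _ h7) ((map_ne_zero _).2 h1)) h4 h6
  · rw [map_mul] at h0
    have hE0 := right_ne_zero_of_mul h0
    have hN0 := left_ne_zero_of_mul h0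
    rw [key x hx hE0] at hN0
    exact hDP _ (hJ x hx hE0).1 ((map_ne_zero _).1 (right_ne_zero_of_mul hN0))

/-- The complex conjugate of a curve parametrised by `v` is parametrised by the conjugate of
`v ∘ J`, for an anticonformal involution `J` of the source. -/
theorem conjPt_image_closedImage
    (hJ : ∀ P : (ι → ℂ) → Prop, Generically V P → Generically V (fun x => P (J x)))
    (hJJ : Generically V (fun x => J (J x) = x)) (v : (ι → ℂ) → (κ → ℂ)) :
    conjPt '' closedImage V v = closedImage V (fun x => conjPt (v (J x))) := by
  ext y
  rw [mem_conjPt_image]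
  have hmm : ∀ q : MvPolynomial κ ℂ, map (starRingEnd ℂ) (map (starRingEnd ℂ) q) = q := fun q => by
    rw [map_map]
    convert map_id q
    ext z
    simp
  constructor
  · intro h q hq
    have h1 : Generically V (fun x => aeval (v x) (map (starRingEnd ℂ) q) = 0) := by
      refine ((hJ _ hq).and hJJ).mono fun x _ hx => ?_
      obtain ⟨h1, h2⟩ := hx
      simp only [h2] at h1
      rw [← hmm q, aeval_conjPt_complex] at h1
      exact (map_eq_zero _).1 h1
    have h2 := h _ h1
    rw [aeval_conjPt_complex] at h2
    exact (map_eq_zero _).1 h2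
  · intro h q hq
    have h1 : Generically V (fun x => aeval (conjPt (v (J x))) (map (starRingEnd ℂ) q) = 0) := by
      refine (hJ _ hq).mono fun x _ hx => ?_
      rw [aeval_conjPt_complex, hx, map_zero]
    have h2 := h _ h1
    rw [← conjPt_conjPt y, aeval_conjPt_complex] at h2
    exact (map_eq_zero _).1 h2

end Conj

/-! ### Ideals spanned by polynomials over a subfield -/

section Descent

variable {ι κ τ : Type} {k : Type} [Field k] [Algebra k ℂ]

/-- Application of a `k`-linear form to the coefficients of a polynomial. -/
def coeffForm (l : ℂ →ₗ[k] k) (p : MvPolynomial κ ℂ) : MvPolynomial κ k :=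
  ∑ m ∈ p.support, monomial m (l (coeff m p))

theorem coeff_coeffForm (l : ℂ →ₗ[k] k) (p : MvPolynomial κ ℂ) (m : κ →₀ ℕ) :
    coeff m (coeffForm l p) = l (coeff m p) := by
  classical
  simp only [coeffForm, coeff_sum, coeff_monomial, Finset.sum_ite_eq', mem_support_iff]
  split_ifs with h
  · rfl
  · rw [not_not.1 h, map_zero]

theorem coeffForm_add (l : ℂ →ₗ[k] k) (p q : MvPolynomial κ ℂ) :
    coeffForm l (p + q) = coeffForm l p + coeffForm l q := by
  ext m
  simp [coeff_coeffForm]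

theorem coeffForm_mul_map (l : ℂ →ₗ[k] k) (p : MvPolynomial κ ℂ) (h : MvPolynomial κ k) :
    coeffForm l (p * map (algebraMap k ℂ) h) = coeffForm l p * h := by
  classical
  ext m
  rw [coeff_coeffForm, coeff_mul, coeff_mul, map_sum l]
  refine Finset.sum_congr rfl fun x _ => ?_
  rw [coeff_map, coeff_coeffForm, mul_comm, ← Algebra.smul_def, map_smul, smul_eq_mul, mul_comm]

/-- An ideal generated over `k` is stable under `k`-linear forms applied to coefficients; this is
the form of faithful flatness that descends relations from `ℂ` to `k`. -/
theorem coeffForm_mem (l : ℂ →ₗ[k] k) {I : Ideal (MvPolynomial κ k)} {p : MvPolynomial κ ℂ}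
    (hp : p ∈ I.map (map (algebraMap k ℂ))) : coeffForm l p ∈ I := by
  have h0 : coeffForm l (0 : MvPolynomial κ ℂ) = 0 := by simp [coeffForm]
  have h : ∀ c : MvPolynomial κ ℂ, coeffForm l (c * p) ∈ I := by
    refine Submodule.span_induction (p := fun p _ => ∀ c, coeffForm l (c * p) ∈ I)
      ?_ ?_ ?_ ?_ hp
    · rintro _ ⟨q, hq, rfl⟩ c
      rw [coeffForm_mul_map]
      exact I.mul_mem_left _ hq
    · intro c
      rw [mul_zero, h0]
      exact I.zero_mem
    · intro x y _ _ hx hy c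
      rw [mul_add, coeffForm_add]
      exact I.add_mem (hx c) (hy c)
    · intro a x _ hx c
      rw [smul_eq_mul, ← mul_assoc]
      exact hx _
  simpa using h 1

theorem exists_basis_expansion {β : Type} (B : Module.Basis β k ℂ) (f : MvPolynomial κ ℂ) :
    ∃ s : Finset β, f = ∑ b ∈ s, C (B b) * map (algebraMap k ℂ) (coeffForm (B.coord b) f) := by
  classical
  refine ⟨f.support.biUnion fun m => (B.repr (coeff m f)).support, ?_⟩
  ext m
  simp only [coeff_sum, coeff_C_mul, coeff_map, coeff_coeffForm]
  by_cases hm : m ∈ f.support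
  · conv_lhs => rw [← B.linearCombination_repr (coeff m f)]
    rw [Finsupp.linearCombination_apply, Finsupp.sum]
    have hsub : (B.repr (coeff m f)).support ⊆
        f.support.biUnion fun m => (B.repr (coeff m f)).support :=
      fun b hb => Finset.mem_biUnion.2 ⟨m, hm, hb⟩
    rw [Finset.sum_subset hsub fun b _ hb => by rw [Finsupp.notMem_support_iff.1 hb, zero_smul]]
    refine Finset.sum_congr rfl fun b _ => ?_
    rw [Algebra.smul_def, mul_comm, Module.Basis.coord_apply]
  · rw [notMem_support_iff.1 hm]
    simp

theorem mem_of_sum_basis_mem {β : Type} (B : Module.Basis β k ℂ) {I : Ideal (MvPolynomial κ k)}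
    {s : Finset β} {P : β → MvPolynomial κ k}
    (h : ∑ b ∈ s, C (B b) * map (algebraMap k ℂ) (P b) ∈ I.map (map (algebraMap k ℂ)))
    {b : β} (hb : b ∈ s) : P b ∈ I := by
  classical
  have h1 := coeffForm_mem (B.coord b) h
  have h2 : coeffForm (B.coord b) (∑ b ∈ s, C (B b) * map (algebraMap k ℂ) (P b)) = P b := by
    ext m
    simp only [coeff_coeffForm, coeff_sum, coeff_C_mul, coeff_map, map_sum]
    rw [Finset.sum_eq_single_of_mem b hb]
    · rw [mul_comm, ← Algebra.smul_def, map_smul]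
      simp
    · intro c _ hc
      rw [mul_comm, ← Algebra.smul_def, map_smul, Module.Basis.coord_apply, B.repr_self,
        Finsupp.single_eq_of_ne (Ne.symm hc), smul_zero]
  rwa [h2] at h1

/-- The vanishing ideal of `V` is generated by polynomials with coefficients in `k`. -/
def IsSpannedOver (k : Type) [Field k] [Algebra k ℂ] (V : Set (ι → ℂ)) : Prop :=
  vanishingIdeal ℂ V ≤ (vanishingIdeal k V).map (map (algebraMap k ℂ))

theorem IsSpannedOver.definedOver {V : Set (ι → ℂ)} (h : IsSpannedOver k V)
    (hcl : zariskiClosure V = V) : DefinedOver k V := by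
  refine ⟨vanishingIdeal k V, Set.Subset.antisymm (zeroLocus_vanishingIdeal_le V) fun x hx => ?_⟩
  rw [← hcl]
  intro f hf
  have h1 : (vanishingIdeal k V).map (map (algebraMap k ℂ)) ≤
      RingHom.ker (aeval (R := ℂ) x : MvPolynomial ι ℂ →ₐ[ℂ] ℂ) := by
    rw [Ideal.map_le_iff_le_comap]
    intro q hq
    rw [Ideal.mem_comap, RingHom.mem_ker, aeval_map_algebraMap]
    exact hx q hq
  exact h1 (h hf)

/-- If the closed image of `v` is spanned over `k`, so is that of every map that is rational over
`k` in terms of `v`: apply `k`-linear forms to the coefficients of a relation. -/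
theorem IsSpannedOver.closedImage {V : Set (ι → ℂ)} [(vanishingIdeal ℂ V).IsPrime]
    [Finite κ] [Finite τ] {v : (ι → ℂ) → (κ → ℂ)} {w : (ι → ℂ) → (τ → ℂ)}
    (hv : ∀ i, IsRatFun ℂ V id (fun p => v p i)) (hw : ∀ i, IsRatFun k V v (fun p => w p i))
    (h : IsSpannedOver k (closedImage V v)) : IsSpannedOver k (closedImage V w) := by
  classical
  have hw' : ∀ i, IsRatFun ℂ V id (fun p => w p i) := fun i => (hw i).baseChange.trans hv
  intro f hf
  rw [vanishingIdeal_closedImage hw'] at hf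
  let B := Module.Basis.ofVectorSpace k ℂ
  obtain ⟨s, hs⟩ := exists_basis_expansion B f
  obtain ⟨R, hR⟩ := exists_ratMap (τ := s) (k := k) (V := V) (v := v)
    (w := fun p b => aeval (w p) (coeffForm (B.coord (b : _)) f))
    fun b => IsRatFun.aeval_comp hw _
  let P := fun b => if hb : b ∈ s then R.num ⟨b, hb⟩ else 0
  have h1 : ∑ b ∈ s, C (B b) * map (algebraMap k ℂ) (P b) ∈
      vanishingIdeal ℂ (FrickeMacbeath.closedImage V v) := by
    rw [vanishingIdeal_closedImage hv]
    refine (Generically.and hf hR).mono fun p _ hp => ?_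
    obtain ⟨hf, hden, hp⟩ := hp
    have hden' : aeval (v p) R.den ≠ 0 := hden
    rw [hs, map_sum] at hf
    rw [map_sum, ← mul_zero (aeval (v p) R.den), ← hf, Finset.mul_sum]
    refine Finset.sum_congr rfl fun b hb => ?_
    have := congrFun hp ⟨b, hb⟩
    simp only [RatMap.eval, eq_div_iff hden'] at this
    simp only [map_mul, aeval_C, aeval_map_algebraMap, P, dif_pos hb, ← this]
    ring
  have h2 : ∀ b ∈ s, coeffForm (B.coord b) f ∈ vanishingIdeal k (FrickeMacbeath.closedImage V w) := by
    intro b hb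
    have h3 := mem_of_sum_basis_mem B (h h1) hb
    simp only [P, dif_pos hb] at h3
    have h4 : Generically V (fun p => v p ∈ FrickeMacbeath.closedImage V v) :=
      generically_mem_closedImage hv
    have h5 : map (algebraMap k ℂ) (coeffForm (B.coord b) f) ∈ genericIdeal V w := by
      refine (h4.and hR).mono fun p _ hp => ?_
      obtain ⟨hp1, _, hp2⟩ := hp
      rw [aeval_map_algebraMap]
      have := congrFun hp2 ⟨b, hb⟩
      simp only [RatMap.eval] at this
      rw [this, h3 _ hp1, zero_div]
    rw [← vanishingIdeal_closedImage hw'] at h5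
    intro y hy
    have := h5 y hy
    rwa [aeval_map_algebraMap] at this
  rw [hs]
  exact Ideal.sum_mem _ fun b hb => Ideal.mul_mem_left _ _ (Ideal.mem_map_of_mem _ (h2 b hb))

end Descent

/-! ### Dimension -/

section Dimension

/-- A domain that is integral over `ℂ[T]` and contains it has dimension one. -/
theorem ringKrullDim_eq_one_of_isIntegral {A : Type} [CommRing A] [IsDomain A]
    [Algebra (Polynomial ℂ) A] [Algebra.IsIntegral (Polynomial ℂ) A]
    (hinj : Function.Injective (algebraMap (Polynomial ℂ) A)) : ringKrullDim A = 1 := by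
  have hle : Ring.KrullDimLE 1 A := by
    refine Ring.krullDimLE_one_iff_of_noZeroDivisors.2 fun I hI hp => ?_
    refine Ideal.isMaximal_of_isIntegral_of_isMaximal_comap (R := Polynomial ℂ) I ?_
    have h1 : I.comap (algebraMap (Polynomial ℂ) A) ≠ ⊥ := fun h =>
      hI (Ideal.eq_bot_of_comap_eq_bot h)
    have h2 := Ideal.comap_isPrime (algebraMap (Polynomial ℂ) A) I
    exact Ideal.IsPrime.isMaximal h2 h1
  refine eq_of_le_of_not_lt ?_ fun h => ?_
  · rw [← Nat.cast_one, ← Ring.krullDimLE_iff]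
    exact hle
  · have h' : ringKrullDim A ≤ 0 := Order.le_of_lt_succ h
    rw [← Nat.cast_zero, ← Ring.krullDimLE_iff] at h'
    exact Polynomial.not_isField ℂ
      (isField_of_isIntegral_of_isField hinj Ring.KrullDimLE.isField_of_isDomain)

variable {ι κ : Type}

/-- Evaluation of polynomials in one variable at a function `T` on `U`. -/
def evalAt (U : Set (ι → ℂ)) (T : (ι → ℂ) → ℂ) : Polynomial ℂ →+* (U → ℂ) :=
  RingHom.pi fun p => Polynomial.evalRingHom (T p)

/-- The closed image of `w` has dimension one if the components of `w` are integral over the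
polynomials in one of them, say `T`, which satisfies no polynomial equation. -/
theorem ringKrullDim_closedImage {V : Set (ι → ℂ)} [(vanishingIdeal ℂ V).IsPrime] [Finite κ]
    {w : (ι → ℂ) → (κ → ℂ)} (hw : ∀ i, IsRatFun ℂ V id (fun p => w p i)) (j : κ)
    (htr : ∀ f : Polynomial ℂ, f ≠ 0 → Generically V (fun p => f.eval (w p j) ≠ 0))
    {P : (ι → ℂ) → Prop} (hP : Generically V P)
    (hint : ∀ U : Set (ι → ℂ), (∀ p ∈ U, p ∈ V ∧ P p) → ∀ i,
      (evalAt U (fun p => w p j)).IsIntegralElem (fun p => w p i)) :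
    ringKrullDim (MvPolynomial κ ℂ ⧸ vanishingIdeal ℂ (closedImage V w)) = 1 := by
  obtain ⟨R, hR⟩ := exists_ratMap hw
  obtain ⟨D, hD, hDP⟩ := generically_iff.1 (hR.and hP)
  let U : Set (ι → ℂ) := {p | p ∈ V ∧ aeval p D ≠ 0}
  have hgen : ∀ q : MvPolynomial κ ℂ, q ∈ vanishingIdeal ℂ (closedImage V w) ↔
      ∀ p ∈ U, aeval (w p) q = 0 := by
    intro q
    rw [vanishingIdeal_closedImage hw]
    constructor
    · intro hq p hp
      obtain ⟨⟨h1, h2⟩, _⟩ := hDP p hp.1 hp.2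
      rw [h2]
      refine R.aeval_eval_eq_zero ((hR.and hq).mono fun x _ hx _ => ?_) hp.1 h1
      obtain ⟨⟨_, h2⟩, h3⟩ := hx
      rwa [h2] at h3
    · intro h
      exact generically_iff.2 ⟨D, hD, fun p hp h0 => h p ⟨hp, h0⟩⟩
  have hprime := closedImage_isPrime hw
  let A := MvPolynomial κ ℂ ⧸ vanishingIdeal ℂ (closedImage V w)
  let ψ : MvPolynomial κ ℂ →+* (U → ℂ) :=
    RingHom.pi fun p => (aeval (R := ℂ) (w p) : MvPolynomial κ ℂ →ₐ[ℂ] ℂ).toRingHom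
  have hψ : ∀ q, q ∈ vanishingIdeal ℂ (closedImage V w) → ψ q = 0 := fun q hq => by
    funext p
    exact (hgen q).1 hq p p.2
  let φ : A →+* (U → ℂ) := Ideal.Quotient.lift _ ψ hψ
  have hφmk : ∀ (q : MvPolynomial κ ℂ) (p : U),
      φ (Ideal.Quotient.mk _ q) p = aeval (w p) q := fun _ _ => rfl
  have hφ : Function.Injective φ := by
    rw [injective_iff_map_eq_zero]
    intro a ha
    obtain ⟨q, rfl⟩ := Ideal.Quotient.mk_surjective a
    rw [Ideal.Quotient.eq_zero_iff_mem, hgen]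
    intro p hp
    exact congrFun ha ⟨p, hp⟩
  let e : Polynomial ℂ →+* A :=
    (Polynomial.aeval (Ideal.Quotient.mk (vanishingIdeal ℂ (closedImage V w))
      (MvPolynomial.X j))).toRingHom
  have hφe : φ.comp e = evalAt U (fun p => w p j) := by
    refine Polynomial.ringHom_ext (fun a => ?_) ?_
    · funext p
      have : e (Polynomial.C a) = Ideal.Quotient.mk _ (C a) := by
        simp only [e, AlgHom.toRingHom_eq_coe, RingHom.coe_coe, Polynomial.aeval_C]
        rfl
      rw [RingHom.comp_apply, this, hφmk]
      simp [evalAt]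
    · funext p
      have : e Polynomial.X = Ideal.Quotient.mk _ (MvPolynomial.X j) := by simp [e]
      rw [RingHom.comp_apply, this, hφmk]
      simp [evalAt]
  let _ : Algebra (Polynomial ℂ) A := e.toAlgebra
  have hinte : ∀ a : A, e.IsIntegralElem a := by
    intro a
    obtain ⟨q, rfl⟩ := Ideal.Quotient.mk_surjective a
    induction q using MvPolynomial.induction_on with
    | C a =>
      have : Ideal.Quotient.mk (vanishingIdeal ℂ (closedImage V w)) (C a) = e (Polynomial.C a) := by
        simp only [e, AlgHom.toRingHom_eq_coe, RingHom.coe_coe, Polynomial.aeval_C]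
        rfl
      rw [this]
      exact RingHom.isIntegralElem_map e
    | add p q hp hq => rw [map_add]; exact hp.add _ hq
    | mul_X p i hp =>
      rw [map_mul]
      refine hp.mul _ ?_
      obtain ⟨f, hf, hf0⟩ := hint U (fun p hp => ⟨hp.1, (hDP p hp.1 hp.2).2⟩) i
      refine ⟨f, hf, hφ ?_⟩
      rw [Polynomial.hom_eval₂, hφe, map_zero]
      have : φ (Ideal.Quotient.mk _ (MvPolynomial.X i)) = fun p : U => w p i := by
        funext p
        rw [hφmk, aeval_X]
      rw [this]
      exact hf0
  have : Algebra.IsIntegral (Polynomial ℂ) A := ⟨hinte⟩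
  refine ringKrullDim_eq_one_of_isIntegral ((injective_iff_map_eq_zero _).2 fun f hf => ?_)
  by_contra h0
  obtain ⟨p, hp, h1, h2⟩ := ((htr f h0).and (generically_aeval_ne_zero hD)).exists_mem
  have h3 : φ (e f) = 0 := by
    have : e f = 0 := hf
    rw [this, map_zero]
  have h4 := congrFun (DFunLike.congr_fun hφe f) ⟨p, hp, h2⟩
  rw [RingHom.comp_apply, h3] at h4
  exact h1 h4.symm

end Dimension

/-! ### Seventh roots of unity -/

theorem rho_isPrimitiveRoot : IsPrimitiveRoot rho 7 := by
  simpa [rho] using Complex.isPrimitiveRoot_exp 7 (by norm_num)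

theorem rho_pow_seven : rho ^ 7 = 1 := rho_isPrimitiveRoot.pow_eq_one

theorem rho_ne_zero : rho ≠ 0 := rho_isPrimitiveRoot.ne_zero (by norm_num)

theorem rho_pow_ne {i j : ℕ} (hi : i < 7) (hj : j < 7) (hij : i ≠ j) : rho ^ i ≠ rho ^ j :=
  fun h => hij (rho_isPrimitiveRoot.pow_inj hi hj h)

theorem rho_sub_ne {i j : ℕ} (hi : i < 7) (hj : j < 7) (hij : i ≠ j) : rho ^ i - rho ^ j ≠ 0 :=
  sub_ne_zero.2 (rho_pow_ne hi hj hij)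

theorem rho_cyclotomic : 1 + rho + rho ^ 2 + rho ^ 3 + rho ^ 4 + rho ^ 5 + rho ^ 6 = 0 := by
  have h := rho_pow_seven
  have h1 : rho - 1 ≠ 0 := by simpa using rho_sub_ne (i := 1) (j := 0) (by simp) (by simp) (by simp)
  refine (mul_eq_zero.1 (?_ : (rho - 1) * _ = 0)).resolve_left h1
  linear_combination h

/-! ### Towers of quadratic extensions -/

section Quadratic

variable {Ω : Type*} [Field Ω]

/-- The field `M(v)` for `v ^ 2 ∈ M`. -/
def quadExt (M : Subfield Ω) (v : Ω) (hv : v ^ 2 ∈ M) : Subfield Ω where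
  carrier := {z | ∃ a ∈ M, ∃ b ∈ M, z = a + b * v}
  zero_mem' := ⟨0, M.zero_mem, 0, M.zero_mem, by ring⟩
  one_mem' := ⟨1, M.one_mem, 0, M.zero_mem, by ring⟩
  add_mem' := by
    rintro _ _ ⟨a, ha, b, hb, rfl⟩ ⟨c, hc, d, hd, rfl⟩
    exact ⟨a + c, M.add_mem ha hc, b + d, M.add_mem hb hd, by ring⟩
  mul_mem' := by
    rintro _ _ ⟨a, ha, b, hb, rfl⟩ ⟨c, hc, d, hd, rfl⟩
    exact ⟨a * c + b * d * v ^ 2, M.add_mem (M.mul_mem ha hc) (M.mul_mem (M.mul_mem hb hd) hv),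
      a * d + b * c, M.add_mem (M.mul_mem ha hd) (M.mul_mem hb hc), by ring⟩
  neg_mem' := by
    rintro _ ⟨a, ha, b, hb, rfl⟩
    exact ⟨-a, M.neg_mem ha, -b, M.neg_mem hb, by ring⟩
  inv_mem' := by
    rintro _ ⟨a, ha, b, hb, rfl⟩
    by_cases hvM : v ∈ M
    · exact ⟨_, M.inv_mem (M.add_mem ha (M.mul_mem hb hvM)), 0, M.zero_mem, by ring⟩
    by_cases h0 : a + b * v = 0
    · exact ⟨0, M.zero_mem, 0, M.zero_mem, by rw [h0]; simp⟩
    have hN : (a + b * v) * (a - b * v) = a ^ 2 - b ^ 2 * v ^ 2 := by ring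
    have h1 : a - b * v ≠ 0 := by
      intro h
      by_cases hb0 : b = 0
      · subst hb0
        exact h0 (by simpa using h)
      · refine hvM ?_
        have : v = a / b := by
          field_simp
          linear_combination -h
        rw [this]
        exact M.div_mem ha hb
    have hN' : a ^ 2 - b ^ 2 * v ^ 2 ∈ M :=
      M.sub_mem (M.pow_mem ha 2) (M.mul_mem (M.pow_mem hb 2) hv)
    refine ⟨a / (a ^ 2 - b ^ 2 * v ^ 2), M.div_mem ha hN', -b / (a ^ 2 - b ^ 2 * v ^ 2),
      M.div_mem (M.neg_mem hb) hN', ?_⟩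
    rw [← hN]
    field_simp
    ring

theorem le_quadExt {M : Subfield Ω} {v : Ω} (hv : v ^ 2 ∈ M) : M ≤ quadExt M v hv :=
  fun a ha => ⟨a, ha, 0, M.zero_mem, by ring⟩

theorem self_mem_quadExt {M : Subfield Ω} {v : Ω} (hv : v ^ 2 ∈ M) : v ∈ quadExt M v hv :=
  ⟨0, M.zero_mem, 1, M.one_mem, by ring⟩

theorem eq_zero_of_add_mul_eq_zero {M : Subfield Ω} {v a b : Ω} (hv : v ∉ M) (ha : a ∈ M)
    (hb : b ∈ M) (h : a + b * v = 0) : a = 0 ∧ b = 0 := by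
  have hb0 : b = 0 := by
    by_contra hb0
    refine hv ?_
    have : v = -a / b := by
      field_simp
      linear_combination h
    rw [this]
    exact M.div_mem (M.neg_mem ha) hb
  subst hb0
  exact ⟨by simpa using h, rfl⟩

/-- An element of `M(v)` with square in `M` lies in `M` or in `M v`. -/
theorem mem_or_mul_mem_of_mem_quadExt [CharZero Ω] {M : Subfield Ω} {v w : Ω} (hv : v ^ 2 ∈ M)
    (hvM : v ∉ M) (hw : w ^ 2 ∈ M) (h : w ∈ quadExt M v hv) : w ∈ M ∨ w * v ∈ M := by
  obtain ⟨a, ha, b, hb, rfl⟩ := h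
  have h2 : (2 : Ω) ∈ M := by exact_mod_cast natCast_mem M 2
  have h1 := (eq_zero_of_add_mul_eq_zero (a := a ^ 2 + b ^ 2 * v ^ 2 - (a + b * v) ^ 2)
    (b := 2 * a * b) hvM
    (M.sub_mem (M.add_mem (M.pow_mem ha 2) (M.mul_mem (M.pow_mem hb 2) hv)) hw)
    (M.mul_mem (M.mul_mem h2 ha) hb) (by ring)).2
  rcases mul_eq_zero.1 h1 with h1 | h1
  · have : a = 0 := by simpa using h1
    right
    rw [this]
    have := M.mul_mem hb hv
    convert this using 1
    ring
  · left
    simpa [h1] using ha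

/-- Three square roots, no product of which lies in `M`, generate an extension of degree eight. -/
theorem notMem_quadExt_tower [CharZero Ω] {M : Subfield Ω} {u v w : Ω} (hu : u ^ 2 ∈ M)
    (hv : v ^ 2 ∈ M) (hw : w ^ 2 ∈ M) (h1 : u ∉ M) (h2 : v ∉ M) (h3 : w ∉ M) (h12 : v * u ∉ M)
    (h13 : w * u ∉ M) (h23 : w * v ∉ M) (h123 : w * v * u ∉ M) :
    v ∉ quadExt M u hu ∧ w ∉ quadExt (quadExt M u hu) v (le_quadExt hu hv) := by
  have hv' : v ∉ quadExt M u hu := fun h =>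
    (mem_or_mul_mem_of_mem_quadExt hu h1 hv h).elim h2 h12
  refine ⟨hv', fun h => ?_⟩
  rcases mem_or_mul_mem_of_mem_quadExt _ hv' (le_quadExt hu hw) h with h | h
  · exact (mem_or_mul_mem_of_mem_quadExt hu h1 hw h).elim h3 h13
  · refine (mem_or_mul_mem_of_mem_quadExt hu h1 ?_ h).elim h23 h123
    rw [mul_pow]
    exact M.mul_mem hw hv

end Quadratic

/-! ### Irreducibility of the curve -/

section Curve

/-- The right-hand side of the equation for `y₁ ^ 2`. -/
def polyA1 : Polynomial ℂ :=
  (Polynomial.X - Polynomial.C 1) * ((Polynomial.X - Polynomial.C (rho ^ 3)) *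
    (Polynomial.X - Polynomial.C (rho ^ 5)) * (Polynomial.X - Polynomial.C (rho ^ 6)))

/-- The right-hand side of the equation for `y₂ ^ 2`. -/
def polyA2 : Polynomial ℂ :=
  (Polynomial.X - Polynomial.C (rho ^ 2)) * ((Polynomial.X - Polynomial.C (rho ^ 4)) *
    (Polynomial.X - Polynomial.C (rho ^ 5)) * (Polynomial.X - Polynomial.C (rho ^ 6)))

/-- The right-hand side of the equation for `y₄ ^ 2`. -/
def polyA4 : Polynomial ℂ :=
  (Polynomial.X - Polynomial.C (rho ^ 1)) * ((Polynomial.X - Polynomial.C (rho ^ 3)) *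
    (Polynomial.X - Polynomial.C (rho ^ 4)) * (Polynomial.X - Polynomial.C (rho ^ 5)))

theorem mem_X_iff {p : Fin 4 → ℂ} : p ∈ X ↔ p 1 ^ 2 = polyA1.eval (p 0) ∧
    p 2 ^ 2 = polyA2.eval (p 0) ∧ p 3 ^ 2 = polyA4.eval (p 0) := by
  simp [X, polyA1, polyA2, polyA4, mul_assoc]

theorem polyA1_ne_zero : polyA1 ≠ 0 := by
  simp only [polyA1, ne_eq, mul_eq_zero, Polynomial.X_sub_C_ne_zero, or_self, not_false_eq_true]

theorem polyA2_ne_zero : polyA2 ≠ 0 := by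
  simp only [polyA2, ne_eq, mul_eq_zero, Polynomial.X_sub_C_ne_zero, or_self, not_false_eq_true]

theorem polyA4_ne_zero : polyA4 ≠ 0 := by
  simp only [polyA4, ne_eq, mul_eq_zero, Polynomial.X_sub_C_ne_zero, or_self, not_false_eq_true]

/-- Every value of `x` is attained on the curve. -/
theorem exists_mem_X (x : ℂ) : ∃ p ∈ X, p 0 = x := by
  obtain ⟨a, ha⟩ := IsAlgClosed.exists_pow_nat_eq (polyA1.eval x) (n := 2) (by norm_num)
  obtain ⟨b, hb⟩ := IsAlgClosed.exists_pow_nat_eq (polyA2.eval x) (n := 2) (by norm_num)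
  obtain ⟨c, hc⟩ := IsAlgClosed.exists_pow_nat_eq (polyA4.eval x) (n := 2) (by norm_num)
  exact ⟨![x, a, b, c], mem_X_iff.2 ⟨ha, hb, hc⟩, rfl⟩

theorem zariskiClosure_X : zariskiClosure X = X := by
  refine Set.Subset.antisymm (fun p hp => ?_) (zeroLocus_vanishingIdeal_le X)
  have key : ∀ (i : Fin 4) (A : Polynomial ℂ), (∀ q ∈ X, q i ^ 2 = A.eval (q 0)) →
      p i ^ 2 = A.eval (p 0) := by
    intro i A h
    have h1 := hp (MvPolynomial.X i ^ 2 - Polynomial.aeval (MvPolynomial.X 0) A) fun q hq => by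
      rw [map_sub, map_pow, aeval_X, ← Polynomial.aeval_algHom_apply, aeval_X, h q hq]
      simp
    rw [map_sub, map_pow, aeval_X, ← Polynomial.aeval_algHom_apply, aeval_X] at h1
    simpa using sub_eq_zero.1 h1
  exact mem_X_iff.2 ⟨key 1 _ fun q hq => (mem_X_iff.1 hq).1,
    key 2 _ fun q hq => (mem_X_iff.1 hq).2.1, key 3 _ fun q hq => (mem_X_iff.1 hq).2.2⟩

/-- Reduction of a polynomial modulo three equations `yᵢ ^ 2 = Aᵢ(x)`, valid in every algebra. -/
theorem exists_reduction (A₁ A₂ A₄ : Polynomial ℂ) (f : MvPolynomial (Fin 4) ℂ) :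
    ∃ c : Fin 2 → Fin 2 → Fin 2 → Polynomial ℂ, ∀ (B : Type) [CommRing B] [Algebra ℂ B]
      (v : Fin 4 → B), v 1 ^ 2 = Polynomial.aeval (v 0) A₁ → v 2 ^ 2 = Polynomial.aeval (v 0) A₂ →
      v 3 ^ 2 = Polynomial.aeval (v 0) A₄ →
      aeval v f = ∑ i, ∑ j, ∑ k, Polynomial.aeval (v 0) (c i j k) *
        v 1 ^ (i : ℕ) * v 2 ^ (j : ℕ) * v 3 ^ (k : ℕ) := by
  induction f using MvPolynomial.induction_on with
  | C a =>
    refine ⟨fun i j k => if i = 0 ∧ j = 0 ∧ k = 0 then Polynomial.C a else 0, ?_⟩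
    intro B _ _ v _ _ _
    simp [Fin.sum_univ_two]
  | add f g hf hg =>
    obtain ⟨c, hc⟩ := hf
    obtain ⟨d, hd⟩ := hg
    refine ⟨fun i j k => c i j k + d i j k, ?_⟩
    intro B _ _ v h1 h2 h3
    rw [map_add, hc B v h1 h2 h3, hd B v h1 h2 h3]
    simp only [map_add, add_mul, Finset.sum_add_distrib]
  | mul_X f m hf =>
    obtain ⟨c, hc⟩ := hf
    fin_cases m
    · refine ⟨fun i j k => c i j k * Polynomial.X, ?_⟩
      intro B _ _ v h1 h2 h3
      rw [map_mul, hc B v h1 h2 h3]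
      simp [Fin.sum_univ_two]
      ring
    · refine ⟨fun i j k => if i = 0 then c 1 j k * A₁ else c 0 j k, ?_⟩
      intro B _ _ v h1 h2 h3
      rw [map_mul, hc B v h1 h2 h3]
      simp [Fin.sum_univ_two, ← h1]
      ring
    · refine ⟨fun i j k => if j = 0 then c i 1 k * A₂ else c i 0 k, ?_⟩
      intro B _ _ v h1 h2 h3
      rw [map_mul, hc B v h1 h2 h3]
      simp [Fin.sum_univ_two, ← h2]
      ring
    · refine ⟨fun i j k => if k = 0 then c i j 1 * A₄ else c i j 0, ?_⟩
      intro B _ _ v h1 h2 h3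
      rw [map_mul, hc B v h1 h2 h3]
      simp [Fin.sum_univ_two, ← h3]
      ring

theorem eq_zero_of_add_sub {a b y : ℂ} (hy : y ≠ 0) (h1 : a + b * y = 0) (h2 : a - b * y = 0) :
    a = 0 ∧ b = 0 := by
  have h3 : b * y = 0 := by linear_combination (h1 - h2) / 2
  exact ⟨by linear_combination (h1 + h2) / 2, (mul_eq_zero.1 h3).resolve_right hy⟩

/-- A polynomial identity in one variable may be checked away from the zeros of a nonzero
polynomial. -/
theorem eq_zero_of_forall_eval {A c : Polynomial ℂ} (hA : A ≠ 0)
    (h : ∀ x, A.eval x ≠ 0 → c.eval x = 0) : c = 0 := by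
  have h1 : A * c = 0 := Polynomial.funext fun x => by
    by_cases h0 : A.eval x = 0
    · simp [h0]
    · simp [h x h0]
  exact (mul_eq_zero.1 h1).resolve_left hA

/-- A reduced polynomial that vanishes on `X` is zero: change the signs of the `yᵢ`. -/
theorem reduced_eq_zero_of_forall_mem_X {c : Fin 2 → Fin 2 → Fin 2 → Polynomial ℂ}
    (h : ∀ p ∈ X, ∑ i, ∑ j, ∑ k, (c i j k).eval (p 0) *
        p 1 ^ (i : ℕ) * p 2 ^ (j : ℕ) * p 3 ^ (k : ℕ) = 0) : ∀ i j k, c i j k = 0 := by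
  have key : ∀ x, (polyA1 * polyA2 * polyA4).eval x ≠ 0 → ∀ i j k, (c i j k).eval x = 0 := by
    intro x hx
    obtain ⟨p, hp, rfl⟩ := exists_mem_X x
    rw [mem_X_iff] at hp
    obtain ⟨h1, h2, h3⟩ := hp
    simp only [Polynomial.eval_mul, ← h1, ← h2, ← h3] at hx
    have hy1 : p 1 ≠ 0 := by rintro h; simp [h] at hx
    have hy2 : p 2 ≠ 0 := by rintro h; simp [h] at hx
    have hy3 : p 3 ≠ 0 := by rintro h; simp [h] at hx
    have hs : ∀ a b d : ℂ, a ^ 2 = 1 → b ^ 2 = 1 → d ^ 2 = 1 →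
        ∑ i, ∑ j, ∑ k, (c i j k).eval (p 0) *
        (a * p 1) ^ (i : ℕ) * (b * p 2) ^ (j : ℕ) * (d * p 3) ^ (k : ℕ) = 0 := by
      intro a b d ha hb hd
      exact h ![p 0, a * p 1, b * p 2, d * p 3] (mem_X_iff.2
        ⟨by simp [mul_pow, ha, h1], by simp [mul_pow, hb, h2], by simp [mul_pow, hd, h3]⟩)
    simp only [Fin.sum_univ_two, Fin.val_zero, Fin.val_one, pow_zero, pow_one, mul_one] at hs
    have s3 : ∀ a b : ℂ, a ^ 2 = 1 → b ^ 2 = 1 → ∀ k,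
        ((c 0 0 k).eval (p 0) + (c 0 1 k).eval (p 0) * (b * p 2)) +
        ((c 1 0 k).eval (p 0) + (c 1 1 k).eval (p 0) * (b * p 2)) * (a * p 1) = 0 := by
      intro a b ha hb
      have e1 := hs a b 1 ha hb (by norm_num)
      have e2 := hs a b (-1) ha hb (by norm_num)
      have := eq_zero_of_add_sub
        (a := ((c 0 0 0).eval (p 0) + (c 0 1 0).eval (p 0) * (b * p 2)) +
          ((c 1 0 0).eval (p 0) + (c 1 1 0).eval (p 0) * (b * p 2)) * (a * p 1))
        (b := ((c 0 0 1).eval (p 0) + (c 0 1 1).eval (p 0) * (b * p 2)) +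
          ((c 1 0 1).eval (p 0) + (c 1 1 1).eval (p 0) * (b * p 2)) * (a * p 1))
        hy3 (by linear_combination e1) (by linear_combination e2)
      intro k
      fin_cases k
      · exact this.1
      · exact this.2
    have s2 : ∀ a : ℂ, a ^ 2 = 1 → ∀ j k,
        (c 0 j k).eval (p 0) + (c 1 j k).eval (p 0) * (a * p 1) = 0 := by
      intro a ha j k
      have e1 := s3 a 1 ha (by norm_num) k
      have e2 := s3 a (-1) ha (by norm_num) k
      have := eq_zero_of_add_sub
        (a := (c 0 0 k).eval (p 0) + (c 1 0 k).eval (p 0) * (a * p 1))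
        (b := (c 0 1 k).eval (p 0) + (c 1 1 k).eval (p 0) * (a * p 1))
        hy2 (by linear_combination e1) (by linear_combination e2)
      fin_cases j
      · exact this.1
      · exact this.2
    intro i j k
    have := eq_zero_of_add_sub (a := (c 0 j k).eval (p 0)) (b := (c 1 j k).eval (p 0)) hy1
      (by linear_combination s2 1 (by norm_num) j k)
      (by linear_combination s2 (-1) (by norm_num) j k)
    fin_cases i
    · exact this.1
    · exact this.2
  intro i j k
  exact eq_zero_of_forall_eval
    (mul_ne_zero (mul_ne_zero polyA1_ne_zero polyA2_ne_zero) polyA4_ne_zero)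
    fun x hx => key x hx i j k

/-- A polynomial with a simple root has no square root among rational functions. -/
theorem notMem_fieldRange_of_sq {Ω : Type*} [Field Ω] [Algebra (RatFunc ℂ) Ω] {r : ℂ}
    {Q : Polynomial ℂ} (hQ : Q.eval r ≠ 0) {z : Ω}
    (hz : z ^ 2 = algebraMap (RatFunc ℂ) Ω
      (algebraMap (Polynomial ℂ) (RatFunc ℂ) ((Polynomial.X - Polynomial.C r) * Q))) :
    z ∉ (algebraMap (RatFunc ℂ) Ω).fieldRange := by
  rintro ⟨y, rfl⟩
  rw [← map_pow] at hz
  have hy := (algebraMap (RatFunc ℂ) Ω).injective hz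
  obtain ⟨f, rfl⟩ := IsIntegrallyClosed.exists_algebraMap_eq_of_isIntegral_pow
    (R := Polynomial ℂ) (K := RatFunc ℂ) (x := y) (n := 2) (by norm_num)
    (by rw [hy]; exact isIntegral_algebraMap)
  rw [← map_pow] at hy
  have hf : f ^ 2 = (Polynomial.X - Polynomial.C r) * Q :=
    IsFractionRing.injective (Polynomial ℂ) (RatFunc ℂ) hy
  have h0 : f.IsRoot r := by
    have := congrArg (Polynomial.eval r) hf
    simpa using this
  obtain ⟨g, rfl⟩ := Polynomial.dvd_iff_isRoot.2 h0
  have h1 : (Polynomial.X - Polynomial.C r) * g ^ 2 = Q :=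
    mul_left_cancel₀ (Polynomial.X_sub_C_ne_zero r) (by rw [← hf]; ring)
  refine hQ ?_
  rw [← h1]
  simp

/-- The curve `X` is irreducible: its vanishing ideal is the kernel of a homomorphism into an
algebraic closure of `ℂ(x)`. -/
instance X_isPrime : (vanishingIdeal ℂ X).IsPrime := by
  let K := RatFunc ℂ
  let Ω := AlgebraicClosure K
  have hchar : CharZero Ω := algebraRat.charZero Ω
  let e : Polynomial ℂ →ₐ[ℂ] Ω := (Algebra.ofId (Polynomial ℂ) Ω).restrictScalars ℂ
  have he : ∀ q : Polynomial ℂ, e q = algebraMap K Ω (algebraMap (Polynomial ℂ) K q) := fun q =>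
    IsScalarTower.algebraMap_apply (Polynomial ℂ) K Ω q
  have hinj : Function.Injective e := fun a b hab => by
    rw [he, he] at hab
    exact IsFractionRing.injective (Polynomial ℂ) K ((algebraMap K Ω).injective hab)
  have hea : ∀ q : Polynomial ℂ, Polynomial.aeval (e Polynomial.X) q = e q := fun q => by
    rw [Polynomial.aeval_algHom_apply, Polynomial.aeval_X_left_apply]
  obtain ⟨u, hu⟩ := IsAlgClosed.exists_pow_nat_eq (e polyA1) (n := 2) (by norm_num)
  obtain ⟨v, hv⟩ := IsAlgClosed.exists_pow_nat_eq (e polyA2) (n := 2) (by norm_num)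
  obtain ⟨w, hw⟩ := IsAlgClosed.exists_pow_nat_eq (e polyA4) (n := 2) (by norm_num)
  let M := (algebraMap K Ω).fieldRange
  have hM : ∀ q, e q ∈ M := fun q => ⟨_, (he q).symm⟩
  have hns : ∀ (r : ℂ) (Q : Polynomial ℂ) (z : Ω), Q.eval r ≠ 0 →
      z ^ 2 = e ((Polynomial.X - Polynomial.C r) * Q) → z ∉ M := fun r Q z hQ hz =>
    notMem_fieldRange_of_sq hQ (by rw [hz, he])
  -- `1`, `ρ ^ 2` and `ρ` are roots of just one of the three quartics, so that each product of
  -- distinct quartics has a simple root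
  have d : ∀ i j : ℕ, i < 7 → j < 7 → i ≠ j → rho ^ i - rho ^ j ≠ 0 := fun i j => rho_sub_ne
  have d0 : ∀ j : ℕ, j ≠ 0 → j < 7 → 1 - rho ^ j ≠ 0 := fun j hj hj' => by
    simpa using d 0 j (by norm_num) hj' hj.symm
  have d1 : ∀ j : ℕ, j ≠ 1 → j < 7 → rho - rho ^ j ≠ 0 := fun j hj hj' => by
    simpa using d 1 j (by norm_num) hj' hj.symm
  have d0' : 1 - rho ≠ 0 := by simpa using d0 1 (by norm_num) (by norm_num)
  have d2' : rho ^ 2 - rho ≠ 0 := by simpa using d 2 1 (by norm_num) (by norm_num) (by norm_num)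
  have h1 : u ∉ M := hns 1 _ u (by simp [d0]) hu
  have h2 : v ∉ M := hns (rho ^ 2) _ v (by simp [d]) hv
  have h3 : w ∉ M := hns (rho ^ 1) _ w (by simp [d1]) hw
  have h12 : v * u ∉ M := hns 1 (((Polynomial.X - Polynomial.C (rho ^ 3)) *
    (Polynomial.X - Polynomial.C (rho ^ 5)) * (Polynomial.X - Polynomial.C (rho ^ 6))) * polyA2) _
    (by simp [polyA2, d0]) (by rw [mul_pow, hu, hv, ← map_mul, polyA1]; congr 1; ring)
  have h13 : w * u ∉ M := hns 1 (((Polynomial.X - Polynomial.C (rho ^ 3)) *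
    (Polynomial.X - Polynomial.C (rho ^ 5)) * (Polynomial.X - Polynomial.C (rho ^ 6))) * polyA4) _
    (by simp [polyA4, d0, d0']) (by rw [mul_pow, hu, hw, ← map_mul, polyA1]; congr 1; ring)
  have h23 : w * v ∉ M := hns (rho ^ 2) (((Polynomial.X - Polynomial.C (rho ^ 4)) *
    (Polynomial.X - Polynomial.C (rho ^ 5)) * (Polynomial.X - Polynomial.C (rho ^ 6))) * polyA4) _
    (by simp [polyA4, d, d2']) (by rw [mul_pow, hv, hw, ← map_mul, polyA2]; congr 1; ring)
  have h123 : w * v * u ∉ M := hns 1 (((Polynomial.X - Polynomial.C (rho ^ 3)) *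
    (Polynomial.X - Polynomial.C (rho ^ 5)) * (Polynomial.X - Polynomial.C (rho ^ 6))) *
    polyA2 * polyA4) _ (by simp [polyA2, polyA4, d0, d0'])
    (by rw [mul_pow, mul_pow, hu, hv, hw, ← map_mul, ← map_mul, polyA1]; congr 1; ring)
  have hu' : u ^ 2 ∈ M := hu ▸ hM _
  obtain ⟨hvM, hwM⟩ := notMem_quadExt_tower hu' (hv ▸ hM _) (hw ▸ hM _) h1 h2 h3 h12 h13 h23 h123
  let φ : MvPolynomial (Fin 4) ℂ →ₐ[ℂ] Ω := aeval ![e Polynomial.X, u, v, w]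
  have hker : vanishingIdeal ℂ X = RingHom.ker φ := by
    ext f
    obtain ⟨c, hc⟩ := exists_reduction polyA1 polyA2 polyA4 f
    have hφ := hc Ω ![e Polynomial.X, u, v, w] (by simp [hea, hu]) (by simp [hea, hv])
      (by simp [hea, hw])
    have hX : ∀ p ∈ X, aeval p f = ∑ i, ∑ j, ∑ k, (c i j k).eval (p 0) *
        p 1 ^ (i : ℕ) * p 2 ^ (j : ℕ) * p 3 ^ (k : ℕ) := fun p hp => by
      obtain ⟨e1, e2, e3⟩ := mem_X_iff.1 hp
      rw [hc ℂ p (by simpa using e1) (by simpa using e2) (by simpa using e3)]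
      simp
    rw [RingHom.mem_ker]
    constructor
    · intro hf
      have hc0 := reduced_eq_zero_of_forall_mem_X (c := c) fun p hp => by rw [← hX p hp, hf p hp]
      rw [hφ]
      simp [hc0]
    · intro hf
      have hc0 : ∀ i j k, c i j k = 0 := by
        have h0 := hφ.symm.trans hf
        simp only [Fin.sum_univ_two, Fin.val_zero, Fin.val_one, pow_zero, pow_one, mul_one,
          Matrix.cons_val_zero, hea] at h0
        have hM1 : ∀ q, e q ∈ quadExt M u hu' := fun q => le_quadExt hu' (hM q)
        have hul := self_mem_quadExt hu'
        have hl : ∀ k, ∀ j, e (c 0 j k) + e (c 1 j k) * u ∈ quadExt M u hu' := fun k j =>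
          Subfield.add_mem _ (hM1 _) (Subfield.mul_mem _ (hM1 _) hul)
        have hl2 : ∀ k, (e (c 0 0 k) + e (c 1 0 k) * u) + (e (c 0 1 k) + e (c 1 1 k) * u) * v ∈
            quadExt (quadExt M u hu') v (le_quadExt hu' (hv ▸ hM _)) := fun k =>
          ⟨_, hl k 0, _, hl k 1, rfl⟩
        have z3 := eq_zero_of_add_mul_eq_zero hwM (hl2 0) (hl2 1)
          (by rw [← h0]; simp; ring)
        have z3' : ∀ k, (e (c 0 0 k) + e (c 1 0 k) * u) +
            (e (c 0 1 k) + e (c 1 1 k) * u) * v = 0 := fun k => by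
          fin_cases k
          · exact z3.1
          · exact z3.2
        have z2 : ∀ k j, e (c 0 j k) + e (c 1 j k) * u = 0 := fun k j => by
          have := eq_zero_of_add_mul_eq_zero hvM (hl k 0) (hl k 1) (z3' k)
          fin_cases j
          · exact this.1
          · exact this.2
        intro i j k
        have := eq_zero_of_add_mul_eq_zero h1 (hM _) (hM _) (z2 k j)
        refine (map_eq_zero_iff e hinj).1 ?_
        fin_cases i
        · exact this.1
        · exact this.2
      intro p hp
      rw [hX p hp]
      simp [hc0]
  rw [hker]
  exact RingHom.ker_isPrime _

/-- A nonzero polynomial in `x` is generically nonzero on `X`. -/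
theorem generically_eval_ne_zero {q : Polynomial ℂ} (hq : q ≠ 0) :
    Generically X (fun p => q.eval (p 0) ≠ 0) := by
  have key : ∀ p : Fin 4 → ℂ, aeval p (Polynomial.aeval (MvPolynomial.X 0) q) = q.eval (p 0) :=
    fun p => by
      rw [← Polynomial.aeval_algHom_apply, aeval_X]
      simp
  have : Polynomial.aeval (MvPolynomial.X 0) q ∉ vanishingIdeal ℂ X := fun h => by
    refine hq (Polynomial.funext fun x => ?_)
    obtain ⟨p, hp, rfl⟩ := exists_mem_X x
    rw [← key, h p hp, Polynomial.eval_zero]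
  exact (generically_aeval_ne_zero this).mono fun p _ h => by rwa [key] at h

end Curve

/-! ### The quadratic subfield and traces of roots of unity -/

section Trace

theorem conj_rho : starRingEnd ℂ rho = rho ^ 6 := by
  have h1 : starRingEnd ℂ rho * rho = 1 := by
    rw [mul_comm, Complex.mul_conj, Complex.normSq_eq_norm_sq,
      rho_isPrimitiveRoot.norm'_eq_one (by norm_num)]
    simp
  have h2 := rho_pow_seven
  have h3 : starRingEnd ℂ rho = starRingEnd ℂ rho * rho ^ 7 := by rw [h2, mul_one]
  rw [h3]
  linear_combination rho ^ 6 * h1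

/-- The Gaussian period `ρ + ρ² + ρ⁴`. -/
def omega : ℂ := rho + rho ^ 2 + rho ^ 4

/-- The element `√-7` of `ℂ`. -/
def delta : ℂ := Complex.I * (Real.sqrt 7 : ℂ)

theorem delta_sq : delta ^ 2 = -7 := by
  have h : ((Real.sqrt 7 : ℝ) : ℂ) ^ 2 = 7 := by
    rw [← Complex.ofReal_pow, Real.sq_sqrt (by norm_num)]
    norm_num
  rw [delta, mul_pow, h, Complex.I_sq]
  norm_num

theorem conj_delta : starRingEnd ℂ delta = -delta := by
  simp [delta]

theorem delta_ne_zero : delta ≠ 0 := fun h => by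
  have := delta_sq
  rw [h] at this
  norm_num at this

theorem delta_mem : delta ∈ QSqrtNegSeven := IntermediateField.mem_adjoin_simple_self ℚ _

theorem rho_mem : rho ∈ QRho := IntermediateField.mem_adjoin_simple_self ℚ _

theorem omega_sq : omega ^ 2 = -omega - 2 := by
  rw [omega]
  linear_combination 2 * rho_cyclotomic + rho * rho_pow_seven

theorem two_omega_add_one : 2 * omega + 1 = delta ∨ 2 * omega + 1 = -delta := by
  rw [← sq_eq_sq_iff_eq_or_eq_neg, delta_sq]
  linear_combination 4 * omega_sq

/-- The Gauss sum of the quadratic character modulo `7` is `2 ω + 1 = ±√-7`. -/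
theorem omega_mem : omega ∈ QSqrtNegSeven := by
  have key : ∀ z ∈ QSqrtNegSeven, (z - 1) / 2 ∈ QSqrtNegSeven := fun z hz =>
    div_mem (sub_mem hz (one_mem _)) (by exact_mod_cast natCast_mem QSqrtNegSeven 2)
  rcases two_omega_add_one with h | h
  · convert key _ delta_mem using 1
    linear_combination h / 2
  · convert key _ (neg_mem delta_mem) using 1
    linear_combination h / 2

theorem delta_mem_QRho : delta ∈ QRho := by
  have h1 : 2 * omega + 1 ∈ QRho := by
    refine add_mem (mul_mem (by exact_mod_cast natCast_mem QRho 2) ?_) (one_mem _)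
    exact add_mem (add_mem rho_mem (pow_mem rho_mem 2)) (pow_mem rho_mem 4)
  rcases two_omega_add_one with h | h
  · rwa [← h]
  · rw [← neg_neg delta, ← h]
    exact neg_mem h1

theorem QSqrtNegSeven_le_QRho : QSqrtNegSeven ≤ QRho := by
  rw [IntermediateField.adjoin_simple_le_iff]
  exact delta_mem_QRho

/-- The sum of the values of `φ` at the conjugates of `ρ` over `ℚ(√-7)`. -/
def trace (φ : ℂ → ℂ) : ℂ := φ rho + φ (rho ^ 2) + φ (rho ^ 4)

/-- The exponents `1, 2, 4` form the group of squares modulo `7`, which fixes `ℚ(√-7)`; the sums of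
`m`-th powers are `3`, `ω` or `-1 - ω` according to the class of `m` modulo `7`. -/
theorem trace_pow_mem (m : ℕ) : trace (fun r => r ^ m) ∈ QSqrtNegSeven := by
  have h7 : ∀ j : ℕ, rho ^ (7 * j) = 1 := fun j => by rw [pow_mul, rho_pow_seven, one_pow]
  have key : trace (fun r => r ^ m) = trace (fun r => r ^ (m % 7)) := by
    have : ∀ j : ℕ, (rho ^ j) ^ m = (rho ^ j) ^ (m % 7) := fun j => by
      conv_lhs => rw [← Nat.div_add_mod m 7, pow_add, ← pow_mul]
      rw [show j * (7 * (m / 7)) = 7 * (j * (m / 7)) by ring, h7, one_mul]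
    have h1 := this 1
    rw [pow_one] at h1
    simp only [trace, h1, this]
  have h2 : trace (fun r => r ^ (m % 7)) = 3 ∨ trace (fun r => r ^ (m % 7)) = omega ∨
      trace (fun r => r ^ (m % 7)) = -1 - omega := by
    have hm : m % 7 < 7 := Nat.mod_lt _ (by norm_num)
    have h := rho_pow_seven
    have hc := rho_cyclotomic
    simp only [trace, omega]
    interval_cases m % 7
    · left; norm_num
    · right; left; ring
    · right; left; linear_combination rho * h
    · right; right; linear_combination hc + (rho ^ 5) * h
    · right; left; linear_combination (rho + rho ^ 9 + rho ^ 2) * h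
    · right; right; linear_combination hc + (rho ^ 3 + rho ^ 13 + rho ^ 6) * h
    · right; right; linear_combination hc + (rho ^ 5 + rho ^ 17 + rho ^ 10 + rho ^ 3) * h
  rw [key]
  rcases h2 with h | h | h <;> rw [h]
  · exact_mod_cast natCast_mem QSqrtNegSeven 3
  · exact omega_mem
  · exact sub_mem (neg_mem (one_mem _)) omega_mem

end Trace

/-! ### Families of rational functions indexed by the conjugates of `ρ` -/

section Family

variable {ι κ : Type} {V : Set (ι → ℂ)} {k : Type} [Field k] [Algebra k ℂ]
  {v : (ι → ℂ) → (κ → ℂ)}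

theorem IsRatFun.sum [(vanishingIdeal ℂ V).IsPrime] {α : Type} (s : Finset α) {g : α → (ι → ℂ) → ℂ}
    (hg : ∀ a ∈ s, IsRatFun k V v (g a)) : IsRatFun k V v (fun p => ∑ a ∈ s, g a p) := by
  classical
  induction s using Finset.induction_on with
  | empty => simpa using IsRatFun.natCast (k := k) (V := V) (v := v) 0
  | insert a s ha ih =>
    simp only [Finset.sum_insert ha]
    exact (hg a (Finset.mem_insert_self a s)).add
      (ih fun b hb => hg b (Finset.mem_insert_of_mem hb))

/-- Families `φ r p` of functions on `V` that are polynomial in the parameter `r`, with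
coefficients that are rational over `k` in `v p`. -/
inductive RatFamily (k : Type) [Field k] [Algebra k ℂ] (V : Set (ι → ℂ))
    (v : (ι → ℂ) → (κ → ℂ)) : (ℂ → (ι → ℂ) → ℂ) → Prop
  | base {g : (ι → ℂ) → ℂ} (hg : IsRatFun k V v g) : RatFamily k V v (fun _ p => g p)
  | root : RatFamily k V v (fun r _ => r)
  | add {φ ψ : ℂ → (ι → ℂ) → ℂ} (hφ : RatFamily k V v φ) (hψ : RatFamily k V v ψ) :
      RatFamily k V v (fun r p => φ r p + ψ r p)
  | mul {φ ψ : ℂ → (ι → ℂ) → ℂ} (hφ : RatFamily k V v φ) (hψ : RatFamily k V v ψ) :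
      RatFamily k V v (fun r p => φ r p * ψ r p)

namespace RatFamily

variable {φ ψ : ℂ → (ι → ℂ) → ℂ}

theorem pow (hφ : RatFamily k V v φ) (m : ℕ) : RatFamily k V v (fun r p => φ r p ^ m) := by
  induction m with
  | zero => simpa using base (k := k) (V := V) (v := v) IsRatFun.one
  | succ m ih => simpa [pow_succ] using ih.mul hφ

theorem sub (hφ : RatFamily k V v φ) (hψ : RatFamily k V v ψ) :
    RatFamily k V v (fun r p => φ r p - ψ r p) := by
  simpa [sub_eq_add_neg] using hφ.add ((base (IsRatFun.const (-1 : k))).mul hψ)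

theorem comp_pow (hφ : RatFamily k V v φ) (m : ℕ) : RatFamily k V v (fun r p => φ (r ^ m) p) := by
  induction hφ with
  | base hg => exact base hg
  | root => exact root.pow m
  | add _ _ h1 h2 => exact h1.add h2
  | mul _ _ h1 h2 => exact h1.mul h2

variable [(vanishingIdeal ℂ V).IsPrime]

/-- A family is the value of a polynomial whose coefficients are rational functions, so that its
trace only involves the traces of the powers of `ρ`. -/
theorem exists_polynomial (hφ : RatFamily k V v φ) : ∃ P : Polynomial ((ι → ℂ) → ℂ),
    (∀ i, IsRatFun k V v (P.coeff i)) ∧ ∀ r p, φ r p = P.eval (fun _ => r) p := by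
  have h0 : IsRatFun k V v (0 : (ι → ℂ) → ℂ) := by
    have := IsRatFun.natCast (k := k) (V := V) (v := v) 0
    rwa [Nat.cast_zero] at this
  have h1 : IsRatFun k V v (1 : (ι → ℂ) → ℂ) := IsRatFun.one
  induction hφ with
  | @base g hg =>
    refine ⟨Polynomial.C g, fun i => ?_, fun r p => by simp⟩
    rw [Polynomial.coeff_C]
    split_ifs
    · exact hg
    · exact h0
  | root =>
    refine ⟨Polynomial.X, fun i => ?_, fun r p => by simp⟩
    rw [Polynomial.coeff_X]
    split_ifs
    · exact h1
    · exact h0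
  | add _ _ ih1 ih2 =>
    obtain ⟨P, hP, hP'⟩ := ih1
    obtain ⟨Q, hQ, hQ'⟩ := ih2
    refine ⟨P + Q, fun i => ?_, fun r p => by simp [hP', hQ']⟩
    rw [Polynomial.coeff_add]
    exact (hP i).add (hQ i)
  | mul _ _ ih1 ih2 =>
    obtain ⟨P, hP, hP'⟩ := ih1
    obtain ⟨Q, hQ, hQ'⟩ := ih2
    refine ⟨P * Q, fun i => ?_, fun r p => by simp [hP', hQ']⟩
    rw [Polynomial.coeff_mul]
    convert IsRatFun.sum (k := k) (V := V) (v := v) (Finset.HasAntidiagonal.antidiagonal i)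
      (g := fun x p => P.coeff x.1 p * Q.coeff x.2 p) (fun x _ => (hP x.1).mul (hQ x.2)) using 1
    funext p
    simp

theorem isRatFun_trace {v : (ι → ℂ) → (κ → ℂ)} {φ : ℂ → (ι → ℂ) → ℂ}
    (hφ : RatFamily QSqrtNegSeven V v φ) :
    IsRatFun QSqrtNegSeven V v (fun p => trace fun r => φ r p) := by
  obtain ⟨P, hP, h⟩ := hφ.exists_polynomial
  have key : ∀ p, trace (fun r => φ r p) =
      ∑ i ∈ Finset.range (P.natDegree + 1), P.coeff i p * trace fun r => r ^ i := by
    intro p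
    have h1 : ∀ r, φ r p = ∑ i ∈ Finset.range (P.natDegree + 1), P.coeff i p * r ^ i := fun r => by
      rw [h, Polynomial.eval_eq_sum_range]
      simp
    simp only [trace, h1, ← Finset.sum_add_distrib, mul_add]
  simp only [key]
  exact IsRatFun.sum _ fun i _ =>
    (hP i).mul (IsRatFun.const (⟨_, trace_pow_mem i⟩ : QSqrtNegSeven))

/-- The trace of a quotient of two families is rational over `ℚ(√-7)`: put the three fractions
over their common denominator. -/
theorem isRatFun_trace_div {v : (ι → ℂ) → (κ → ℂ)} {φ ψ : ℂ → (ι → ℂ) → ℂ}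
    (hφ : RatFamily QSqrtNegSeven V v φ) (hψ : RatFamily QSqrtNegSeven V v ψ)
    (h0 : Generically V (fun p => ψ rho p ≠ 0 ∧ ψ (rho ^ 2) p ≠ 0 ∧ ψ (rho ^ 4) p ≠ 0)) :
    IsRatFun QSqrtNegSeven V v (fun p => trace fun r => φ r p / ψ r p) := by
  have hn := (hφ.mul ((hψ.comp_pow 2).mul (hψ.comp_pow 4))).isRatFun_trace
  have hd := (hψ.mul ((hψ.comp_pow 2).mul (hψ.comp_pow 4))).isRatFun_trace
  have h3 : IsRatFun QSqrtNegSeven V v (fun _ => ((3 : ℕ) : ℂ)) := IsRatFun.natCast 3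
  have r8 : rho ^ 8 = rho := by linear_combination rho * rho_pow_seven
  have r16 : rho ^ 16 = rho ^ 2 := by linear_combination (rho ^ 9 + rho ^ 2) * rho_pow_seven
  refine ((hn.mul h3).div hd (h0.mono fun p _ h => ?_)).congr (h0.mono fun p _ h => ?_)
  · simp only [trace, ← pow_mul]
    norm_num [r8, r16]
    have : ψ rho p * (ψ (rho ^ 2) p * ψ (rho ^ 4) p) +
        ψ (rho ^ 2) p * (ψ (rho ^ 4) p * ψ rho p) +
        ψ (rho ^ 4) p * (ψ rho p * ψ (rho ^ 2) p) =
        3 * (ψ rho p * (ψ (rho ^ 2) p * ψ (rho ^ 4) p)) := by ring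
    rw [this]
    simp [h.1, h.2.1, h.2.2]
  · obtain ⟨h1, h2, h4⟩ := h
    simp only [trace, ← pow_mul]
    norm_num [r8, r16]
    have : ψ rho p * (ψ (rho ^ 2) p * ψ (rho ^ 4) p) +
        ψ (rho ^ 2) p * (ψ (rho ^ 4) p * ψ rho p) +
        ψ (rho ^ 4) p * (ψ rho p * ψ (rho ^ 2) p) =
        3 * (ψ rho p * (ψ (rho ^ 2) p * ψ (rho ^ 4) p)) := by ring
    rw [this]
    field_simp

end RatFamily

end Family

/-! ### The three conjugate square roots -/

section Roots

/-- The quartic whose values at `r = ρ, ρ², ρ⁴` are the squares of `y₂`, `y₄`, `y₆`. -/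
def quartic (r x : ℂ) : ℂ := (x - r ^ 2) * (x - r ^ 4) * (x - r ^ 5) * (x - r ^ 6)

/-- The quadratic factor in the relations `y₄ y₆ = y₂ cofactor ρ` and its conjugates. -/
def cofactor (r x : ℂ) : ℂ := (x - r) * (x - r ^ 3)

theorem rho_pow_eq (m : ℕ) : rho ^ (m + 7) = rho ^ m := by
  rw [pow_add, rho_pow_seven, mul_one]

theorem quartic_rho_sq (x : ℂ) : quartic (rho ^ 2) x =
    (x - rho ^ 4) * (x - rho) * (x - rho ^ 3) * (x - rho ^ 5) := by
  simp only [quartic, ← pow_mul]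
  norm_num [rho_pow_eq 1, rho_pow_eq 3, rho_pow_eq 5]

theorem quartic_rho_four (x : ℂ) : quartic (rho ^ 4) x =
    (x - rho) * (x - rho ^ 2) * (x - rho ^ 6) * (x - rho ^ 3) := by
  simp only [quartic, ← pow_mul]
  norm_num [rho_pow_eq 1, rho_pow_eq 9, rho_pow_eq 2, rho_pow_eq 6, rho_pow_eq 13, rho_pow_eq 3,
    rho_pow_eq 10, rho_pow_eq 17]

theorem cofactor_rho_sq (x : ℂ) : cofactor (rho ^ 2) x = (x - rho ^ 2) * (x - rho ^ 6) := by
  simp only [cofactor, ← pow_mul]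

theorem cofactor_rho_four (x : ℂ) : cofactor (rho ^ 4) x = (x - rho ^ 4) * (x - rho ^ 5) := by
  simp only [cofactor, ← pow_mul]
  norm_num [rho_pow_eq 5]

/-- Conditions on the coordinate `x` that hold generically and under which all the formulas below
make sense: zero and the seventh roots of unity are excluded, the denominators `x ^ 2 + 1` and
`x ^ 4 + 1` do not vanish, and the squares of `y₂`, `y₄`, `y₆`, as well as those of the terms
`y(r) (1 + r ^ 2 / x ^ 2)` of the third coordinate of `W`, are distinct. -/
structure IsGood (x : ℂ) : Prop where
  ne_zero : x ≠ 0
  pow_ne : x ^ 7 ≠ 1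
  sq_ne : x ^ 2 + 1 ≠ 0
  four_ne : x ^ 4 + 1 ≠ 0
  ne₂₄ : quartic rho x ≠ quartic (rho ^ 2) x
  ne₂₆ : quartic rho x ≠ quartic (rho ^ 4) x
  ne₄₆ : quartic (rho ^ 2) x ≠ quartic (rho ^ 4) x
  twist₂₄ : quartic rho x * (x ^ 2 + rho ^ 2) ^ 2 ≠
    quartic (rho ^ 2) x * (x ^ 2 + (rho ^ 2) ^ 2) ^ 2
  twist₂₆ : quartic rho x * (x ^ 2 + rho ^ 2) ^ 2 ≠
    quartic (rho ^ 4) x * (x ^ 2 + (rho ^ 4) ^ 2) ^ 2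
  twist₄₆ : quartic (rho ^ 2) x * (x ^ 2 + (rho ^ 2) ^ 2) ^ 2 ≠
    quartic (rho ^ 4) x * (x ^ 2 + (rho ^ 4) ^ 2) ^ 2

theorem IsGood.ne_rho_pow {x : ℂ} (hx : IsGood x) (j : ℕ) : x - rho ^ j ≠ 0 := fun h => by
  refine hx.pow_ne ?_
  rw [sub_eq_zero.1 h, ← pow_mul, mul_comm, pow_mul, rho_pow_seven, one_pow]

theorem generically_ne {f g : Polynomial ℂ} (x : ℂ) (h : f.eval x ≠ g.eval x) :
    Generically X (fun p => f.eval (p 0) ≠ g.eval (p 0)) := by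
  have h0 : f - g ≠ 0 := fun h0 => h (by rw [sub_eq_zero.1 h0])
  refine (generically_eval_ne_zero h0).mono fun p _ hp => ?_
  rwa [Polynomial.eval_sub, sub_ne_zero] at hp

/-- The quartic as a polynomial in `x`. -/
def quarticPoly (r : ℂ) : Polynomial ℂ := (Polynomial.X - Polynomial.C (r ^ 2)) *
  (Polynomial.X - Polynomial.C (r ^ 4)) * (Polynomial.X - Polynomial.C (r ^ 5)) *
  (Polynomial.X - Polynomial.C (r ^ 6))

theorem eval_quarticPoly (r x : ℂ) : (quarticPoly r).eval x = quartic r x := by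
  simp [quarticPoly, quartic]

/-- Each condition excludes finitely many `x`, as is seen from its value at one point; for those that
compare quartics, at a zero of just one side. -/
theorem generically_isGood : Generically X (fun p => IsGood (p 0)) := by
  have d : ∀ i j : ℕ, i < 7 → j < 7 → i ≠ j → rho ^ i - rho ^ j ≠ 0 := fun i j => rho_sub_ne
  have d1 : ∀ i : ℕ, i ≠ 1 → i < 7 → rho ^ i - rho ≠ 0 := fun i hi hi' => by
    simpa using d i 1 hi' (by norm_num) hi
  have h2 : quartic rho (rho ^ 2) = 0 := by simp [quartic]
  have h4 : quartic rho (rho ^ 4) = 0 := by simp [quartic]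
  have h4' : quartic (rho ^ 2) (rho ^ 4) = 0 := by simp [quartic_rho_sq]
  have n2 : quartic (rho ^ 2) (rho ^ 2) ≠ 0 := by
    rw [quartic_rho_sq]
    simp [d, d1]
  have n4 : quartic (rho ^ 4) (rho ^ 4) ≠ 0 := by
    rw [quartic_rho_four]
    simp [d, d1]
  have t2 : (rho ^ 2) ^ 2 + (rho ^ 2) ^ 2 ≠ 0 := by
    rw [← two_mul]
    simp [rho_ne_zero]
  have t4 : (rho ^ 4) ^ 2 + (rho ^ 4) ^ 2 ≠ 0 := by
    rw [← two_mul]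
    simp [rho_ne_zero]
  have g1 := generically_ne (f := Polynomial.X) (g := 0) 1 (by simp)
  have g2 := generically_ne (f := Polynomial.X ^ 7) (g := 1) 0 (by simp)
  have g3 := generically_ne (f := Polynomial.X ^ 2 + 1) (g := 0) 0 (by simp)
  have g4 := generically_ne (f := Polynomial.X ^ 4 + 1) (g := 0) 0 (by simp)
  have g5 := generically_ne (f := quarticPoly rho) (g := quarticPoly (rho ^ 2)) (rho ^ 2)
    (by rw [eval_quarticPoly, eval_quarticPoly, h2]; exact n2.symm)
  have g6 := generically_ne (f := quarticPoly rho) (g := quarticPoly (rho ^ 4)) (rho ^ 4)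
    (by rw [eval_quarticPoly, eval_quarticPoly, h4]; exact n4.symm)
  have g7 := generically_ne (f := quarticPoly (rho ^ 2)) (g := quarticPoly (rho ^ 4)) (rho ^ 4)
    (by rw [eval_quarticPoly, eval_quarticPoly, h4']; exact n4.symm)
  let P : ℂ → Polynomial ℂ := fun r =>
    quarticPoly r * (Polynomial.X ^ 2 + Polynomial.C (r ^ 2)) ^ 2
  have hP : ∀ r x, (P r).eval x = quartic r x * (x ^ 2 + r ^ 2) ^ 2 := fun r x => by
    simp [P, eval_quarticPoly]
  have g8 := generically_ne (f := P rho) (g := P (rho ^ 2)) (rho ^ 2)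
    (by rw [hP, hP, h2, zero_mul]; exact (mul_ne_zero n2 (pow_ne_zero 2 t2)).symm)
  have g9 := generically_ne (f := P rho) (g := P (rho ^ 4)) (rho ^ 4)
    (by rw [hP, hP, h4, zero_mul]; exact (mul_ne_zero n4 (pow_ne_zero 2 t4)).symm)
  have g10 := generically_ne (f := P (rho ^ 2)) (g := P (rho ^ 4)) (rho ^ 4)
    (by rw [hP, hP, h4', zero_mul]; exact (mul_ne_zero n4 (pow_ne_zero 2 t4)).symm)
  refine (((((g1.and g2).and (g3.and g4)).and (g5.and (g6.and g7))).and
    (g8.and (g9.and g10)))).mono fun p _ h => ?_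
  simp only [eval_quarticPoly, hP] at h
  obtain ⟨⟨⟨⟨h1, h2⟩, h3, h4⟩, h5, h6, h7⟩, h8, h9, h10⟩ := h
  exact ⟨by simpa using h1, by simpa using h2, by simpa using h3, by simpa using h4, h5, h6, h7,
    h8, h9, h10⟩

/-- The relations between `y₂`, `y₄` and `y₆`. -/
structure RootRelations (x y z w : ℂ) : Prop where
  sq₂ : y ^ 2 = quartic rho x
  sq₄ : z ^ 2 = quartic (rho ^ 2) x
  sq₆ : w ^ 2 = quartic (rho ^ 4) x
  mul₄₆ : z * w = y * cofactor rho x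
  mul₆₂ : w * y = z * cofactor (rho ^ 2) x
  mul₂₄ : y * z = w * cofactor (rho ^ 4) x

theorem rootRelations {p : Fin 4 → ℂ} (hp : p ∈ X) (h4 : p 0 - rho ^ 4 ≠ 0)
    (h5 : p 0 - rho ^ 5 ≠ 0) : RootRelations (p 0) (p 2) (p 3) (y6 p) := by
  obtain ⟨_, e2, e3⟩ := hp
  have hy : y6 p * ((p 0 - rho ^ 4) * (p 0 - rho ^ 5)) = p 2 * p 3 := by
    rw [y6, div_mul_cancel₀ _ (mul_ne_zero h4 h5)]
  have h45 := mul_ne_zero h4 h5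
  refine ⟨by rw [e2, quartic], by rw [e3, quartic_rho_sq]; ring, ?_, ?_, ?_, ?_⟩
  · rw [quartic_rho_four]
    refine mul_right_cancel₀ (pow_ne_zero 2 h45) ?_
    rw [← mul_pow, hy, mul_pow, e2, e3]
    ring
  · rw [cofactor]
    refine mul_right_cancel₀ h45 ?_
    linear_combination p 3 * hy + p 2 * e3
  · rw [cofactor_rho_sq]
    refine mul_right_cancel₀ h45 ?_
    linear_combination p 2 * hy + p 3 * e2
  · rw [cofactor_rho_four, ← hy]

/-- One of three numbers is determined by their sum, their squares, and the ratio of the product of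
the other two to it. -/
theorem eq_div_of_mul_eq {y z w c : ℂ} (h : z * w = y * c) (hz : y ^ 2 ≠ z ^ 2)
    (hw : y ^ 2 ≠ w ^ 2) : y + z + w + c ≠ 0 ∧
      y = (y ^ 2 + ((y + z + w) ^ 2 - (y ^ 2 + z ^ 2 + w ^ 2)) / 2) / (y + z + w + c) := by
  have h1 : y * (y + z + w + c) = (y + z) * (y + w) := by linear_combination -h
  have hyz : y + z ≠ 0 := fun h0 => hz (by linear_combination (y - z) * h0)
  have hyw : y + w ≠ 0 := fun h0 => hw (by linear_combination (y - w) * h0)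
  have h2 : y + z + w + c ≠ 0 := fun h0 => mul_ne_zero hyz hyw (by rw [← h1, h0, mul_zero])
  refine ⟨h2, ?_⟩
  rw [eq_div_iff h2, h1]
  ring

/-- The value of the square root attached to `r` in terms of `x`, the sum `s` and the sum of
squares `t`. -/
def rootOf (r x s t : ℂ) : ℂ := (quartic r x + (s ^ 2 - t) / 2) / (s + cofactor r x)

/-- The single formula `rootOf r` gives the three square roots at `r = ρ, ρ², ρ⁴`. -/
theorem RootRelations.eq_rootOf {x y z w : ℂ} (h : RootRelations x y z w) (hx : IsGood x) :
    ((y + z + w) + cofactor rho x ≠ 0 ∧ (y + z + w) + cofactor (rho ^ 2) x ≠ 0 ∧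
      (y + z + w) + cofactor (rho ^ 4) x ≠ 0) ∧
    y = rootOf rho x (y + z + w) (y ^ 2 + z ^ 2 + w ^ 2) ∧
    z = rootOf (rho ^ 2) x (y + z + w) (y ^ 2 + z ^ 2 + w ^ 2) ∧
    w = rootOf (rho ^ 4) x (y + z + w) (y ^ 2 + z ^ 2 + w ^ 2) := by
  have n1 : y ^ 2 ≠ z ^ 2 := by rw [h.sq₂, h.sq₄]; exact hx.ne₂₄
  have n2 : y ^ 2 ≠ w ^ 2 := by rw [h.sq₂, h.sq₆]; exact hx.ne₂₆
  have n3 : z ^ 2 ≠ w ^ 2 := by rw [h.sq₄, h.sq₆]; exact hx.ne₄₆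
  obtain ⟨a1, b1⟩ := eq_div_of_mul_eq h.mul₄₆ n1 n2
  obtain ⟨a2, b2⟩ := eq_div_of_mul_eq h.mul₆₂ n3 n1.symm
  obtain ⟨a3, b3⟩ := eq_div_of_mul_eq h.mul₂₄ n2.symm n3.symm
  rw [show z + w + y = y + z + w by ring] at a2 b2
  rw [show w + y + z = y + z + w by ring] at a3 b3
  refine ⟨⟨a1, a2, a3⟩, ?_, ?_, ?_⟩
  · rw [rootOf, ← h.sq₂]
    exact b1
  · rw [rootOf, ← h.sq₄, show y ^ 2 + z ^ 2 + w ^ 2 = z ^ 2 + w ^ 2 + y ^ 2 by ring]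
    exact b2
  · rw [rootOf, ← h.sq₆, show y ^ 2 + z ^ 2 + w ^ 2 = w ^ 2 + y ^ 2 + z ^ 2 by ring]
    exact b3

theorem IsGood.rootRelations {p : Fin 4 → ℂ} (hx : IsGood (p 0)) (hp : p ∈ X) :
    RootRelations (p 0) (p 2) (p 3) (y6 p) :=
  FrickeMacbeath.rootRelations hp (hx.ne_rho_pow 4) (hx.ne_rho_pow 5)

end Roots

/-! ### The map `L1star` -/

section L1star

theorem IsRatFun.quartic {ι κ : Type} {V : Set (ι → ℂ)} [(vanishingIdeal ℂ V).IsPrime] {k : Type}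
    [Field k] [Algebra k ℂ] {v : (ι → ℂ) → (κ → ℂ)} {g : (ι → ℂ) → ℂ} {r : ℂ}
    (hr : IsRatFun k V v (fun _ => r)) (hg : IsRatFun k V v g) :
    IsRatFun k V v (fun p => FrickeMacbeath.quartic r (g p)) :=
  (((hg.sub (hr.pow 2)).mul (hg.sub (hr.pow 4))).mul (hg.sub (hr.pow 5))).mul (hg.sub (hr.pow 6))

theorem IsRatFun.cofactor {ι κ : Type} {V : Set (ι → ℂ)} [(vanishingIdeal ℂ V).IsPrime] {k : Type}
    [Field k] [Algebra k ℂ] {v : (ι → ℂ) → (κ → ℂ)} {g : (ι → ℂ) → ℂ} {r : ℂ}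
    (hr : IsRatFun k V v (fun _ => r)) (hg : IsRatFun k V v g) :
    IsRatFun k V v (fun p => FrickeMacbeath.cofactor r (g p)) :=
  (hg.sub hr).mul (hg.sub (hr.pow 3))

theorem isRatFun_rho {ι κ : Type} {V : Set (ι → ℂ)} {v : (ι → ℂ) → (κ → ℂ)} :
    IsRatFun QRho V v (fun _ => rho) := IsRatFun.const (⟨rho, rho_mem⟩ : QRho)

theorem isRatFun_L1star (i : Fin 5) : IsRatFun QRho X id (fun p => L1star p i) := by
  have c : ∀ i : Fin 4, IsRatFun QRho X id (fun p => p i) := IsRatFun.coord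
  have h3 : IsRatFun QRho X id (fun _ => (3 : ℂ)) := IsRatFun.natCast 3
  have hy : IsRatFun QRho X id y6 := ((c 2).mul (c 3)).div
    (((c 0).sub (isRatFun_rho.pow 4)).mul ((c 0).sub (isRatFun_rho.pow 5)))
    (generically_isGood.mono fun p _ h => mul_ne_zero (h.ne_rho_pow 4) (h.ne_rho_pow 5))
  fin_cases i
  · exact h3.mul (c 0)
  · exact h3.mul (c 1)
  · exact ((c 2).add (c 3)).add hy
  · exact (((c 2).pow 2).add ((c 3).pow 2)).add (hy.pow 2)
  · exact (((c 2).pow 3).add ((c 3).pow 3)).add (hy.pow 3)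

/-- The coordinate `x` as a function of the value of `L1star`. -/
theorem isRatFun_x {k : Type} [Field k] [Algebra k ℂ] : IsRatFun k X L1star (fun p => p 0) := by
  have h3 : IsRatFun k X L1star (fun _ => (3 : ℂ)) := IsRatFun.natCast 3
  refine ((IsRatFun.coord 0).div h3 (generically_of_forall fun _ _ => by norm_num)).congr
    (generically_of_forall fun p _ => ?_)
  simp [L1star]

theorem isRatFun_y1 {k : Type} [Field k] [Algebra k ℂ] : IsRatFun k X L1star (fun p => p 1) := by
  have h3 : IsRatFun k X L1star (fun _ => (3 : ℂ)) := IsRatFun.natCast 3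
  refine ((IsRatFun.coord 1).div h3 (generically_of_forall fun _ _ => by norm_num)).congr
    (generically_of_forall fun p _ => ?_)
  simp [L1star]

theorem IsGood.eq_rootOf {p : Fin 4 → ℂ} (hx : IsGood (p 0)) (hp : p ∈ X) :
    (L1star p 2 + cofactor rho (p 0) ≠ 0 ∧ L1star p 2 + cofactor (rho ^ 2) (p 0) ≠ 0 ∧
      L1star p 2 + cofactor (rho ^ 4) (p 0) ≠ 0) ∧
    p 2 = rootOf rho (p 0) (L1star p 2) (L1star p 3) ∧
    p 3 = rootOf (rho ^ 2) (p 0) (L1star p 2) (L1star p 3) ∧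
    y6 p = rootOf (rho ^ 4) (p 0) (L1star p 2) (L1star p 3) :=
  (hx.rootRelations hp).eq_rootOf hx

/-- The inverse of `L1star` is rational over `ℚ(ρ)`: the power sums of `y₂, y₄, y₆` determine the
three numbers, without ambiguity of order, because of the relations `RootRelations`. -/
theorem isRatFun_L1star_inv (i : Fin 4) : IsRatFun QRho X L1star (fun p => p i) := by
  have h2 : IsRatFun QRho X L1star (fun _ => (2 : ℂ)) := IsRatFun.natCast 2
  have hx : IsRatFun QRho X L1star (fun p => p 0) := isRatFun_x
  have hroot : ∀ r : ℂ, IsRatFun QRho X L1star (fun _ => r) →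
      Generically X (fun p => L1star p 2 + cofactor r (p 0) ≠ 0) →
      IsRatFun QRho X L1star (fun p => rootOf r (p 0) (L1star p 2) (L1star p 3)) := fun r hr h0 =>
    ((IsRatFun.quartic hr hx).add ((((IsRatFun.coord 2).pow 2).sub (IsRatFun.coord 3)).div h2
      (generically_of_forall fun _ _ => by norm_num))).div
      ((IsRatFun.coord 2).add (IsRatFun.cofactor hr hx)) h0
  fin_cases i
  · exact isRatFun_x
  · exact isRatFun_y1
  · exact (hroot rho isRatFun_rho
      (generically_isGood.mono fun p hp h => (h.eq_rootOf hp).1.1)).congr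
      (generically_isGood.mono fun p hp h => (h.eq_rootOf hp).2.1)
  · exact (hroot (rho ^ 2) (isRatFun_rho.pow 2)
      (generically_isGood.mono fun p hp h => (h.eq_rootOf hp).1.2.1)).congr
      (generically_isGood.mono fun p hp h => (h.eq_rootOf hp).2.2.1)

/-- `L1star` is injective on the good points of `X`. -/
theorem L1starInv_L1star {p : Fin 4 → ℂ} (hp : p ∈ X) (hx : IsGood (p 0)) :
    L1starInv (L1star p) = p := by
  have hex : ∃ q ∈ X, L1star q = L1star p := ⟨p, hp, rfl⟩
  have h1 : L1starInv (L1star p) ∈ X := Function.invFunOn_mem hex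
  have h2 : L1star (L1starInv (L1star p)) = L1star p := Function.invFunOn_eq hex
  set q := L1starInv (L1star p)
  have e0 : q 0 = p 0 := by
    have := congrFun h2 0
    simpa [L1star] using this
  have e1 : q 1 = p 1 := by
    have := congrFun h2 1
    simpa [L1star] using this
  have hq : IsGood (q 0) := by rwa [e0]
  obtain ⟨_, a2, a3, _⟩ := hx.eq_rootOf hp
  obtain ⟨_, b2, b3, _⟩ := hq.eq_rootOf h1
  rw [h2, e0, ← a2] at b2
  rw [h2, e0, ← a3] at b3
  funext i
  fin_cases i
  · exact e0
  · exact e1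
  · exact b2
  · exact b3

end L1star

/-! ### The involution `J` -/

section Involution

/-- The conjugate of `J`, as a rational map. -/
def conjJ : RatMap ℂ (Fin 4) (Fin 4) where
  num := ![MvPolynomial.X 0, MvPolynomial.X 1, C (rho ^ 2) * MvPolynomial.X 2,
    C (rho ^ 4) * MvPolynomial.X 3]
  den := MvPolynomial.X 0 ^ 2

theorem conj_pow_rho (j : ℕ) : starRingEnd ℂ (rho ^ j) = rho ^ (6 * j) := by
  rw [map_pow, conj_rho, pow_mul]

theorem conjPt_J (p : Fin 4 → ℂ) :
    conjPt (J p) = ![1 / p 0, p 1 / p 0 ^ 2, rho ^ 2 * p 2 / p 0 ^ 2, rho ^ 4 * p 3 / p 0 ^ 2] := by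
  have h5 : starRingEnd ℂ rho ^ 5 = rho ^ 2 := by
    rw [conj_rho, ← pow_mul]
    norm_num [rho_pow_eq 2, rho_pow_eq 9, rho_pow_eq 16, rho_pow_eq 23]
  have h3 : starRingEnd ℂ rho ^ 3 = rho ^ 4 := by
    rw [conj_rho, ← pow_mul]
    norm_num [rho_pow_eq 4, rho_pow_eq 11]
  funext i
  fin_cases i <;> simp [conjPt, J, h5, h3]

theorem rho_pow_mul_conj (j : ℕ) : rho ^ j * starRingEnd ℂ (rho ^ j) = 1 := by
  rw [conj_pow_rho, ← pow_add, show j + 6 * j = 7 * j by ring, pow_mul, rho_pow_seven, one_pow]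

/-- The reflection in the unit circle fixes the branch points; this is why `J` preserves `X`. -/
theorem inv_conj_sub {x : ℂ} (hx : x ≠ 0) (j : ℕ) : 1 / starRingEnd ℂ x - rho ^ j =
    -rho ^ j * starRingEnd ℂ (x - rho ^ j) / starRingEnd ℂ x := by
  have hx' : starRingEnd ℂ x ≠ 0 := (map_ne_zero _).2 hx
  rw [map_sub]
  field_simp
  linear_combination -rho_pow_mul_conj j

theorem J_mem_X {p : Fin 4 → ℂ} (hp : p ∈ X) (h0 : p 0 ≠ 0) : J p ∈ X := by
  obtain ⟨e1, e2, e3⟩ := hp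
  have hx' : starRingEnd ℂ (p 0) ≠ 0 := (map_ne_zero _).2 h0
  have h1 := inv_conj_sub h0 0
  rw [pow_zero] at h1
  have h1' := inv_conj_sub h0 1
  rw [pow_one] at h1'
  have h7 := rho_pow_seven
  refine ⟨?_, ?_, ?_⟩
  · simp only [J, conjPt, Matrix.cons_val]
    rw [h1, inv_conj_sub h0, inv_conj_sub h0, inv_conj_sub h0, div_pow, ← map_pow, e1]
    simp only [map_mul]
    field_simp
    linear_combination (-1 - rho ^ 7) * (starRingEnd ℂ (p 0 - 1) * starRingEnd ℂ (p 0 - rho ^ 3) *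
      starRingEnd ℂ (p 0 - rho ^ 5) * starRingEnd ℂ (p 0 - rho ^ 6)) * h7
  · simp only [J, conjPt, Matrix.cons_val]
    rw [inv_conj_sub h0, inv_conj_sub h0, inv_conj_sub h0, inv_conj_sub h0, div_pow, mul_pow,
      ← map_pow, e2]
    simp only [map_mul]
    field_simp
    linear_combination -rho ^ 10 * (starRingEnd ℂ (p 0 - rho ^ 2) * starRingEnd ℂ (p 0 - rho ^ 4) *
      starRingEnd ℂ (p 0 - rho ^ 5) * starRingEnd ℂ (p 0 - rho ^ 6)) * h7
  · simp only [J, conjPt, Matrix.cons_val]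
    rw [h1', inv_conj_sub h0, inv_conj_sub h0, inv_conj_sub h0, div_pow, mul_pow, ← map_pow, e3]
    simp only [map_mul]
    field_simp
    linear_combination -rho ^ 6 * (starRingEnd ℂ (p 0 - rho) * starRingEnd ℂ (p 0 - rho ^ 3) *
      starRingEnd ℂ (p 0 - rho ^ 4) * starRingEnd ℂ (p 0 - rho ^ 5)) * h7

theorem J_zero (p : Fin 4 → ℂ) : J p 0 = 1 / starRingEnd ℂ (p 0) := rfl

theorem J_J {p : Fin 4 → ℂ} (h0 : p 0 ≠ 0) : J (J p) = p := by
  have hx' : starRingEnd ℂ (p 0) ≠ 0 := (map_ne_zero _).2 h0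
  have h5 := rho_pow_mul_conj 5
  have h3 := rho_pow_mul_conj 3
  rw [map_pow] at h5 h3
  funext i
  fin_cases i
  · simp [J, conjPt]
  · simp [J, conjPt]
    field_simp
  · simp [J, conjPt]
    field_simp
    linear_combination p 2 * h5
  · simp [J, conjPt]
    field_simp
    linear_combination p 3 * h3

/-- Generic properties of `X` are preserved by `J`. -/
theorem Generically.comp_J {P : (Fin 4 → ℂ) → Prop} (hP : Generically X P) :
    Generically X (fun p => P (J p)) := by
  refine Generically.comp_antirational conjJ (E := MvPolynomial.X 0) (fun h => ?_)
    (fun p hp h0 => ?_) hP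
  · obtain ⟨p, hp, h1⟩ := exists_mem_X 1
    have := h p hp
    rw [aeval_X, h1] at this
    exact one_ne_zero this
  · rw [aeval_X] at h0
    refine ⟨J_mem_X hp h0, ?_, J_J h0, ?_, ?_⟩
    · rw [aeval_X, J_zero]
      exact one_div_ne_zero ((map_ne_zero _).2 h0)
    · simpa [RatMap.DefinedAt, conjJ] using h0
    · rw [conjPt_J]
      funext i
      fin_cases i
      · simp [RatMap.eval, conjJ]
        field_simp
      · simp [RatMap.eval, conjJ]
      · simp [RatMap.eval, conjJ]
      · simp [RatMap.eval, conjJ]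

theorem generically_J_J : Generically X (fun p => J (J p) = p) :=
  generically_isGood.mono fun _ _ h => J_J h.ne_zero

/-- The parametrisation of the complex conjugate of `Z2` by `X` that lifts `gEta`. -/
def conjL1star (p : Fin 4 → ℂ) : Fin 5 → ℂ := conjPt (L1star (J p))

theorem conj_y6_J {p : Fin 4 → ℂ} (hx : IsGood (p 0)) :
    starRingEnd ℂ (y6 (J p)) = rho * y6 p / p 0 ^ 2 := by
  have h0 := hx.ne_zero
  have h4 := hx.ne_rho_pow 4
  have h5 := hx.ne_rho_pow 5
  have hJ : ∀ i, starRingEnd ℂ (J p i) = conjPt (J p) i := fun _ => rfl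
  have key : ∀ i j : ℕ, i + j = 7 →
      1 / p 0 - rho ^ i = -rho ^ i * (p 0 - rho ^ j) / p 0 := fun i j hij => by
    have : rho ^ i * rho ^ j = 1 := by rw [← pow_add, hij, rho_pow_seven]
    field_simp
    linear_combination -this
  have c4 : starRingEnd ℂ (rho ^ 4) = rho ^ 3 := by
    rw [conj_pow_rho]
    norm_num [rho_pow_eq 3, rho_pow_eq 10, rho_pow_eq 17]
  have c5 : starRingEnd ℂ (rho ^ 5) = rho ^ 2 := by
    rw [conj_pow_rho]
    norm_num [rho_pow_eq 2, rho_pow_eq 9, rho_pow_eq 16, rho_pow_eq 23]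
  simp only [y6, map_div₀, map_mul, map_sub, hJ, c4, c5, conjPt_J, Matrix.cons_val]
  rw [key 3 4 rfl, key 2 5 rfl]
  have := rho_ne_zero
  field_simp

/-- Conjugation cancels the conjugations in `J`, and `conjL1star` is `L1star` with `x` replaced by
`1 / x` and the square roots attached to `r` multiplied by `r ^ 2 / x ^ 2`. -/
theorem conjL1star_eq {p : Fin 4 → ℂ} (hx : IsGood (p 0)) :
    conjL1star p = ![3 / p 0, 3 * p 1 / p 0 ^ 2,
      (rho ^ 2 * p 2 + rho ^ 4 * p 3 + rho * y6 p) / p 0 ^ 2,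
      ((rho ^ 2 * p 2) ^ 2 + (rho ^ 4 * p 3) ^ 2 + (rho * y6 p) ^ 2) / p 0 ^ 4,
      ((rho ^ 2 * p 2) ^ 3 + (rho ^ 4 * p 3) ^ 3 + (rho * y6 p) ^ 3) / p 0 ^ 6] := by
  have h0 := hx.ne_zero
  have c0 : starRingEnd ℂ (J p 0) = 1 / p 0 := congrFun (conjPt_J p) 0
  have c1 : starRingEnd ℂ (J p 1) = p 1 / p 0 ^ 2 := congrFun (conjPt_J p) 1
  have c2 : starRingEnd ℂ (J p 2) = rho ^ 2 * p 2 / p 0 ^ 2 := congrFun (conjPt_J p) 2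
  have c3 : starRingEnd ℂ (J p 3) = rho ^ 4 * p 3 / p 0 ^ 2 := congrFun (conjPt_J p) 3
  have c6 := conj_y6_J hx
  have h3 : starRingEnd ℂ 3 = 3 := map_ofNat _ 3
  funext i
  fin_cases i
  · simp only [conjL1star, L1star, conjPt, Fin.zero_eta, Matrix.cons_val_zero, map_mul, c0, h3]
    ring
  · simp only [conjL1star, L1star, conjPt, Fin.mk_one, Matrix.cons_val_one, Matrix.cons_val_zero,
      map_mul, c1, h3]
    ring
  · simp only [conjL1star, L1star, conjPt, Fin.reduceFinMk, Matrix.cons_val, map_add, c2, c3, c6]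
    ring
  · simp only [conjL1star, L1star, conjPt, Fin.reduceFinMk, Matrix.cons_val, map_add, map_pow, c2,
      c3, c6]
    ring
  · simp only [conjL1star, L1star, conjPt, Fin.reduceFinMk, Matrix.cons_val, map_add, map_pow, c2,
      c3, c6]
    ring

end Involution

/-! ### Rationality over the quadratic subfield -/

section Rationality

theorem RatFamily.quartic {ι κ : Type} {V : Set (ι → ℂ)} {k : Type}
    [Field k] [Algebra k ℂ] {v : (ι → ℂ) → (κ → ℂ)} {g : (ι → ℂ) → ℂ} (hg : IsRatFun k V v g) :
    RatFamily k V v (fun r p => FrickeMacbeath.quartic r (g p)) :=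
  ((((base hg).sub (root.pow 2)).mul ((base hg).sub (root.pow 4))).mul
    ((base hg).sub (root.pow 5))).mul ((base hg).sub (root.pow 6))

theorem RatFamily.cofactor {ι κ : Type} {V : Set (ι → ℂ)} {k : Type}
    [Field k] [Algebra k ℂ] {v : (ι → ℂ) → (κ → ℂ)} {g : (ι → ℂ) → ℂ} (hg : IsRatFun k V v g) :
    RatFamily k V v (fun r p => FrickeMacbeath.cofactor r (g p)) :=
  ((base hg).sub root).mul ((base hg).sub (root.pow 3))

/-- The map `gEta` is defined over `ℚ(√-7)`: the components of `conjL1star` are traces of families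
in `r`, because the factors `ρ², ρ⁴, ρ` of `y₂, y₄, y₆` are the values of `r ^ 2`. -/
theorem isRatFun_conjL1star (i : Fin 5) :
    IsRatFun QSqrtNegSeven X L1star (fun p => conjL1star p i) := by
  have h3 : IsRatFun QSqrtNegSeven X L1star (fun _ => (3 : ℂ)) := IsRatFun.natCast 3
  have h2 : IsRatFun QSqrtNegSeven X L1star (fun _ => (2 : ℂ)) := IsRatFun.natCast 2
  have hx : IsRatFun QSqrtNegSeven X L1star (fun p => p 0) := isRatFun_x
  have hy : IsRatFun QSqrtNegSeven X L1star (fun p => p 1) := isRatFun_y1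
  have hx0 : ∀ m : ℕ, Generically X (fun p => p 0 ^ m ≠ 0) := fun m =>
    generically_isGood.mono fun p _ h => pow_ne_zero m h.ne_zero
  have hN : RatFamily QSqrtNegSeven X L1star
      (fun r p => quartic r (p 0) + (L1star p 2 ^ 2 - L1star p 3) / 2) :=
    (RatFamily.quartic hx).add (RatFamily.base ((((IsRatFun.coord 2).pow 2).sub
      (IsRatFun.coord 3)).div h2 (generically_of_forall fun _ _ => by norm_num)))
  have hD : RatFamily QSqrtNegSeven X L1star (fun r p => L1star p 2 + cofactor r (p 0)) :=
    (RatFamily.base (IsRatFun.coord 2)).add (RatFamily.cofactor hx)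
  have hD0 : Generically X (fun p => L1star p 2 + cofactor rho (p 0) ≠ 0 ∧
      L1star p 2 + cofactor (rho ^ 2) (p 0) ≠ 0 ∧ L1star p 2 + cofactor (rho ^ 4) (p 0) ≠ 0) :=
    generically_isGood.mono fun p hp h => (h.eq_rootOf hp).1
  have h7 := rho_pow_seven
  fin_cases i
  · refine (h3.div hx (generically_isGood.mono fun p _ h => h.ne_zero)).congr
      (generically_isGood.mono fun p _ h => ?_)
    rw [conjL1star_eq h]
    rfl
  · refine ((h3.mul hy).div (hx.pow 2) (hx0 2)).congr
      (generically_isGood.mono fun p _ h => ?_)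
    rw [conjL1star_eq h]
    rfl
  · refine ((((RatFamily.root.pow 2).mul hN).isRatFun_trace_div hD hD0).div (hx.pow 2)
      (hx0 2)).congr (generically_isGood.mono fun p hp h => ?_)
    rw [conjL1star_eq h]
    obtain ⟨_, a2, a3, a6⟩ := h.eq_rootOf hp
    simp only [trace, mul_div_assoc]
    simp only [rootOf] at a2 a3 a6
    rw [← a2, ← a3, ← a6]
    simp only [Fin.reduceFinMk, Matrix.cons_val]
    linear_combination (-rho * y6 p / p 0 ^ 2) * h7
  · refine ((((RatFamily.root.pow 4).mul (RatFamily.quartic hx)).isRatFun_trace).div (hx.pow 4)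
      (hx0 4)).congr (generically_isGood.mono fun p hp h => ?_)
    rw [conjL1star_eq h]
    obtain ⟨b2, b3, b6, _⟩ := h.rootRelations hp
    simp only [trace, ← b2, ← b3, ← b6]
    simp only [Fin.reduceFinMk, Matrix.cons_val]
    linear_combination (-(rho ^ 9 + rho ^ 2) * y6 p ^ 2 / p 0 ^ 4) * h7
  · refine ((((RatFamily.root.pow 6).mul ((RatFamily.quartic hx).mul hN)).isRatFun_trace_div
      hD hD0).div (hx.pow 6) (hx0 6)).congr (generically_isGood.mono fun p hp h => ?_)
    rw [conjL1star_eq h]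
    obtain ⟨b2, b3, b6, _⟩ := h.rootRelations hp
    obtain ⟨_, a2, a3, a6⟩ := h.eq_rootOf hp
    simp only [trace, mul_div_assoc]
    simp only [rootOf] at a2 a3 a6
    rw [← a2, ← a3, ← a6, ← b2, ← b3, ← b6]
    simp only [Fin.reduceFinMk, Matrix.cons_val]
    linear_combination (-(rho ^ 17 + rho ^ 10 + rho ^ 3) * y6 p ^ 3 / p 0 ^ 6) * h7

/-- The parametrisation of `W` by `X`: the value of `Psi2` at `(L1star p, conjL1star p)`. -/
def paramW (p : Fin 4 → ℂ) : Fin 5 ⊕ Fin 5 → ℂ := Psi2 (Sum.elim (L1star p) (conjL1star p))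

theorem paramW_inl (p : Fin 4 → ℂ) (i : Fin 5) :
    paramW p (Sum.inl i) = L1star p i + conjL1star p i := rfl

theorem paramW_inr (p : Fin 4 → ℂ) (i : Fin 5) :
    paramW p (Sum.inr i) = L1star p i ^ 2 + conjL1star p i ^ 2 := rfl

theorem isRatFun_paramW (i : Fin 5 ⊕ Fin 5) :
    IsRatFun QSqrtNegSeven X L1star (fun p => paramW p i) := by
  rcases i with i | i
  · exact (IsRatFun.coord i).add (isRatFun_conjL1star i)
  · exact ((IsRatFun.coord i).pow 2).add ((isRatFun_conjL1star i).pow 2)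

/-- The right-hand side of the first equation has coefficients in `ℚ(√-7)`. -/
theorem A1_eq (x : ℂ) : (x - 1) * (x - rho ^ 3) * (x - rho ^ 5) * (x - rho ^ 6) =
    x ^ 4 + omega * x ^ 3 - x ^ 2 - (1 + omega) * x + 1 := by
  have h1 : rho ^ 3 + rho ^ 5 + rho ^ 6 = -1 - omega := by
    rw [omega]
    linear_combination rho_cyclotomic
  have h2 : rho ^ 3 * rho ^ 5 + rho ^ 3 * rho ^ 6 + rho ^ 5 * rho ^ 6 = omega := by
    rw [omega]
    linear_combination (rho + rho ^ 2 + rho ^ 4) * rho_pow_seven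
  have h3 : rho ^ 3 * rho ^ 5 * rho ^ 6 = 1 := by
    linear_combination (rho ^ 7 + 1) * rho_pow_seven
  linear_combination (x - 1) * (-x ^ 2 * h1 + x * h2 - h3)

theorem isRatFun_omega {ι κ : Type} {V : Set (ι → ℂ)} {v : (ι → ℂ) → (κ → ℂ)} :
    IsRatFun QSqrtNegSeven V v (fun _ => omega) :=
  IsRatFun.const (⟨omega, omega_mem⟩ : QSqrtNegSeven)

theorem two_omega_add_one_ne_zero : 2 * omega + 1 ≠ 0 := by
  rcases two_omega_add_one with h | h <;> rw [h]
  · exact delta_ne_zero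
  · exact neg_ne_zero.2 delta_ne_zero

/-- The coordinate `x` is rational over `ℚ(√-7)` in the coordinates of `W`: with `m = x + 1 / x`,
the function `y₁ ^ 2 / x ^ 2` is known, and it is not symmetric under `x ↦ 1 / x`. -/
theorem isRatFun_paramW_x : IsRatFun QSqrtNegSeven X paramW (fun p => p 0) := by
  have n : ∀ m : ℕ, IsRatFun QSqrtNegSeven X paramW (fun _ => (m : ℂ)) := fun m =>
    IsRatFun.natCast m
  have hm : IsRatFun QSqrtNegSeven X paramW (fun p => paramW p (Sum.inl 0) / ((3 : ℕ) : ℂ)) :=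
    (IsRatFun.coord _).div (n 3) (generically_of_forall fun _ _ => by norm_num)
  have em : ∀ p : Fin 4 → ℂ, IsGood (p 0) →
      paramW p (Sum.inl 0) / ((3 : ℕ) : ℂ) = p 0 + 1 / p 0 := fun p h => by
    rw [paramW_inl, conjL1star_eq h]
    simp [L1star]
    ring
  have hB : IsRatFun QSqrtNegSeven X paramW (fun p => paramW p (Sum.inr 1) /
      (((9 : ℕ) : ℂ) * ((paramW p (Sum.inl 0) / ((3 : ℕ) : ℂ)) ^ 2 - ((2 : ℕ) : ℂ)))) := by
    refine (IsRatFun.coord _).div ((n 9).mul ((hm.pow 2).sub (n 2)))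
      (generically_isGood.mono fun p _ h => ?_)
    rw [em p h]
    have h0 := h.ne_zero
    have : (p 0 + 1 / p 0) ^ 2 - ((2 : ℕ) : ℂ) = (p 0 ^ 4 + 1) / p 0 ^ 2 := by
      field_simp
      push_cast
      ring
    rw [this]
    exact mul_ne_zero (by norm_num) (div_ne_zero h.four_ne (pow_ne_zero 2 h0))
  have h2o := isRatFun_omega (V := X) (v := paramW)
  refine ((((hB.sub (hm.pow 2)).add (n 3)).add (((n 1).add h2o).mul hm)).div
    (((n 2).mul h2o).add (n 1)) (generically_of_forall fun _ _ => by
      simpa using two_omega_add_one_ne_zero)).congr (generically_isGood.mono fun p hp h => ?_)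
  have h0 := h.ne_zero
  have h4 := h.four_ne
  have e1 := hp.1
  rw [A1_eq] at e1
  have e2 : paramW p (Sum.inr 1) = 9 * p 1 ^ 2 * (p 0 ^ 4 + 1) / p 0 ^ 4 := by
    rw [paramW_inr, conjL1star_eq h]
    simp [L1star]
    field_simp
    ring
  have e3 : (p 0 + 1 / p 0) ^ 2 - 2 = (p 0 ^ 4 + 1) / p 0 ^ 2 := by
    field_simp
    ring
  have h2 := two_omega_add_one_ne_zero
  rw [em p h, e2, e1]
  push_cast
  rw [e3, eq_div_iff h2]
  field_simp
  ring

/-- The factor by which the square root attached to `r` is scaled in the coordinates of `W`. -/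
def twist (r x : ℂ) : ℂ := 1 + r ^ 2 / x ^ 2

theorem twist_cycle (x : ℂ) : twist (rho ^ 8) x = twist rho x ∧
    twist (rho ^ 16) x = twist (rho ^ 2) x := by
  simp only [twist, ← pow_mul]
  norm_num [rho_pow_eq 2, rho_pow_eq 9, rho_pow_eq 4, rho_pow_eq 11, rho_pow_eq 18, rho_pow_eq 25]

/-- The weighted version of `eq_div_of_mul_eq`. -/
theorem eq_div_of_mul_eq_of_twist {y z w c a b d : ℂ} (h : z * w = y * c)
    (hz : (y * a) ^ 2 ≠ (z * b) ^ 2) (hw : (y * a) ^ 2 ≠ (w * d) ^ 2) :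
    a * (y * a + z * b + w * d) + c * (b * d) ≠ 0 ∧
      y = ((y * a) ^ 2 + ((y * a + z * b + w * d) ^ 2 -
        ((y * a) ^ 2 + (z * b) ^ 2 + (w * d) ^ 2)) / 2) /
        (a * (y * a + z * b + w * d) + c * (b * d)) := by
  have h1 : y * (a * (y * a + z * b + w * d) + c * (b * d)) = (y * a + z * b) * (y * a + w * d) := by
    linear_combination -(b * d) * h
  have hyz : y * a + z * b ≠ 0 := fun h0 => hz (by linear_combination (y * a - z * b) * h0)
  have hyw : y * a + w * d ≠ 0 := fun h0 => hw (by linear_combination (y * a - w * d) * h0)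
  have h2 : a * (y * a + z * b + w * d) + c * (b * d) ≠ 0 := fun h0 =>
    mul_ne_zero hyz hyw (by rw [← h1, h0, mul_zero])
  refine ⟨h2, ?_⟩
  rw [eq_div_iff h2, h1]
  ring

/-- The numerator and denominator of the square root attached to `r`, in terms of `x` and the
third coordinate `u` of `W`. -/
def twistNum (r x u : ℂ) : ℂ :=
  quartic r x * twist r x ^ 2 + (u ^ 2 - trace fun r => quartic r x * twist r x ^ 2) / 2

/-- See `twistNum`. -/
def twistDen (r x u : ℂ) : ℂ :=
  twist r x * u + cofactor r x * (twist (r ^ 2) x * twist (r ^ 4) x)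

/-- The three square roots in terms of `x` and the coordinate `u = ∑ y(r) (1 + r ^ 2 / x ^ 2)` of `W`. -/
theorem IsGood.eq_twist {p : Fin 4 → ℂ} (hx : IsGood (p 0)) (hp : p ∈ X) :
    (twistDen rho (p 0) (paramW p (Sum.inl 2)) ≠ 0 ∧
      twistDen (rho ^ 2) (p 0) (paramW p (Sum.inl 2)) ≠ 0 ∧
      twistDen (rho ^ 4) (p 0) (paramW p (Sum.inl 2)) ≠ 0) ∧
    p 2 = twistNum rho (p 0) (paramW p (Sum.inl 2)) /
      twistDen rho (p 0) (paramW p (Sum.inl 2)) ∧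
    p 3 = twistNum (rho ^ 2) (p 0) (paramW p (Sum.inl 2)) /
      twistDen (rho ^ 2) (p 0) (paramW p (Sum.inl 2)) ∧
    y6 p = twistNum (rho ^ 4) (p 0) (paramW p (Sum.inl 2)) /
      twistDen (rho ^ 4) (p 0) (paramW p (Sum.inl 2)) := by
  have h := hx.rootRelations hp
  have h0 := hx.ne_zero
  have hsq : ∀ y r : ℂ, y ^ 2 = quartic r (p 0) →
      (y * twist r (p 0)) ^ 2 = quartic r (p 0) * (p 0 ^ 2 + r ^ 2) ^ 2 / p 0 ^ 4 := by
    intro y r hy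
    rw [mul_pow, hy, twist]
    field_simp
  have hinj : ∀ a b : ℂ, a ≠ b → a / p 0 ^ 4 ≠ b / p 0 ^ 4 := fun a b hab hab' =>
    hab (by rwa [div_left_inj' (pow_ne_zero 4 h0)] at hab')
  have n1 : (p 2 * twist rho (p 0)) ^ 2 ≠ (p 3 * twist (rho ^ 2) (p 0)) ^ 2 := by
    rw [hsq _ _ h.sq₂, hsq _ _ h.sq₄]
    exact hinj _ _ hx.twist₂₄
  have n2 : (p 2 * twist rho (p 0)) ^ 2 ≠ (y6 p * twist (rho ^ 4) (p 0)) ^ 2 := by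
    rw [hsq _ _ h.sq₂, hsq _ _ h.sq₆]
    exact hinj _ _ hx.twist₂₆
  have n3 : (p 3 * twist (rho ^ 2) (p 0)) ^ 2 ≠ (y6 p * twist (rho ^ 4) (p 0)) ^ 2 := by
    rw [hsq _ _ h.sq₄, hsq _ _ h.sq₆]
    exact hinj _ _ hx.twist₄₆
  have hu : paramW p (Sum.inl 2) =
      p 2 * twist rho (p 0) + p 3 * twist (rho ^ 2) (p 0) + y6 p * twist (rho ^ 4) (p 0) := by
    rw [paramW_inl, conjL1star_eq hx]
    simp only [L1star, twist, Matrix.cons_val]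
    linear_combination (-rho * y6 p / p 0 ^ 2) * rho_pow_seven
  have ht : trace (fun r => quartic r (p 0) * twist r (p 0) ^ 2) = (p 2 * twist rho (p 0)) ^ 2 +
      (p 3 * twist (rho ^ 2) (p 0)) ^ 2 + (y6 p * twist (rho ^ 4) (p 0)) ^ 2 := by
    rw [trace, ← h.sq₂, ← h.sq₄, ← h.sq₆]
    ring
  obtain ⟨a1, b1⟩ := eq_div_of_mul_eq_of_twist h.mul₄₆ n1 n2
  obtain ⟨a2, b2⟩ := eq_div_of_mul_eq_of_twist h.mul₆₂ n3 n1.symm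
  obtain ⟨a3, b3⟩ := eq_div_of_mul_eq_of_twist h.mul₂₄ n2.symm n3.symm
  have d1 : twistDen rho (p 0) (paramW p (Sum.inl 2)) = twist rho (p 0) *
      (p 2 * twist rho (p 0) + p 3 * twist (rho ^ 2) (p 0) + y6 p * twist (rho ^ 4) (p 0)) +
      cofactor rho (p 0) * (twist (rho ^ 2) (p 0) * twist (rho ^ 4) (p 0)) := by
    rw [twistDen, hu]
  have d2 : twistDen (rho ^ 2) (p 0) (paramW p (Sum.inl 2)) = twist (rho ^ 2) (p 0) *
      (p 3 * twist (rho ^ 2) (p 0) + y6 p * twist (rho ^ 4) (p 0) + p 2 * twist rho (p 0)) +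
      cofactor (rho ^ 2) (p 0) * (twist (rho ^ 4) (p 0) * twist rho (p 0)) := by
    rw [twistDen, hu, ← pow_mul, ← pow_mul, (twist_cycle (p 0)).1]
    ring
  have d3 : twistDen (rho ^ 4) (p 0) (paramW p (Sum.inl 2)) = twist (rho ^ 4) (p 0) *
      (y6 p * twist (rho ^ 4) (p 0) + p 2 * twist rho (p 0) + p 3 * twist (rho ^ 2) (p 0)) +
      cofactor (rho ^ 4) (p 0) * (twist rho (p 0) * twist (rho ^ 2) (p 0)) := by
    rw [twistDen, hu, ← pow_mul, ← pow_mul, (twist_cycle (p 0)).1, (twist_cycle (p 0)).2]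
    ring
  rw [d1, d2, d3]
  refine ⟨⟨a1, a2, a3⟩, ?_, ?_, ?_⟩
  · rw [twistNum, ht, hu, ← h.sq₂]
    refine b1.trans ?_
    congr 1
    ring
  · rw [twistNum, ht, hu, ← h.sq₄]
    refine b2.trans ?_
    congr 1
    ring
  · rw [twistNum, ht, hu, ← h.sq₆]
    refine b3.trans ?_
    congr 1
    ring

/-- The inverse of `L2` is defined over `ℚ(√-7)`: once `x` is known, the components of `L1star` are
traces of the families `twistNum / twistDen`. -/
theorem isRatFun_paramW_inv (i : Fin 5) :
    IsRatFun QSqrtNegSeven X paramW (fun p => L1star p i) := by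
  have n : ∀ m : ℕ, IsRatFun QSqrtNegSeven X paramW (fun _ => (m : ℂ)) := fun m =>
    IsRatFun.natCast m
  have h3 : IsRatFun QSqrtNegSeven X paramW (fun _ => (3 : ℂ)) := n 3
  have h2 : IsRatFun QSqrtNegSeven X paramW (fun _ => (2 : ℂ)) := n 2
  have h1 : IsRatFun QSqrtNegSeven X paramW (fun _ => (1 : ℂ)) := IsRatFun.one
  have hx := isRatFun_paramW_x
  have hx0 : ∀ m : ℕ, Generically X (fun p => p 0 ^ m ≠ 0) := fun m =>
    generically_isGood.mono fun p _ h => pow_ne_zero m h.ne_zero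
  have hu : IsRatFun QSqrtNegSeven X paramW (fun p => paramW p (Sum.inl 2)) := IsRatFun.coord _
  have ht : RatFamily QSqrtNegSeven X paramW (fun r p => twist r (p 0)) := by
    simpa [twist, div_eq_mul_inv] using (RatFamily.base h1).add
      ((RatFamily.root.pow 2).mul (RatFamily.base ((hx.pow 2).inv (hx0 2))))
  have hqt := (RatFamily.quartic hx).mul (ht.pow 2)
  have hN : RatFamily QSqrtNegSeven X paramW
      (fun r p => twistNum r (p 0) (paramW p (Sum.inl 2))) :=
    hqt.add (RatFamily.base (((hu.pow 2).sub hqt.isRatFun_trace).div h2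
      (generically_of_forall fun _ _ => by norm_num)))
  have hD : RatFamily QSqrtNegSeven X paramW
      (fun r p => twistDen r (p 0) (paramW p (Sum.inl 2))) :=
    (ht.mul (RatFamily.base hu)).add ((RatFamily.cofactor hx).mul
      ((ht.comp_pow 2).mul (ht.comp_pow 4)))
  have hD0 : Generically X (fun p => twistDen rho (p 0) (paramW p (Sum.inl 2)) ≠ 0 ∧
      twistDen (rho ^ 2) (p 0) (paramW p (Sum.inl 2)) ≠ 0 ∧
      twistDen (rho ^ 4) (p 0) (paramW p (Sum.inl 2)) ≠ 0) :=
    generically_isGood.mono fun p hp h => (h.eq_twist hp).1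
  fin_cases i
  · exact h3.mul hx
  · refine (((IsRatFun.coord (Sum.inl 1)).mul (hx.pow 2)).div ((hx.pow 2).add h1)
      (generically_isGood.mono fun p _ h => h.sq_ne)).congr
      (generically_isGood.mono fun p _ h => ?_)
    rw [paramW_inl, conjL1star_eq h]
    have h0 := h.ne_zero
    have := h.sq_ne
    simp [L1star]
    field_simp
  · refine (hN.isRatFun_trace_div hD hD0).congr (generically_isGood.mono fun p hp h => ?_)
    obtain ⟨_, a2, a3, a6⟩ := h.eq_twist hp
    rw [trace, ← a2, ← a3, ← a6]
    rfl
  · refine (RatFamily.quartic hx).isRatFun_trace.congr (generically_isGood.mono fun p hp h => ?_)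
    obtain ⟨b2, b3, b6, _⟩ := h.rootRelations hp
    rw [trace, ← b2, ← b3, ← b6]
    rfl
  · refine (((RatFamily.quartic hx).mul hN).isRatFun_trace_div hD hD0).congr
      (generically_isGood.mono fun p hp h => ?_)
    obtain ⟨b2, b3, b6, _⟩ := h.rootRelations hp
    obtain ⟨_, a2, a3, a6⟩ := h.eq_twist hp
    simp only [trace, mul_div_assoc]
    rw [← a2, ← a3, ← a6, ← b2, ← b3, ← b6]
    simp only [L1star, Fin.reduceFinMk, Matrix.cons_val]
    ring

end Rationality

/-! ### Equations of `Z2` over the quadratic subfield -/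

section Equations

/-- The coefficientwise trace of a polynomial in `r` and `x`. -/
def tracePoly (P : Polynomial (Polynomial QSqrtNegSeven)) : Polynomial QSqrtNegSeven :=
  ∑ i ∈ Finset.range (P.natDegree + 1), P.coeff i * Polynomial.C ⟨_, trace_pow_mem i⟩

theorem aeval_tracePoly (P : Polynomial (Polynomial QSqrtNegSeven)) (x : ℂ) :
    Polynomial.aeval x (tracePoly P) = trace fun r =>
      Polynomial.eval₂ (Polynomial.aeval (R := QSqrtNegSeven) x).toRingHom r P := by
  have h : ∀ i, algebraMap QSqrtNegSeven ℂ ⟨_, trace_pow_mem i⟩ = trace fun r => r ^ i :=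
    fun _ => rfl
  simp only [tracePoly, map_sum, map_mul, Polynomial.aeval_C, h]
  simp only [trace, Polynomial.eval₂_eq_sum_range, ← Finset.sum_add_distrib, mul_add]
  rfl

/-- `quartic (r ^ m) x` as a polynomial in `r` and `x`. -/
def quarticBi (m : ℕ) : Polynomial (Polynomial QSqrtNegSeven) :=
  (Polynomial.C Polynomial.X - (Polynomial.X ^ m) ^ 2) *
  (Polynomial.C Polynomial.X - (Polynomial.X ^ m) ^ 4) *
  (Polynomial.C Polynomial.X - (Polynomial.X ^ m) ^ 5) *
  (Polynomial.C Polynomial.X - (Polynomial.X ^ m) ^ 6)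

/-- `cofactor r x` as a polynomial in `r` and `x`. -/
def cofactorBi : Polynomial (Polynomial QSqrtNegSeven) :=
  (Polynomial.C Polynomial.X - Polynomial.X) * (Polynomial.C Polynomial.X - Polynomial.X ^ 3)

theorem eval₂_quarticBi (m : ℕ) (r x : ℂ) :
    Polynomial.eval₂ (Polynomial.aeval (R := QSqrtNegSeven) x).toRingHom r (quarticBi m) =
      quartic (r ^ m) x := by
  simp [quarticBi, quartic, Polynomial.eval₂_mul, Polynomial.eval₂_sub, Polynomial.eval₂_pow,
    Polynomial.eval₂_C]

theorem eval₂_cofactorBi (r x : ℂ) :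
    Polynomial.eval₂ (Polynomial.aeval (R := QSqrtNegSeven) x).toRingHom r cofactorBi =
      cofactor r x := by
  simp [cofactorBi, cofactor, Polynomial.eval₂_mul, Polynomial.eval₂_sub, Polynomial.eval₂_pow,
    Polynomial.eval₂_C]

/-- The substitution `x ↦ x / 3`. -/
def third (q : Polynomial QSqrtNegSeven) : Polynomial QSqrtNegSeven :=
  q.comp (Polynomial.C (1 / 3) * Polynomial.X)

theorem aeval_third (q : Polynomial QSqrtNegSeven) (x : ℂ) :
    Polynomial.aeval (3 * x) (third q) = Polynomial.aeval x q := by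
  rw [third, Polynomial.aeval_comp]
  have h : algebraMap QSqrtNegSeven ℂ (1 / 3) = 1 / 3 := by
    rw [map_div₀, map_one, map_ofNat]
  rw [map_mul, Polynomial.aeval_C, Polynomial.aeval_X, h]
  congr 2
  ring

/-- `9 y₁ ^ 2` as a polynomial in `3 x`. -/
def polyY : Polynomial QSqrtNegSeven :=
  third (9 * (Polynomial.X ^ 4 + Polynomial.C ⟨omega, omega_mem⟩ * Polynomial.X ^ 3 -
    Polynomial.X ^ 2 - (1 + Polynomial.C ⟨omega, omega_mem⟩) * Polynomial.X + 1))

/-- `y₂ ^ 2 + y₄ ^ 2 + y₆ ^ 2` as a polynomial in `3 x`. -/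
def polyT : Polynomial QSqrtNegSeven := third (tracePoly (quarticBi 1))

/-- The second elementary symmetric function of the squares, as a polynomial in `3 x`. -/
def polyQ : Polynomial QSqrtNegSeven := third (tracePoly (quarticBi 1 * quarticBi 2))

/-- The product `y₂ y₄ y₆` as a polynomial in `3 x`. -/
def polyE : Polynomial QSqrtNegSeven :=
  third (Polynomial.C (1 / 3) * tracePoly (quarticBi 1 * cofactorBi))

/-- The equations of `Z2`, with values in an arbitrary algebra. -/
structure Z2Relations {B : Type} [CommRing B] [Algebra ℂ B] (v : Fin 5 → B)
    (A K₀ K₁ K₂ T D₀ D₁ D₃ : Polynomial ℂ) : Prop where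
  eq₁ : v 1 ^ 2 = Polynomial.aeval (v 0) A
  eq₂ : v 2 ^ 4 = Polynomial.aeval (v 0) K₀ + Polynomial.aeval (v 0) K₁ * v 2 +
    Polynomial.aeval (v 0) K₂ * v 2 ^ 2
  eq₃ : v 3 = Polynomial.aeval (v 0) T
  eq₄ : v 4 = Polynomial.aeval (v 0) D₀ + Polynomial.aeval (v 0) D₁ * v 2 +
    Polynomial.aeval (v 0) D₃ * v 2 ^ 3

/-- `f` can be reduced modulo the equations of `Z2` to degree less than two in the second and less
than four in the third variable. -/
def IsReducible (A K₀ K₁ K₂ T D₀ D₁ D₃ : Polynomial ℂ) (f : MvPolynomial (Fin 5) ℂ) : Prop :=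
  ∃ c : Fin 2 → Fin 4 → Polynomial ℂ, ∀ (B : Type) [CommRing B] [Algebra ℂ B] (v : Fin 5 → B),
    Z2Relations v A K₀ K₁ K₂ T D₀ D₁ D₃ → aeval v f =
      ∑ i, ∑ j, Polynomial.aeval (v 0) (c i j) * v 1 ^ (i : ℕ) * v 2 ^ (j : ℕ)

variable {A K₀ K₁ K₂ T D₀ D₁ D₃ : Polynomial ℂ} {f g : MvPolynomial (Fin 5) ℂ}

theorem IsReducible.add (hf : IsReducible A K₀ K₁ K₂ T D₀ D₁ D₃ f)
    (hg : IsReducible A K₀ K₁ K₂ T D₀ D₁ D₃ g) : IsReducible A K₀ K₁ K₂ T D₀ D₁ D₃ (f + g) := by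
  obtain ⟨c, hc⟩ := hf
  obtain ⟨d, hd⟩ := hg
  refine ⟨fun i j => c i j + d i j, fun B _ _ v hv => ?_⟩
  rw [map_add, hc B v hv, hd B v hv]
  simp only [map_add, add_mul, Finset.sum_add_distrib]

theorem IsReducible.mul_poly (hf : IsReducible A K₀ K₁ K₂ T D₀ D₁ D₃ f) (q : Polynomial ℂ) :
    IsReducible A K₀ K₁ K₂ T D₀ D₁ D₃ (Polynomial.aeval (MvPolynomial.X 0) q * f) := by
  obtain ⟨c, hc⟩ := hf
  refine ⟨fun i j => q * c i j, fun B _ _ v hv => ?_⟩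
  rw [map_mul, hc B v hv, ← Polynomial.aeval_algHom_apply, aeval_X]
  simp only [map_mul, Finset.mul_sum, mul_assoc]

theorem IsReducible.mul_X1 (hf : IsReducible A K₀ K₁ K₂ T D₀ D₁ D₃ f) :
    IsReducible A K₀ K₁ K₂ T D₀ D₁ D₃ (MvPolynomial.X 1 * f) := by
  obtain ⟨c, hc⟩ := hf
  refine ⟨fun i j => if i = 0 then A * c 1 j else c 0 j, fun B _ _ v hv => ?_⟩
  rw [map_mul, hc B v hv, aeval_X]
  simp [Fin.sum_univ_two, Fin.sum_univ_four, ← hv.eq₁]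
  ring

theorem IsReducible.mul_X2 (hf : IsReducible A K₀ K₁ K₂ T D₀ D₁ D₃ f) :
    IsReducible A K₀ K₁ K₂ T D₀ D₁ D₃ (MvPolynomial.X 2 * f) := by
  obtain ⟨c, hc⟩ := hf
  refine ⟨fun i => ![c i 3 * K₀, c i 0 + c i 3 * K₁, c i 1 + c i 3 * K₂, c i 2],
    fun B _ _ v hv => ?_⟩
  rw [map_mul, hc B v hv, aeval_X]
  simp [Fin.sum_univ_two, Fin.sum_univ_four]
  linear_combination (Polynomial.aeval (v 0) (c 0 3) + Polynomial.aeval (v 0) (c 1 3) * v 1) *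
    hv.eq₂

theorem IsReducible.congr (hf : IsReducible A K₀ K₁ K₂ T D₀ D₁ D₃ f)
    (h : ∀ (B : Type) [CommRing B] [Algebra ℂ B] (v : Fin 5 → B),
      Z2Relations v A K₀ K₁ K₂ T D₀ D₁ D₃ → aeval v g = aeval v f) :
    IsReducible A K₀ K₁ K₂ T D₀ D₁ D₃ g := by
  obtain ⟨c, hc⟩ := hf
  exact ⟨c, fun B _ _ v hv => by rw [h B v hv, hc B v hv]⟩

/-- The equations eliminate the last two variables and bound the degrees in the second and third. -/
theorem isReducible (A K₀ K₁ K₂ T D₀ D₁ D₃ : Polynomial ℂ) (f : MvPolynomial (Fin 5) ℂ) :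
    IsReducible A K₀ K₁ K₂ T D₀ D₁ D₃ f := by
  have hev : ∀ (B : Type) [CommRing B] [Algebra ℂ B] (v : Fin 5 → B) (q : Polynomial ℂ),
      aeval v (Polynomial.aeval (MvPolynomial.X 0 : MvPolynomial (Fin 5) ℂ) q) =
        Polynomial.aeval (v 0) q := by
    intro B _ _ v q
    rw [← Polynomial.aeval_algHom_apply (aeval (R := ℂ) v), aeval_X]
  induction f using MvPolynomial.induction_on with
  | C a =>
    refine ⟨fun i j => if i = 0 ∧ j = 0 then Polynomial.C a else 0, fun B _ _ v _ => ?_⟩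
    simp [Fin.sum_univ_two, Fin.sum_univ_four]
  | add f g hf hg => exact hf.add hg
  | mul_X f m hf =>
    rw [mul_comm]
    fin_cases m
    · simpa using hf.mul_poly Polynomial.X
    · exact hf.mul_X1
    · exact hf.mul_X2
    · refine (hf.mul_poly T).congr fun B _ _ v hv => ?_
      rw [map_mul, map_mul, hev, ← hv.eq₃]
      simp
    · refine (((hf.mul_poly D₀).add (hf.mul_X2.mul_poly D₁)).add
        (hf.mul_X2.mul_X2.mul_X2.mul_poly D₃)).congr fun B _ _ v hv => ?_
      have h4 := hv.eq₄
      simp only [map_add, map_mul, hev, aeval_X, Fin.reduceFinMk, h4]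
      ring

end Equations

/-! ### The ideal of `Z2` -/

section IdealOfZ2

/-- `L1star` as a rational map. -/
def L1starMap : RatMap ℂ (Fin 4) (Fin 5) where
  num :=
    let d : MvPolynomial (Fin 4) ℂ :=
      (MvPolynomial.X 0 - C (rho ^ 4)) * (MvPolynomial.X 0 - C (rho ^ 5))
    let y : MvPolynomial (Fin 4) ℂ := MvPolynomial.X 2
    let z : MvPolynomial (Fin 4) ℂ := MvPolynomial.X 3
    ![C 3 * MvPolynomial.X 0 * d ^ 3, C 3 * MvPolynomial.X 1 * d ^ 3, ((y + z) * d + y * z) * d ^ 2,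
      ((y ^ 2 + z ^ 2) * d ^ 2 + (y * z) ^ 2) * d, (y ^ 3 + z ^ 3) * d ^ 3 + (y * z) ^ 3]
  den := ((MvPolynomial.X 0 - C (rho ^ 4)) * (MvPolynomial.X 0 - C (rho ^ 5))) ^ 3

theorem L1starMap_definedAt {p : Fin 4 → ℂ} (hx : IsGood (p 0)) : L1starMap.DefinedAt p := by
  simp only [RatMap.DefinedAt, L1starMap, map_pow, map_mul, map_sub, aeval_X, aeval_C]
  exact pow_ne_zero 3 (mul_ne_zero (hx.ne_rho_pow 4) (hx.ne_rho_pow 5))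

theorem L1starMap_eval {p : Fin 4 → ℂ} (hx : IsGood (p 0)) : L1starMap.eval p = L1star p := by
  have h4 := hx.ne_rho_pow 4
  have h5 := hx.ne_rho_pow 5
  funext i
  fin_cases i
  all_goals
    simp only [RatMap.eval, L1starMap, L1star, y6, Fin.zero_eta, Fin.mk_one, Fin.reduceFinMk,
      Matrix.cons_val, map_mul, map_add, map_sub, map_pow, aeval_X, aeval_C,
      Algebra.algebraMap_self, RingHom.id_apply]
    field_simp

theorem isRatFun_L1star_complex (i : Fin 5) : IsRatFun ℂ X id (fun p => L1star p i) :=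
  (isRatFun_L1star i).baseChange

theorem aeval_L1star_eq_zero {f : MvPolynomial (Fin 5) ℂ} (hf : f ∈ vanishingIdeal ℂ Z2)
    {p : Fin 4 → ℂ} (hp : p ∈ X) (hx : IsGood (p 0)) : aeval (L1star p) f = 0 := by
  rw [Z2, vanishingIdeal_closedImage isRatFun_L1star_complex] at hf
  rw [← L1starMap_eval hx]
  refine L1starMap.aeval_eval_eq_zero ((generically_isGood.and hf).mono fun q _ hq _ => ?_) hp
    (L1starMap_definedAt hx)
  rw [L1starMap_eval hq.1]
  exact hq.2

/-- A reduced polynomial that vanishes on `Z2` is zero: the sum `y₂ + y₄ + y₆` takes four different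
values over a given value of `(x, y₁)`. -/
theorem reduced_eq_zero_of_forall_L1star {c : Fin 2 → Fin 4 → Polynomial ℂ}
    (h : ∀ p ∈ X, IsGood (p 0) → ∑ i, ∑ j, (c i j).eval (L1star p 0) *
      L1star p 1 ^ (i : ℕ) * L1star p 2 ^ (j : ℕ) = 0) : ∀ i j, c i j = 0 := by
  have key : ∀ p ∈ X, IsGood (p 0) → ∀ i j, (c i j).eval (3 * p 0) = 0 := by
    intro p hp hx
    have hrel := hx.rootRelations hp
    obtain ⟨e1, e2, e3⟩ := mem_X_iff.1 hp
    have hsign : ∀ a b d : ℂ, a ^ 2 = 1 → b ^ 2 = 1 → d ^ 2 = 1 →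
        ∑ j, (fun j => (c 0 j).eval (3 * p 0) + (c 1 j).eval (3 * p 0) * (a * (3 * p 1))) j *
          (b * p 2 + d * p 3 + b * d * y6 p) ^ (j : ℕ) = 0 := by
      intro a b d ha hb hd
      have h1 := h ![p 0, a * p 1, b * p 2, d * p 3] (mem_X_iff.2
        ⟨by simp [mul_pow, ha, e1], by simp [mul_pow, hb, e2], by simp [mul_pow, hd, e3]⟩) hx
      have hs : L1star ![p 0, a * p 1, b * p 2, d * p 3] 2 =
          b * p 2 + d * p 3 + b * d * y6 p := by
        simp [L1star, y6]
        ring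
      rw [hs] at h1
      rw [← h1]
      simp only [L1star, Fin.sum_univ_two, Fin.sum_univ_four, Matrix.cons_val, Fin.val_zero,
        Fin.val_one]
      simp
      ring
    have n24 : p 2 ^ 2 ≠ p 3 ^ 2 := by rw [hrel.sq₂, hrel.sq₄]; exact hx.ne₂₄
    have n26 : p 2 ^ 2 ≠ y6 p ^ 2 := by rw [hrel.sq₂, hrel.sq₆]; exact hx.ne₂₆
    have n46 : p 3 ^ 2 ≠ y6 p ^ 2 := by rw [hrel.sq₄, hrel.sq₆]; exact hx.ne₄₆
    have hne : ∀ {y z : ℂ}, y ^ 2 ≠ z ^ 2 → y + z ≠ 0 ∧ y - z ≠ 0 := fun {y z} hyz =>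
      ⟨fun h0 => hyz (by linear_combination (y - z) * h0),
        fun h0 => hyz (by linear_combination (y + z) * h0)⟩
    -- the values of `y₂ + y₄ + y₆` under the changes of sign of `y₂` and `y₄`
    let s : Fin 4 → ℂ := ![p 2 + p 3 + y6 p, p 2 - p 3 - y6 p, -p 2 + p 3 - y6 p,
      -p 2 - p 3 + y6 p]
    have hinj : Function.Injective s := by
      have d01 : s 0 - s 1 ≠ 0 := by
        have : s 0 - s 1 = 2 * (p 3 + y6 p) := by simp [s]; ring
        rw [this]
        exact mul_ne_zero two_ne_zero (hne n46).1
      have d02 : s 0 - s 2 ≠ 0 := by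
        have : s 0 - s 2 = 2 * (p 2 + y6 p) := by simp [s]; ring
        rw [this]
        exact mul_ne_zero two_ne_zero (hne n26).1
      have d03 : s 0 - s 3 ≠ 0 := by
        have : s 0 - s 3 = 2 * (p 2 + p 3) := by simp [s]; ring
        rw [this]
        exact mul_ne_zero two_ne_zero (hne n24).1
      have d12 : s 1 - s 2 ≠ 0 := by
        have : s 1 - s 2 = 2 * (p 2 - p 3) := by simp [s]; ring
        rw [this]
        exact mul_ne_zero two_ne_zero (hne n24).2
      have d13 : s 1 - s 3 ≠ 0 := by
        have : s 1 - s 3 = 2 * (p 2 - y6 p) := by simp [s]; ring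
        rw [this]
        exact mul_ne_zero two_ne_zero (hne n26).2
      have d23 : s 2 - s 3 ≠ 0 := by
        have : s 2 - s 3 = 2 * (p 3 - y6 p) := by simp [s]; ring
        rw [this]
        exact mul_ne_zero two_ne_zero (hne n46).2
      rw [sub_ne_zero] at d01 d02 d03 d12 d13 d23
      intro i j hij
      fin_cases i <;> fin_cases j <;> first | rfl | exact absurd hij ‹_› | exact absurd hij.symm ‹_›
    have hvan : ∀ a : ℂ, a ^ 2 = 1 → (fun j => (c 0 j).eval (3 * p 0) +
        (c 1 j).eval (3 * p 0) * (a * (3 * p 1))) = 0 := by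
      intro a ha
      refine Matrix.eq_zero_of_forall_index_sum_mul_pow_eq_zero hinj fun j => ?_
      fin_cases j
      · convert hsign a 1 1 ha (by norm_num) (by norm_num) using 5
        simp [s]
      · convert hsign a 1 (-1) ha (by norm_num) (by norm_num) using 5
        simp [s]
        ring
      · convert hsign a (-1) 1 ha (by norm_num) (by norm_num) using 5
        simp [s]
        ring
      · convert hsign a (-1) (-1) ha (by norm_num) (by norm_num) using 5
        simp [s]
        ring
    have hy1 : 3 * p 1 ≠ 0 := by
      refine mul_ne_zero (by norm_num) fun h0 => ?_
      have := hp.1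
      rw [h0] at this
      have h1 := hx.ne_rho_pow 0
      rw [pow_zero] at h1
      refine mul_ne_zero (mul_ne_zero (mul_ne_zero h1 (hx.ne_rho_pow 3)) (hx.ne_rho_pow 5))
        (hx.ne_rho_pow 6) ?_
      rw [← this]
      norm_num
    intro i j
    have h1 := congrFun (hvan 1 (by norm_num)) j
    have h2 := congrFun (hvan (-1) (by norm_num)) j
    simp only [Pi.zero_apply] at h1 h2
    have := eq_zero_of_add_sub hy1 (a := (c 0 j).eval (3 * p 0)) (b := (c 1 j).eval (3 * p 0))
      (by linear_combination h1) (by linear_combination h2)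
    fin_cases i
    · exact this.1
    · exact this.2
  intro i j
  by_contra h0
  have h1 : (c i j).comp (Polynomial.C 3 * Polynomial.X) ≠ 0 := by
    intro h1
    refine h0 (Polynomial.funext fun x => ?_)
    have := congrArg (Polynomial.eval (x / 3)) h1
    rw [Polynomial.eval_comp] at this
    simpa [mul_div_cancel₀] using this
  obtain ⟨p, hp, h2, h3⟩ := ((generically_eval_ne_zero h1).and generically_isGood).exists_mem
  refine h2 ?_
  rw [Polynomial.eval_comp]
  simpa using key p hp h3 i j

theorem mem_vanishingIdeal_Z2 {q : MvPolynomial (Fin 5) QSqrtNegSeven}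
    (h : ∀ p ∈ X, IsGood (p 0) → aeval (L1star p) q = 0) :
    q ∈ vanishingIdeal QSqrtNegSeven Z2 := by
  have h1 : map (algebraMap QSqrtNegSeven ℂ) q ∈ vanishingIdeal ℂ Z2 := by
    rw [Z2, vanishingIdeal_closedImage isRatFun_L1star_complex]
    refine generically_isGood.mono fun p hp hx => ?_
    rw [aeval_map_algebraMap]
    exact h p hp hx
  intro t ht
  rw [← aeval_map_algebraMap ℂ]
  exact h1 t ht

/-- The equations satisfied by the coordinates of `L1star`. -/
theorem L1star_relations {p : Fin 4 → ℂ} (hp : p ∈ X) (hx : IsGood (p 0)) :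
    L1star p 1 ^ 2 = Polynomial.aeval (L1star p 0) polyY ∧
    L1star p 2 ^ 4 = Polynomial.aeval (L1star p 0) (4 * polyQ - polyT ^ 2) +
      Polynomial.aeval (L1star p 0) (8 * polyE) * L1star p 2 +
      Polynomial.aeval (L1star p 0) (2 * polyT) * L1star p 2 ^ 2 ∧
    L1star p 3 = Polynomial.aeval (L1star p 0) polyT ∧
    L1star p 4 = Polynomial.aeval (L1star p 0) (3 * polyE) +
      Polynomial.aeval (L1star p 0) (Polynomial.C (3 / 2) * polyT) * L1star p 2 +
      Polynomial.aeval (L1star p 0) (Polynomial.C (-(1 / 2) : QSqrtNegSeven)) * L1star p 2 ^ 3 := by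
  obtain ⟨b2, b4, b6, m46, m62, m24⟩ := hx.rootRelations hp
  have h0 : L1star p 0 = 3 * p 0 := rfl
  have h1 : L1star p 1 = 3 * p 1 := rfl
  have h2 : L1star p 2 = p 2 + p 3 + y6 p := rfl
  have h3 : L1star p 3 = p 2 ^ 2 + p 3 ^ 2 + y6 p ^ 2 := rfl
  have h4 : L1star p 4 = p 2 ^ 3 + p 3 ^ 3 + y6 p ^ 3 := rfl
  -- with `s = y₂ + y₄ + y₆`, `T` the sum of the squares, `Q` the second elementary symmetric function
  -- of the squares and `E` the product, the second equation is `(s ^ 2 - T) ^ 2 = 4 Q + 8 E s`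
  have c8 : (rho ^ 4) ^ 2 = rho := by linear_combination rho * rho_pow_seven
  have hT : Polynomial.aeval (L1star p 0) polyT = p 2 ^ 2 + p 3 ^ 2 + y6 p ^ 2 := by
    rw [h0, polyT, aeval_third, aeval_tracePoly]
    simp only [eval₂_quarticBi, pow_one, trace, b2, b4, b6]
  have hQ : Polynomial.aeval (L1star p 0) polyQ =
      p 2 ^ 2 * p 3 ^ 2 + p 3 ^ 2 * y6 p ^ 2 + y6 p ^ 2 * p 2 ^ 2 := by
    rw [h0, polyQ, aeval_third, aeval_tracePoly]
    simp only [Polynomial.eval₂_mul, eval₂_quarticBi, pow_one, trace, c8, b2, b4, b6]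
    rw [← pow_mul]
  have hE : Polynomial.aeval (L1star p 0) polyE = p 2 * p 3 * y6 p := by
    rw [h0, polyE, aeval_third, map_mul, aeval_tracePoly]
    simp only [Polynomial.eval₂_mul, eval₂_quarticBi, eval₂_cofactorBi, pow_one, trace, ← b2,
      ← b4, ← b6]
    simp only [Polynomial.aeval_C, map_div₀, map_one, map_ofNat]
    linear_combination -(p 2 * m46 + p 3 * m62 + y6 p * m24) / 3
  refine ⟨?_, ?_, ?_, ?_⟩
  · rw [h0, h1, polyY, aeval_third, mul_pow, hp.1, A1_eq]
    have : algebraMap QSqrtNegSeven ℂ ⟨omega, omega_mem⟩ = omega := rfl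
    simp only [map_add, map_sub, map_mul, map_pow, Polynomial.aeval_X, Polynomial.aeval_C, this,
      map_one, map_ofNat]
    norm_num
  · simp only [map_sub, map_mul, map_pow, map_ofNat, hT, hQ, hE, h2]
    ring
  · rw [hT, h3]
  · simp only [map_mul, map_ofNat, hT, hE, h2, h4, Polynomial.aeval_C, map_div₀, map_neg, map_one]
    ring

/-- The ideal of `Z2` is generated over `ℚ(√-7)`: a polynomial that vanishes on `Z2` is reduced, modulo
the equations of `L1star_relations`, to a polynomial that is zero by
`reduced_eq_zero_of_forall_L1star`. -/
theorem isSpannedOver_Z2 : IsSpannedOver QSqrtNegSeven Z2 := by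
  intro f hf
  let 𝔞 := (vanishingIdeal QSqrtNegSeven Z2).map (map (algebraMap QSqrtNegSeven ℂ))
  let m : Polynomial QSqrtNegSeven → Polynomial ℂ := Polynomial.map (algebraMap QSqrtNegSeven ℂ)
  have hm : ∀ (q : Polynomial QSqrtNegSeven) (x : ℂ), Polynomial.aeval x (m q) = Polynomial.aeval x q :=
    fun q x => Polynomial.aeval_map_algebraMap ℂ x q
  obtain ⟨c, hc⟩ := isReducible (m polyY) (m (4 * polyQ - polyT ^ 2)) (m (8 * polyE))
    (m (2 * polyT)) (m polyT) (m (3 * polyE)) (m (Polynomial.C (3 / 2) * polyT))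
    (m (Polynomial.C (-(1 / 2) : QSqrtNegSeven))) f
  have hc0 := reduced_eq_zero_of_forall_L1star (c := c) fun p hp hx => by
    obtain ⟨r1, r2, r3, r4⟩ := L1star_relations hp hx
    have := hc ℂ (L1star p) ⟨by rwa [hm], by rwa [hm, hm, hm], by rwa [hm], by rwa [hm, hm, hm]⟩
    rw [aeval_L1star_eq_zero hf hp hx] at this
    simpa using this.symm
  -- it remains to see that the generators satisfy the equations modulo `𝔞`
  let v : Fin 5 → MvPolynomial (Fin 5) ℂ ⧸ 𝔞 := fun i => Ideal.Quotient.mk 𝔞 (MvPolynomial.X i)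
  have hmk : ∀ q : MvPolynomial (Fin 5) QSqrtNegSeven,
      aeval v q = Ideal.Quotient.mk 𝔞 (map (algebraMap QSqrtNegSeven ℂ) q) := by
    intro q
    induction q using MvPolynomial.induction_on with
    | C a =>
      rw [aeval_C, map_C, IsScalarTower.algebraMap_apply QSqrtNegSeven ℂ]
      rfl
    | add p q hp hq => rw [map_add, map_add, map_add, hp, hq]
    | mul_X p i hp => rw [map_mul, map_mul, map_mul, hp, aeval_X, map_X]
  have hq : ∀ q : MvPolynomial (Fin 5) QSqrtNegSeven, q ∈ vanishingIdeal QSqrtNegSeven Z2 → aeval v q = 0 := by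
    intro q hq
    have h1 : Ideal.Quotient.mk 𝔞 (map (algebraMap QSqrtNegSeven ℂ) q) = 0 :=
      Ideal.Quotient.eq_zero_iff_mem.2 (Ideal.mem_map_of_mem _ hq)
    rw [hmk, h1]
  have ha : ∀ q : Polynomial QSqrtNegSeven, Polynomial.aeval (v 0) (m q) = Polynomial.aeval (v 0) q :=
    fun q => Polynomial.aeval_map_algebraMap ℂ _ q
  have hX : ∀ q : Polynomial QSqrtNegSeven, aeval v (Polynomial.aeval (MvPolynomial.X 0) q) =
      Polynomial.aeval (v 0) q := fun q => by
    rw [← Polynomial.aeval_algHom_apply (aeval (R := QSqrtNegSeven) v), aeval_X]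
  have hL : ∀ (p : Fin 4 → ℂ) (q : Polynomial QSqrtNegSeven),
      aeval (L1star p) (Polynomial.aeval (MvPolynomial.X 0) q) =
      Polynomial.aeval (L1star p 0) q := fun p q => by
    rw [← Polynomial.aeval_algHom_apply (aeval (R := QSqrtNegSeven) (L1star p)), aeval_X]
  let Y : Polynomial QSqrtNegSeven → MvPolynomial (Fin 5) QSqrtNegSeven := fun q => Polynomial.aeval (MvPolynomial.X 0) q
  have hrel : Z2Relations v (m polyY) (m (4 * polyQ - polyT ^ 2)) (m (8 * polyE))
      (m (2 * polyT)) (m polyT) (m (3 * polyE)) (m (Polynomial.C (3 / 2) * polyT))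
      (m (Polynomial.C (-(1 / 2) : QSqrtNegSeven))) := by
    refine ⟨?_, ?_, ?_, ?_⟩
    · have := hq (MvPolynomial.X 1 ^ 2 - Y polyY) (mem_vanishingIdeal_Z2 fun p hp hx => by
        simp only [Y, map_sub, map_pow, aeval_X, hL]
        exact sub_eq_zero.2 (L1star_relations hp hx).1)
      simp only [Y, map_sub, map_pow, aeval_X, hX] at this
      rw [ha]
      exact sub_eq_zero.1 this
    · have := hq (MvPolynomial.X 2 ^ 4 - (Y (4 * polyQ - polyT ^ 2) +
        Y (8 * polyE) * MvPolynomial.X 2 + Y (2 * polyT) * MvPolynomial.X 2 ^ 2))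
        (mem_vanishingIdeal_Z2 fun p hp hx => by
          rw [map_sub, map_add, map_add, map_mul, map_mul, map_pow, map_pow, aeval_X, hL, hL, hL]
          exact sub_eq_zero.2 (L1star_relations hp hx).2.1)
      rw [map_sub, map_add, map_add, map_mul, map_mul, map_pow, map_pow, aeval_X, hX, hX, hX]
        at this
      rw [ha, ha, ha]
      exact sub_eq_zero.1 this
    · have := hq (MvPolynomial.X 3 - Y polyT) (mem_vanishingIdeal_Z2 fun p hp hx => by
        simp only [Y, map_sub, aeval_X, hL]
        exact sub_eq_zero.2 (L1star_relations hp hx).2.2.1)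
      simp only [Y, map_sub, aeval_X, hX] at this
      rw [ha]
      exact sub_eq_zero.1 this
    · have := hq (MvPolynomial.X 4 - (Y (3 * polyE) + Y (Polynomial.C (3 / 2) * polyT) *
        MvPolynomial.X 2 + Y (Polynomial.C (-(1 / 2) : QSqrtNegSeven)) * MvPolynomial.X 2 ^ 3))
        (mem_vanishingIdeal_Z2 fun p hp hx => by
          rw [map_sub, map_add, map_add, map_mul, map_mul, map_pow, aeval_X, aeval_X, hL, hL, hL]
          exact sub_eq_zero.2 (L1star_relations hp hx).2.2.2)
      rw [map_sub, map_add, map_add, map_mul, map_mul, map_pow, aeval_X, aeval_X, hX, hX, hX]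
        at this
      rw [ha, ha, ha]
      exact sub_eq_zero.1 this
  have h1 := hc _ v hrel
  have h2 : aeval v f = Ideal.Quotient.mk 𝔞 f := by
    have : (aeval v : MvPolynomial (Fin 5) ℂ →ₐ[ℂ] _) = Ideal.Quotient.mkₐ ℂ 𝔞 := by
      ext i
      simp [v]
    rw [this]
    rfl
  rw [h2] at h1
  refine Ideal.Quotient.eq_zero_iff_mem.1 (h1.trans ?_)
  simp [hc0]

end IdealOfZ2

/-! ### The curves have dimension one -/

section Curves

variable {ι : Type} {U : Set (ι → ℂ)} {T g h : (ι → ℂ) → ℂ}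

/-- On `U` the function `g` is integral over the polynomials in `T`. -/
def IsIntegralOn (U : Set (ι → ℂ)) (T g : (ι → ℂ) → ℂ) : Prop :=
  (evalAt U T).IsIntegralElem (fun p => g p)

namespace IsIntegralOn

theorem const (c : ℂ) : IsIntegralOn U T (fun _ => c) := by
  have : (fun _ : U => c) = evalAt U T (Polynomial.C c) := by
    funext p
    simp [evalAt]
  rw [IsIntegralOn, this]
  exact RingHom.isIntegralElem_map _

theorem self : IsIntegralOn U T T := by
  have : (fun p : U => T p) = evalAt U T Polynomial.X := by
    funext p
    simp [evalAt]
  rw [IsIntegralOn, this]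
  exact RingHom.isIntegralElem_map _

theorem add (hg : IsIntegralOn U T g) (hh : IsIntegralOn U T h) :
    IsIntegralOn U T (fun p => g p + h p) :=
  RingHom.IsIntegralElem.add _ hg hh

theorem mul (hg : IsIntegralOn U T g) (hh : IsIntegralOn U T h) :
    IsIntegralOn U T (fun p => g p * h p) :=
  RingHom.IsIntegralElem.mul _ hg hh

theorem sub (hg : IsIntegralOn U T g) (hh : IsIntegralOn U T h) :
    IsIntegralOn U T (fun p => g p - h p) :=
  RingHom.IsIntegralElem.sub _ hg hh

theorem pow (hg : IsIntegralOn U T g) (n : ℕ) : IsIntegralOn U T (fun p => g p ^ n) := by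
  induction n with
  | zero => simpa using const 1
  | succ n ih =>
    simp only [pow_succ]
    exact ih.mul hg

theorem congr (hg : IsIntegralOn U T g) (hgh : ∀ p ∈ U, h p = g p) : IsIntegralOn U T h := by
  have : (fun p : U => h p) = fun p : U => g p := funext fun p => hgh p p.2
  rw [IsIntegralOn, this]
  exact hg

theorem of_sq (hg : IsIntegralOn U T (fun p => g p ^ 2)) : IsIntegralOn U T g := by
  let _ : Algebra (Polynomial ℂ) (U → ℂ) := (evalAt U T).toAlgebra
  exact IsIntegral.of_pow (R := Polynomial ℂ) (x := fun p : U => g p) two_pos hg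

/-- The roots of `X ^ 2 - c T X + 1` are integral. -/
theorem of_quadratic (c : ℂ) (hg : ∀ p ∈ U, g p ^ 2 - c * T p * g p + 1 = 0) :
    IsIntegralOn U T g := by
  refine ⟨Polynomial.X ^ 2 - Polynomial.C (Polynomial.C c * Polynomial.X) * Polynomial.X + 1,
    by monicity!, ?_⟩
  funext p
  have := hg p p.2
  simpa [evalAt] using this

theorem quartic {r : ℂ} (hg : IsIntegralOn U T g) :
    IsIntegralOn U T (fun p => FrickeMacbeath.quartic r (g p)) :=
  (((hg.sub (const _)).mul (hg.sub (const _))).mul (hg.sub (const _))).mul (hg.sub (const _))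

end IsIntegralOn

/-- A nonconstant function is transcendental: it avoids the finitely many roots of `f`. -/
theorem generically_eval_ne_zero_of_forall_ne {V : Set (ι → ℂ)} [(vanishingIdeal ℂ V).IsPrime]
    (hT : ∀ r, Generically V (fun p => T p ≠ r)) {f : Polynomial ℂ} (hf : f ≠ 0) :
    Generically V (fun p => f.eval (T p) ≠ 0) := by
  have := generically_all (α := f.roots.toFinset) fun r => hT r
  refine this.mono fun p _ hp h0 => ?_
  exact hp ⟨T p, by simpa [hf] using h0⟩ rfl

theorem isAffineCurve_closedImage {κ : Type} [Finite κ] {V : Set (ι → ℂ)}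
    [(vanishingIdeal ℂ V).IsPrime] {w : (ι → ℂ) → (κ → ℂ)}
    (hw : ∀ i, IsRatFun ℂ V id (fun p => w p i)) (j : κ)
    (hT : ∀ r, Generically V (fun p => w p j ≠ r)) {P : (ι → ℂ) → Prop} (hP : Generically V P)
    (hint : ∀ U : Set (ι → ℂ), (∀ p ∈ U, p ∈ V ∧ P p) → ∀ i,
      IsIntegralOn U (fun p => w p j) (fun p => w p i)) :
    IsAffineCurve (closedImage V w) where
  closed := zariskiClosure_closedImage hw
  irreducible := closedImage_isPrime hw
  dim_eq_one := ringKrullDim_closedImage hw j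
    (fun _ hf => generically_eval_ne_zero_of_forall_ne (T := fun p => w p j) hT hf) hP hint

end Curves

section IntegralCoordinates

variable {U : Set (Fin 4 → ℂ)} {T : (Fin 4 → ℂ) → ℂ}

theorem isIntegralOn_y1 (hU : ∀ p ∈ U, p ∈ X) (hx : IsIntegralOn U T (fun p => p 0)) :
    IsIntegralOn U T (fun p => p 1) :=
  IsIntegralOn.of_sq <| ((((hx.sub (.const 1)).mul (hx.sub (.const (rho ^ 3)))).mul
    (hx.sub (.const (rho ^ 5)))).mul (hx.sub (.const (rho ^ 6)))).congr fun p hp => (hU p hp).1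

theorem isIntegralOn_y2 (hU : ∀ p ∈ U, p ∈ X) (hx : IsIntegralOn U T (fun p => p 0)) :
    IsIntegralOn U T (fun p => p 2) :=
  IsIntegralOn.of_sq <| ((((hx.sub (.const (rho ^ 2))).mul (hx.sub (.const (rho ^ 4)))).mul
    (hx.sub (.const (rho ^ 5)))).mul (hx.sub (.const (rho ^ 6)))).congr fun p hp => (hU p hp).2.1

theorem isIntegralOn_y4 (hU : ∀ p ∈ U, p ∈ X) (hx : IsIntegralOn U T (fun p => p 0)) :
    IsIntegralOn U T (fun p => p 3) :=
  IsIntegralOn.of_sq <| ((((hx.sub (.const rho)).mul (hx.sub (.const (rho ^ 3)))).mul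
    (hx.sub (.const (rho ^ 4)))).mul (hx.sub (.const (rho ^ 5)))).congr fun p hp => (hU p hp).2.2

theorem isIntegralOn_y6 (hU : ∀ p ∈ U, p ∈ X ∧ IsGood (p 0))
    (hx : IsIntegralOn U T (fun p => p 0)) : IsIntegralOn U T y6 :=
  IsIntegralOn.of_sq <| (hx.quartic (r := rho ^ 4)).congr fun p hp =>
    ((hU p hp).2.rootRelations (hU p hp).1).sq₆

theorem isIntegralOn_L1star (hU : ∀ p ∈ U, p ∈ X ∧ IsGood (p 0))
    (hx : IsIntegralOn U T (fun p => p 0)) (i : Fin 5) :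
    IsIntegralOn U T (fun p => L1star p i) := by
  have h1 := isIntegralOn_y1 (fun p hp => (hU p hp).1) hx
  have h2 := isIntegralOn_y2 (fun p hp => (hU p hp).1) hx
  have h4 := isIntegralOn_y4 (fun p hp => (hU p hp).1) hx
  have h6 := isIntegralOn_y6 hU hx
  fin_cases i
  · exact (IsIntegralOn.const 3).mul hx
  · exact (IsIntegralOn.const 3).mul h1
  · exact (h2.add h4).add h6
  · exact ((h2.pow 2).add (h4.pow 2)).add (h6.pow 2)
  · exact ((h2.pow 3).add (h4.pow 3)).add (h6.pow 3)

theorem isIntegralOn_conjL1star (hU : ∀ p ∈ U, p ∈ X ∧ IsGood (p 0))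
    (hx : IsIntegralOn U T (fun p => p 0)) (hx' : IsIntegralOn U T (fun p => (p 0)⁻¹))
    (i : Fin 5) : IsIntegralOn U T (fun p => conjL1star p i) := by
  have h1 := isIntegralOn_y1 (fun p hp => (hU p hp).1) hx
  have h2 := (IsIntegralOn.const (rho ^ 2)).mul (isIntegralOn_y2 (fun p hp => (hU p hp).1) hx)
  have h4 := (IsIntegralOn.const (rho ^ 4)).mul (isIntegralOn_y4 (fun p hp => (hU p hp).1) hx)
  have h6 := (IsIntegralOn.const rho).mul (isIntegralOn_y6 hU hx)
  have key : ∀ p ∈ U, conjL1star p i = _ := fun p hp => congrFun (conjL1star_eq (hU p hp).2) i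
  refine IsIntegralOn.congr ?_ key
  fin_cases i
  · simpa [div_eq_mul_inv] using (IsIntegralOn.const 3).mul hx'
  · simpa [div_eq_mul_inv] using ((IsIntegralOn.const 3).mul h1).mul (hx'.pow 2)
  · simpa [div_eq_mul_inv] using ((h2.add h4).add h6).mul (hx'.pow 2)
  · simpa [div_eq_mul_inv] using (((h2.pow 2).add (h4.pow 2)).add (h6.pow 2)).mul (hx'.pow 4)
  · simpa [div_eq_mul_inv] using (((h2.pow 3).add (h4.pow 3)).add (h6.pow 3)).mul (hx'.pow 6)

theorem generically_x_ne (r : ℂ) : Generically X (fun p => p 0 ≠ r) :=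
  (generically_eval_ne_zero (Polynomial.X_sub_C_ne_zero r)).mono fun p _ hp h0 =>
    hp (by simp [h0])

theorem isAffineCurve_X : IsAffineCurve X := by
  have h : IsAffineCurve (closedImage X fun p => p) :=
    isAffineCurve_closedImage (fun i => IsRatFun.coord i) 0 generically_x_ne
      (P := fun _ => True) (generically_of_forall fun _ _ => trivial) fun U hU i => by
        fin_cases i
        · exact IsIntegralOn.self
        · exact isIntegralOn_y1 (fun p hp => (hU p hp).1) IsIntegralOn.self
        · exact isIntegralOn_y2 (fun p hp => (hU p hp).1) IsIntegralOn.self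
        · exact isIntegralOn_y4 (fun p hp => (hU p hp).1) IsIntegralOn.self
  rwa [closedImage_id zariskiClosure_X] at h

theorem isAffineCurve_Z2 : IsAffineCurve Z2 := by
  refine isAffineCurve_closedImage isRatFun_L1star_complex 0 (fun r => ?_) generically_isGood
    fun U hU => isIntegralOn_L1star hU ?_
  · refine (generically_x_ne (r / 3)).mono fun p _ hp h0 => hp ?_
    have h0' : 3 * p 0 = r := h0
    rw [← h0']
    ring
  · refine ((IsIntegralOn.const (1 / 3)).mul IsIntegralOn.self).congr fun p _ => ?_
    have : L1star p 0 = 3 * p 0 := rfl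
    rw [this]
    ring

theorem isRatFun_paramW_complex (i : Fin 5 ⊕ Fin 5) : IsRatFun ℂ X id (fun p => paramW p i) :=
  (isRatFun_paramW i).baseChange.trans isRatFun_L1star_complex

/-- Both `x` and `1 / x` are integral over `ℂ[x + 1 / x]`, hence so are all the coordinates of `W`. -/
theorem isAffineCurve_closedImage_paramW : IsAffineCurve (closedImage X paramW) := by
  have hT : ∀ p : Fin 4 → ℂ, IsGood (p 0) → paramW p (Sum.inl 0) = 3 * p 0 + 3 / p 0 := by
    intro p hp
    rw [paramW_inl, conjL1star_eq hp]
    rfl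
  refine isAffineCurve_closedImage isRatFun_paramW_complex (Sum.inl 0) (fun r => ?_)
    generically_isGood fun U hU => ?_
  · have h0 : (Polynomial.C 3 * Polynomial.X ^ 2 - Polynomial.C r * Polynomial.X +
        Polynomial.C 3 : Polynomial ℂ) ≠ 0 := fun h => by
      have := congrArg (Polynomial.eval 0) h
      simp at this
    refine ((generically_eval_ne_zero h0).and generically_isGood).mono fun p _ hp hr => hp.1 ?_
    have h1 := hp.2.ne_zero
    rw [hT p hp.2] at hr
    field_simp at hr
    simp
    linear_combination hr
  · have hx : IsIntegralOn U (fun p => paramW p (Sum.inl 0)) (fun p => p 0) :=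
      IsIntegralOn.of_quadratic (1 / 3) fun p hp => by
        have h1 := (hU p hp).2.ne_zero
        rw [hT p (hU p hp).2]
        field_simp
        ring
    have hx' : IsIntegralOn U (fun p => paramW p (Sum.inl 0)) (fun p => (p 0)⁻¹) :=
      IsIntegralOn.of_quadratic (1 / 3) fun p hp => by
        have h1 := (hU p hp).2.ne_zero
        rw [hT p (hU p hp).2]
        field_simp
        ring
    rintro (i | i)
    · exact (isIntegralOn_L1star hU hx i).add (isIntegralOn_conjL1star hU hx hx' i)
    · exact ((isIntegralOn_L1star hU hx i).pow 2).add
        ((isIntegralOn_conjL1star hU hx hx' i).pow 2)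

end IntegralCoordinates

/-! ### The Galois group of the quadratic field -/

section Galois

theorem exists_rat_of_mem {z : ℂ} (hz : z ∈ QSqrtNegSeven) : ∃ a b : ℚ, z = a + b * delta := by
  have hd : delta ^ 2 ∈ (algebraMap ℚ ℂ).fieldRange := ⟨-7, by simp [delta_sq]⟩
  let K : IntermediateField ℚ ℂ := (quadExt _ delta hd).toIntermediateField fun q =>
    le_quadExt hd ⟨q, rfl⟩
  have hK : QSqrtNegSeven ≤ K := IntermediateField.adjoin_simple_le_iff.2 (self_mem_quadExt hd)
  obtain ⟨_, ⟨a, rfl⟩, _, ⟨b, rfl⟩, h⟩ := hK hz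
  exact ⟨a, b, by simpa using h⟩

theorem conj_mem {z : ℂ} (hz : z ∈ QSqrtNegSeven) : starRingEnd ℂ z ∈ QSqrtNegSeven := by
  obtain ⟨a, b, rfl⟩ := exists_rat_of_mem hz
  rw [map_add, map_mul, map_ratCast, map_ratCast, conj_delta]
  exact add_mem (SubfieldClass.ratCast_mem _ _)
    (mul_mem (SubfieldClass.ratCast_mem _ _) (neg_mem delta_mem))

/-- Complex conjugation on the quadratic field. -/
def conjF : QSqrtNegSeven ≃ₐ[ℚ] QSqrtNegSeven :=
  let f : QSqrtNegSeven →ₐ[ℚ] QSqrtNegSeven :=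
    { toFun := fun z => ⟨starRingEnd ℂ z, conj_mem z.2⟩
      map_one' := Subtype.ext (map_one _)
      map_mul' := fun _ _ => Subtype.ext (map_mul _ _ _)
      map_zero' := Subtype.ext (map_zero _)
      map_add' := fun _ _ => Subtype.ext (map_add _ _ _)
      commutes' := fun q => Subtype.ext (map_ratCast _ q) }
  AlgEquiv.ofAlgHom f f (AlgHom.ext fun _ => Subtype.ext (Complex.conj_conj _))
    (AlgHom.ext fun _ => Subtype.ext (Complex.conj_conj _))

theorem coe_conjF (z : QSqrtNegSeven) : (conjF z : ℂ) = starRingEnd ℂ (z : ℂ) := rfl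

theorem conjF_ne_one : conjF ≠ 1 := by
  intro h
  have h1 := congrArg Subtype.val (DFunLike.congr_fun h ⟨delta, delta_mem⟩)
  rw [coe_conjF] at h1
  have h2 : -delta = delta := by rw [← conj_delta]; exact h1
  exact delta_ne_zero (by linear_combination -h2 / 2)

theorem conjF_mul_conjF : conjF * conjF = 1 := by
  ext z
  exact congrArg _ (Subtype.ext (Complex.conj_conj _))

/-- An automorphism is determined by the image of `√-7`, which is `±√-7`. -/
theorem eq_one_or_eq_conjF (σ : QSqrtNegSeven ≃ₐ[ℚ] QSqrtNegSeven) : σ = 1 ∨ σ = conjF := by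
  let d : QSqrtNegSeven := ⟨delta, delta_mem⟩
  have hd : d ^ 2 = -7 := (algebraMap QSqrtNegSeven ℂ).injective (by
    rw [map_pow, map_neg, map_ofNat]
    exact delta_sq)
  have hdec : ∀ z : QSqrtNegSeven, ∃ a b : ℚ, z = a + b * d := fun z => by
    obtain ⟨a, b, h⟩ := exists_rat_of_mem z.2
    exact ⟨a, b, Subtype.ext (by simpa [d] using h)⟩
  have hconj : conjF d = -d := Subtype.ext conj_delta
  have hext : ∀ τ : QSqrtNegSeven ≃ₐ[ℚ] QSqrtNegSeven, σ d = τ d → σ = τ := fun τ h => by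
    refine AlgEquiv.ext fun z => ?_
    obtain ⟨a, b, rfl⟩ := hdec z
    simp only [map_add, map_mul, map_ratCast, h]
  have h : (σ d) ^ 2 = d ^ 2 := by
    rw [← map_pow, hd, map_neg, map_ofNat]
  rcases sq_eq_sq_iff_eq_or_eq_neg.1 h with h | h
  · exact Or.inl (hext 1 h)
  · exact Or.inr (hext conjF (h.trans hconj.symm))

theorem algebraMap_conjF (z : QSqrtNegSeven) :
    algebraMap QSqrtNegSeven ℂ ((conjF : QSqrtNegSeven →+* QSqrtNegSeven) z) =
      starRingEnd ℂ (algebraMap QSqrtNegSeven ℂ z) := rfl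

variable {ι : Type} {V : Set (ι → ℂ)}

theorem conjVariety_one (hV : DefinedOver QSqrtNegSeven V) :
    conjVariety (1 : QSqrtNegSeven ≃ₐ[ℚ] QSqrtNegSeven) V = V := by
  obtain ⟨I, hI⟩ := hV
  have h1 : ((1 : QSqrtNegSeven ≃ₐ[ℚ] QSqrtNegSeven) : QSqrtNegSeven →+* QSqrtNegSeven) =
      RingHom.id _ := rfl
  have h2 : map (σ := ι) (RingHom.id QSqrtNegSeven) = RingHom.id _ :=
    RingHom.ext MvPolynomial.map_id
  rw [conjVariety, h1, h2, Ideal.map_id]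
  refine Set.Subset.antisymm ?_ (zeroLocus_vanishingIdeal_le V)
  intro x hx
  rw [hI]
  intro q hq
  refine hx q fun y hy => ?_
  rw [hI] at hy
  exact hy q hq

/-- For a set defined over `ℚ(√-7)`, conjugation of the coefficients of its equations is conjugation of
its points. -/
theorem conjVariety_conjF (hV : DefinedOver QSqrtNegSeven V) :
    conjVariety conjF V = conjPt '' V := by
  obtain ⟨I, hI⟩ := hV
  ext x
  rw [mem_conjPt_image]
  have hx : ∀ q : MvPolynomial ι QSqrtNegSeven,
      aeval x (map (conjF : QSqrtNegSeven →+* QSqrtNegSeven) q) = 0 ↔ aeval (conjPt x) q = 0 := by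
    intro q
    have := aeval_conjPt algebraMap_conjF q (conjPt x)
    rw [conjPt_conjPt] at this
    rw [this, map_eq_zero]
  constructor
  · intro h
    rw [hI]
    intro q hq
    rw [← hx]
    refine h _ (Ideal.mem_map_of_mem _ fun y hy => ?_)
    rw [hI] at hy
    exact hy q hq
  · intro h
    have h1 : (vanishingIdeal QSqrtNegSeven V).map
        (map (conjF : QSqrtNegSeven →+* QSqrtNegSeven)) ≤
        RingHom.ker (aeval (R := QSqrtNegSeven) x : MvPolynomial ι QSqrtNegSeven →ₐ[_] ℂ) := by
      rw [Ideal.map_le_iff_le_comap]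
      intro q hq
      rw [Ideal.mem_comap, RingHom.mem_ker, hx]
      exact hq _ h
    exact fun q hq => h1 hq

/-- A polynomial over `ℚ(√-7)` is `g + √-7 h` for rational polynomials `g` and `h`. -/
theorem exists_rat_polynomials (f : MvPolynomial ι QSqrtNegSeven) :
    ∃ g h : MvPolynomial ι ℚ, ∀ x : ι → ℂ, aeval x f = aeval x g + delta * aeval x h ∧
      aeval x (map (conjF : QSqrtNegSeven →+* QSqrtNegSeven) f) =
        aeval x g - delta * aeval x h := by
  induction f using MvPolynomial.induction_on with
  | C z =>
    obtain ⟨a, b, h⟩ := exists_rat_of_mem z.2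
    refine ⟨C a, C b, fun x => ?_⟩
    rw [map_C, aeval_C, aeval_C, aeval_C, aeval_C, algebraMap_conjF]
    have h1 : algebraMap QSqrtNegSeven ℂ z = a + b * delta := h
    rw [h1, map_add, map_mul, map_ratCast, map_ratCast, conj_delta, eq_ratCast, eq_ratCast]
    constructor <;> ring
  | add p q hp hq =>
    obtain ⟨g₁, h₁, e₁⟩ := hp
    obtain ⟨g₂, h₂, e₂⟩ := hq
    refine ⟨g₁ + g₂, h₁ + h₂, fun x => ?_⟩
    simp only [map_add, (e₁ x).1, (e₁ x).2, (e₂ x).1, (e₂ x).2]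
    constructor <;> ring
  | mul_X p i hp =>
    obtain ⟨g, h, e⟩ := hp
    refine ⟨g * MvPolynomial.X i, h * MvPolynomial.X i, fun x => ?_⟩
    simp only [map_mul, map_X, aeval_X, (e x).1, (e x).2]
    constructor <;> ring

/-- An algebraic set defined over the quadratic field and stable under complex conjugation is
defined over `ℚ`. -/
theorem definedOver_rat (hV : DefinedOver QSqrtNegSeven V) (hc : conjPt '' V = V) :
    DefinedOver ℚ V := by
  refine ⟨vanishingIdeal ℚ V, Set.Subset.antisymm (zeroLocus_vanishingIdeal_le V) fun x hx => ?_⟩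
  obtain ⟨I, hI⟩ := hV
  rw [hI]
  intro f hf
  obtain ⟨g, h, e⟩ := exists_rat_polynomials f
  have h1 : ∀ y ∈ V, aeval y f = 0 := fun y hy => by
    rw [hI] at hy
    exact hy f hf
  have h2 : ∀ y ∈ V, aeval y (map (conjF : QSqrtNegSeven →+* QSqrtNegSeven) f) = 0 := by
    intro y hy
    have := aeval_conjPt algebraMap_conjF f (conjPt y)
    rw [conjPt_conjPt] at this
    rw [this, h1 _ (mem_conjPt_image.1 (hc.symm ▸ hy)), map_zero]
  have hg : g ∈ vanishingIdeal ℚ V := fun y hy => by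
    have := h1 y hy
    have h3 := h2 y hy
    rw [(e y).1] at this
    rw [(e y).2] at h3
    linear_combination (this + h3) / 2
  have hh : h ∈ vanishingIdeal ℚ V := fun y hy => by
    have := h1 y hy
    have h3 := h2 y hy
    rw [(e y).1] at this
    rw [(e y).2] at h3
    exact (mul_eq_zero.1 (by linear_combination (this - h3) / 2 : delta * aeval y h = 0)).resolve_left
      delta_ne_zero
  rw [(e x).1, hx g hg, hx h hh, mul_zero, add_zero]

end Galois

/-! ### The maps on the generic point of the curve -/

section Maps

/-- On good points the set-theoretic inverse `L1starInv` is the inverse of `L1star`. -/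
theorem T_L1star {p : Fin 4 → ℂ} (hp : p ∈ X) (hx : IsGood (p 0)) :
    T (L1star p) = L1star (J p) := by
  rw [T, Function.comp_apply, Function.comp_apply, L1starInv_L1star hp hx]

theorem gEta_L1star {p : Fin 4 → ℂ} (hp : p ∈ X) (hx : IsGood (p 0)) :
    gEta (L1star p) = conjL1star p := by
  rw [gEta, Function.comp_apply, T_L1star hp hx, conjL1star]

theorem generically_good_mem_J : Generically X (fun p => J p ∈ X ∧ IsGood (J p 0)) :=
  (generically_isGood.mono fun _ hp hx => And.intro (J_mem_X hp hx.ne_zero) hx).and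
    generically_isGood.comp_J |>.mono fun _ _ h => ⟨h.1.1, h.2⟩

theorem conjPt_conjL1star_J {p : Fin 4 → ℂ} (h : J (J p) = p) :
    conjPt (conjL1star (J p)) = L1star p := by
  rw [conjL1star, h, conjPt_conjPt]

theorem isRatFun_L1star_inv_complex (i : Fin 4) : IsRatFun ℂ X L1star (fun p => p i) :=
  (isRatFun_L1star_inv i).baseChange

/-- The conjugate of the rationality of `conjL1star` in terms of `L1star`. -/
theorem isRatFun_conjL1star_inv (i : Fin 5) :
    IsRatFun QSqrtNegSeven X conjL1star (fun p => L1star p i) :=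
  ((isRatFun_conjL1star i).conj algebraMap_conjF fun _ => Generically.comp_J).congr
    (generically_J_J.mono fun _ _ hp => congrFun (conjPt_conjL1star_J hp).symm i)

theorem conjPt_image_Z2 : conjPt '' Z2 = closedImage X conjL1star :=
  conjPt_image_closedImage (fun _ => Generically.comp_J) generically_J_J L1star

/-- The generic point `(t, g_η(t))` of the graph of `gEta`. -/
def graphPt (p : Fin 4 → ℂ) : Fin 5 ⊕ Fin 5 → ℂ := Sum.elim (L1star p) (conjL1star p)

theorem Phi2_L1star {p : Fin 4 → ℂ} (hp : p ∈ X) (hx : IsGood (p 0)) :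
    Phi2 (L1star p) = graphPt p := by
  rw [Phi2, gEta_L1star hp hx, graphPt]

theorem isRatFun_graphPt (i : Fin 5 ⊕ Fin 5) :
    IsRatFun QSqrtNegSeven X L1star (fun p => graphPt p i) := by
  rcases i with i | i
  · exact IsRatFun.coord i
  · exact isRatFun_conjL1star i

theorem isRatFun_graphPt_complex (i : Fin 5 ⊕ Fin 5) : IsRatFun ℂ X id (fun p => graphPt p i) :=
  (isRatFun_graphPt i).baseChange.trans isRatFun_L1star_complex

theorem isRatFun_graphPt_inv {k : Type} [Field k] [Algebra k ℂ] (i : Fin 5) :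
    IsRatFun k X graphPt (fun p => L1star p i) :=
  IsRatFun.coord (v := graphPt) (Sum.inl i)

theorem isRatFun_graphPt_inv_complex (i : Fin 4) : IsRatFun ℂ X graphPt (fun p => p i) :=
  (isRatFun_L1star_inv_complex i).trans isRatFun_graphPt_inv

theorem Phi2Z2_eq : Phi2Z2 = closedImage X graphPt := by
  rw [Phi2Z2, Z2, closedImage_closedImage zariskiClosure_X isRatFun_L1star_complex
    isRatFun_L1star_inv_complex]
  exact closedImage_congr (generically_isGood.mono fun _ => Phi2_L1star)

theorem W_eq : W = closedImage X paramW := by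
  rw [W, Phi2Z2_eq, closedImage_closedImage zariskiClosure_X isRatFun_graphPt_complex
    isRatFun_graphPt_inv_complex]
  rfl

end Maps

/-! ### Birational maps and involutions -/

section Birational

theorem isBirationalIso_L1star : IsBirationalIso QRho X Z2 L1star := by
  have h : IsBirationalIso QRho (closedImage X fun p => p) (closedImage X L1star) L1star :=
    isBirationalIso_closedImage zariskiClosure_X (fun i => IsRatFun.coord i)
      (fun i => IsRatFun.coord i) isRatFun_L1star isRatFun_L1star_inv
      (generically_of_forall fun _ _ => rfl)
  rwa [closedImage_id zariskiClosure_X] at h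

theorem isRatFun_conjPt_J (i : Fin 4) : IsRatFun ℂ X id (fun p => conjPt (J p) i) := by
  have h0 : Generically X (fun p => p 0 ≠ 0) := generically_x_ne 0
  have hx (j : Fin 4) : IsRatFun ℂ X id (fun p => p j) := IsRatFun.coord j
  have hc (c : ℂ) : IsRatFun ℂ X id (fun _ => c) := IsRatFun.const c
  have hd : Generically X (fun p => p 0 ^ 2 ≠ 0) := h0.mono fun _ _ h => pow_ne_zero 2 h
  simp only [conjPt_J]
  fin_cases i
  · exact IsRatFun.one.div (hx 0) h0
  · exact (hx 1).div ((hx 0).pow 2) hd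
  · exact ((hc (rho ^ 2)).mul (hx 2)).div ((hx 0).pow 2) hd
  · exact ((hc (rho ^ 4)).mul (hx 3)).div ((hx 0).pow 2) hd

theorem isAnticonformalInvolution_J : IsAnticonformalInvolution X J where
  antibirational := by
    have hinv (i : Fin 4) : IsRatFun ℂ X (fun p => conjPt (J p)) (fun p => p i) := by
      have h1 : IsRatFun ℂ X (fun p => conjPt (J p))
          (fun p => starRingEnd ℂ (conjPt (J (J p)) i)) :=
        IsRatFun.conj (v := id) (g := fun p => conjPt (J p) i) (η := starRingEnd ℂ)
          (fun _ => rfl) (fun _ => Generically.comp_J) (isRatFun_conjPt_J i)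
      refine h1.congr (generically_J_J.mono fun p _ hp => ?_)
      have := congrFun (conjPt_conjPt (J (J p))) i
      rw [hp] at this
      rw [hp]
      exact this.symm
    have h : IsBirationalIso ℂ (closedImage X fun p => p)
        (closedImage X fun p => conjPt (J p)) (conjPt ∘ J) :=
      isBirationalIso_closedImage zariskiClosure_X (fun i => IsRatFun.coord i)
        (fun i => IsRatFun.coord i) isRatFun_conjPt_J hinv (generically_of_forall fun _ _ => rfl)
    rwa [← conjPt_image_closedImage (fun _ => Generically.comp_J) generically_J_J fun p => p,
      closedImage_id zariskiClosure_X] at h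
  involutive := generically_isGood.mono fun _ hp hx => ⟨J_mem_X hp hx.ne_zero, J_J hx.ne_zero⟩

theorem isAnticonformalInvolution_T : IsAnticonformalInvolution Z2 T where
  antibirational := by
    rw [conjPt_image_Z2]
    exact isBirationalIso_closedImage zariskiClosure_X isRatFun_L1star_complex
      isRatFun_L1star_inv_complex (fun i => (isRatFun_conjL1star i).baseChange)
      (fun i => (isRatFun_conjL1star_inv i).baseChange)
      (generically_isGood.mono fun _ => gEta_L1star)
  involutive := by
    refine (generically_closedImage_iff zariskiClosure_X isRatFun_L1star_complex
      isRatFun_L1star_inv_complex).2 ?_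
    refine ((generically_isGood.and generically_good_mem_J).and
      (generically_mem_closedImage isRatFun_L1star_complex).comp_J).mono fun p hp h => ?_
    obtain ⟨⟨h1, h2⟩, h3⟩ := h
    rw [T_L1star hp h1, T_L1star h2.1 h2.2, J_J h1.ne_zero]
    exact ⟨h3, rfl⟩

theorem isBirationalIso_Phi2 : IsBirationalIso QSqrtNegSeven Z2 Phi2Z2 Phi2 := by
  rw [Phi2Z2_eq]
  exact isBirationalIso_closedImage zariskiClosure_X isRatFun_L1star_complex
    isRatFun_L1star_inv_complex isRatFun_graphPt isRatFun_graphPt_inv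
    (generically_isGood.mono fun _ => Phi2_L1star)

theorem isBirationalIso_L2 : IsBirationalIso QSqrtNegSeven Z2 W L2 := by
  rw [W_eq]
  refine isBirationalIso_closedImage zariskiClosure_X isRatFun_L1star_complex
    isRatFun_L1star_inv_complex isRatFun_paramW isRatFun_paramW_inv
    (generically_isGood.mono fun _ hp hx => ?_)
  rw [L2, Function.comp_apply, Phi2_L1star hp hx]
  rfl

theorem isBirationalIso_Psi2 : IsBirationalIso QSqrtNegSeven Phi2Z2 W Psi2 := by
  rw [W_eq, Phi2Z2_eq]
  exact isBirationalIso_closedImage zariskiClosure_X isRatFun_graphPt_complex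
    isRatFun_graphPt_inv_complex (fun i => (isRatFun_paramW i).trans isRatFun_graphPt_inv)
    (fun i => (isRatFun_graphPt i).trans isRatFun_paramW_inv)
    (generically_of_forall fun _ _ => rfl)

theorem isBirationalIso_L : IsBirationalIso QRho X W L := by
  let _ : Algebra QSqrtNegSeven QRho :=
    (IntermediateField.inclusion QSqrtNegSeven_le_QRho).toRingHom.toAlgebra
  have : IsScalarTower QSqrtNegSeven QRho ℂ := IsScalarTower.of_algebraMap_eq fun _ => rfl
  have h : IsBirationalIso QRho (closedImage X fun p => p) (closedImage X paramW) L :=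
    isBirationalIso_closedImage zariskiClosure_X (fun i => IsRatFun.coord i)
      (fun i => IsRatFun.coord i)
      (fun i => ((isRatFun_paramW i).baseChange (K := QRho)).trans isRatFun_L1star)
      (fun i => (isRatFun_L1star_inv i).trans fun j =>
        (isRatFun_paramW_inv j).baseChange (K := QRho))
      (generically_isGood.mono fun _ hp hx => by
        exact congrArg Psi2 (Phi2_L1star hp hx))
  rwa [closedImage_id zariskiClosure_X, ← W_eq] at h

/-- The curve `W` is defined over `ℚ(√-7)` since `Z2` is, and it is stable under complex conjugation
because `J` exchanges `L1star` with the conjugate of `conjL1star`, and `Psi2` is symmetric. -/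
theorem definedOver_W : DefinedOver ℚ W := by
  rw [W_eq]
  refine definedOver_rat ((isSpannedOver_Z2.closedImage isRatFun_L1star_complex
    isRatFun_paramW).definedOver (zariskiClosure_closedImage isRatFun_paramW_complex)) ?_
  rw [conjPt_image_closedImage (fun _ => Generically.comp_J) generically_J_J]
  refine closedImage_congr (generically_J_J.mono fun p _ hp => ?_)
  have h (i : Fin 5) : starRingEnd ℂ (conjL1star (J p) i) = L1star p i :=
    congrFun (conjPt_conjL1star_J hp) i
  have h' (i : Fin 5) : starRingEnd ℂ (L1star (J p) i) = conjL1star p i := rfl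
  funext i
  rcases i with i | i
  · rw [conjPt, paramW_inl, paramW_inl, map_add, h, h', add_comm]
  · rw [conjPt, paramW_inr, paramW_inr, map_add, map_pow, map_pow, h, h', add_comm]

end Birational

/-! ### The Weil datum -/

section WeilDatum

variable {ι κ : Type} {k : Type} [Field k]

/-- The identity as a rational map. -/
def idMap (k ι : Type) [Field k] : RatMap k ι ι where
  num := MvPolynomial.X
  den := 1

theorem idMap_conj (σ : k →+* k) : (idMap k ι).conj σ = idMap k ι := by
  simp [idMap, RatMap.conj]

theorem RatMap.conj_id (R : RatMap k ι κ) : R.conj (RingHom.id k) = R := by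
  simp only [RatMap.conj, MvPolynomial.map_id]

variable [Algebra k ℂ]

theorem idMap_definedAt (x : ι → ℂ) : (idMap k ι).DefinedAt x := by
  simp [idMap, RatMap.DefinedAt]

theorem idMap_eval (x : ι → ℂ) : (idMap k ι).eval x = x := by
  funext i
  simp [idMap, RatMap.eval]

theorem RatMap.conj_definedAt {η : k →+* k}
    (hη : ∀ z, algebraMap k ℂ (η z) = starRingEnd ℂ (algebraMap k ℂ z))
    {R : RatMap k ι κ} {x : ι → ℂ} (h : R.DefinedAt x) :
    (R.conj η).DefinedAt (conjPt x) := by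
  rw [RatMap.DefinedAt, RatMap.conj, aeval_conjPt hη]
  exact (map_ne_zero _).2 h

theorem RatMap.conj_eval {η : k →+* k}
    (hη : ∀ z, algebraMap k ℂ (η z) = starRingEnd ℂ (algebraMap k ℂ z)) (R : RatMap k ι κ) (x : ι → ℂ) :
    (R.conj η).eval (conjPt x) = conjPt (R.eval x) := by
  funext i
  simp only [RatMap.eval, RatMap.conj, aeval_conjPt hη]
  exact (map_div₀ (starRingEnd ℂ) _ _).symm

open Classical in
/-- The family `g_1 = id`, `g_η = R` of rational maps. -/
def weilFamily (R : RatMap QSqrtNegSeven ι ι) (σ : QSqrtNegSeven ≃ₐ[ℚ] QSqrtNegSeven) :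
    RatMap QSqrtNegSeven ι ι := if σ = 1 then idMap _ _ else R

theorem weilFamily_one (R : RatMap QSqrtNegSeven ι ι) : weilFamily R 1 = idMap _ _ := if_pos rfl

theorem weilFamily_conjF (R : RatMap QSqrtNegSeven ι ι) : weilFamily R conjF = R :=
  if_neg conjF_ne_one

theorem definedOver_Z2 : DefinedOver QSqrtNegSeven Z2 :=
  isSpannedOver_Z2.definedOver (zariskiClosure_closedImage isRatFun_L1star_complex)

/-- Since `J` is an involution, a rational map that represents `gEta` and the conjugate of that map
are inverse to each other; this is the cocycle condition. -/
theorem isWeilDatum_weilFamily {R : RatMap QSqrtNegSeven (Fin 5) (Fin 5)}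
    (hR : Generically X (fun p => R.DefinedAt (L1star p) ∧ conjL1star p = R.eval (L1star p))) :
    IsWeilDatum Z2 (weilFamily R) where
  definedOver := definedOver_Z2
  birational σ := by
    rcases eq_one_or_eq_conjF σ with rfl | rfl
    · rw [weilFamily_one, conjVariety_one definedOver_Z2]
      have h : Generically X (fun p => (idMap QSqrtNegSeven _).DefinedAt (L1star p) ∧
          L1star p = (idMap QSqrtNegSeven _).eval (L1star p)) :=
        generically_of_forall fun p _ => ⟨idMap_definedAt _, (idMap_eval _).symm⟩
      exact isBirational_closedImage zariskiClosure_X isRatFun_L1star_complex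
        isRatFun_L1star_inv_complex h h
    · rw [weilFamily_conjF, conjVariety_conjF definedOver_Z2, conjPt_image_Z2]
      obtain ⟨H, hH⟩ := exists_ratMap isRatFun_conjL1star_inv
      exact isBirational_closedImage zariskiClosure_X isRatFun_L1star_complex
        isRatFun_L1star_inv_complex hR hH
  cocycle σ τ := by
    refine (generically_closedImage_iff zariskiClosure_X isRatFun_L1star_complex
      isRatFun_L1star_inv_complex).2 ?_
    have h1 : ((1 : QSqrtNegSeven ≃ₐ[ℚ] QSqrtNegSeven) : QSqrtNegSeven →+* QSqrtNegSeven) =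
      RingHom.id _ := rfl
    refine ((hR.and hR.comp_J).and generically_J_J).mono fun p _ hp => ?_
    obtain ⟨⟨⟨hd, he⟩, hd', he'⟩, hJ⟩ := hp
    rcases eq_one_or_eq_conjF σ with rfl | rfl
    · rw [one_mul, weilFamily_one, idMap_eval, h1, RatMap.conj_id]
      refine ⟨?_, idMap_definedAt _, ?_, rfl⟩ <;>
      · rcases eq_one_or_eq_conjF τ with rfl | rfl
        · rw [weilFamily_one]
          exact idMap_definedAt _
        · rw [weilFamily_conjF]
          exact hd
    · rcases eq_one_or_eq_conjF τ with rfl | rfl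
      · rw [mul_one, weilFamily_one, weilFamily_conjF, idMap_conj, idMap_eval]
        exact ⟨hd, hd, idMap_definedAt _, rfl⟩
      · rw [conjF_mul_conjF, weilFamily_one, weilFamily_conjF, idMap_eval, ← he, conjL1star,
          RatMap.conj_eval algebraMap_conjF, ← he', conjPt_conjL1star_J hJ]
        exact ⟨idMap_definedAt _, hd, RatMap.conj_definedAt algebraMap_conjF hd', rfl⟩

theorem exists_isWeilDatum : ∃ g : (QSqrtNegSeven ≃ₐ[ℚ] QSqrtNegSeven) →
      RatMap QSqrtNegSeven (Fin 5) (Fin 5), IsWeilDatum Z2 g ∧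
    Generically Z2 (fun t => (g 1).eval t = t) ∧
    Generically Z2 (fun t => (g conjF).eval t = gEta t) := by
  obtain ⟨R, hR⟩ := exists_ratMap isRatFun_conjL1star
  refine ⟨weilFamily R, isWeilDatum_weilFamily hR, ?_, ?_⟩
  · rw [weilFamily_one]
    exact generically_of_forall fun t _ => idMap_eval t
  · rw [weilFamily_conjF]
    refine (generically_closedImage_iff zariskiClosure_X isRatFun_L1star_complex
      isRatFun_L1star_inv_complex).2 ((hR.and generically_isGood).mono fun p hp h => ?_)
    rw [gEta_L1star hp h.2, h.1.2]

end WeilDatum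

end FrickeMacbeath

end

theorem mainTheorem2 :
    (FrickeMacbeath.IsAffineCurve FrickeMacbeath.X ∧
      FrickeMacbeath.IsAffineCurve FrickeMacbeath.Z2 ∧
      FrickeMacbeath.IsBirationalIso FrickeMacbeath.QRho
        FrickeMacbeath.X FrickeMacbeath.Z2 FrickeMacbeath.L1star) ∧
    (FrickeMacbeath.IsAnticonformalInvolution FrickeMacbeath.X FrickeMacbeath.J ∧
      FrickeMacbeath.IsAnticonformalInvolution FrickeMacbeath.Z2 FrickeMacbeath.T ∧
      FrickeMacbeath.Generically FrickeMacbeath.X (fun p =>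
        FrickeMacbeath.T (FrickeMacbeath.L1star p)
          = FrickeMacbeath.L1star (FrickeMacbeath.J p))) ∧
    (∃ (η : FrickeMacbeath.QSqrtNegSeven ≃ₐ[ℚ] FrickeMacbeath.QSqrtNegSeven)
      (g : (FrickeMacbeath.QSqrtNegSeven ≃ₐ[ℚ] FrickeMacbeath.QSqrtNegSeven) →
        FrickeMacbeath.RatMap FrickeMacbeath.QSqrtNegSeven (Fin 5) (Fin 5)),
      (∀ z : FrickeMacbeath.QSqrtNegSeven, (η z : ℂ) = starRingEnd ℂ (z : ℂ)) ∧
      η ≠ 1 ∧ (∀ σ, σ = 1 ∨ σ = η) ∧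
      FrickeMacbeath.IsWeilDatum FrickeMacbeath.Z2 g ∧
      FrickeMacbeath.Generically FrickeMacbeath.Z2 (fun t => (g 1).eval t = t) ∧
      FrickeMacbeath.Generically FrickeMacbeath.Z2
        (fun t => (g η).eval t = FrickeMacbeath.gEta t)) ∧
    FrickeMacbeath.IsBirationalIso FrickeMacbeath.QSqrtNegSeven
      FrickeMacbeath.Z2 FrickeMacbeath.Phi2Z2 FrickeMacbeath.Phi2 ∧
    ({σ | FrickeMacbeath.Theta2 σ '' FrickeMacbeath.Phi2Z2 = FrickeMacbeath.Phi2Z2} = {1} →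
      FrickeMacbeath.IsAffineCurve FrickeMacbeath.W ∧
      FrickeMacbeath.DefinedOver ℚ FrickeMacbeath.W ∧
      FrickeMacbeath.IsBirationalIso FrickeMacbeath.QSqrtNegSeven
        FrickeMacbeath.Phi2Z2 FrickeMacbeath.W FrickeMacbeath.Psi2 ∧
      FrickeMacbeath.IsBirationalIso FrickeMacbeath.QSqrtNegSeven
        FrickeMacbeath.Z2 FrickeMacbeath.W FrickeMacbeath.L2 ∧
      FrickeMacbeath.IsBirationalIso FrickeMacbeath.QRho
        FrickeMacbeath.X FrickeMacbeath.W FrickeMacbeath.L) := by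
  refine ⟨⟨FrickeMacbeath.isAffineCurve_X, FrickeMacbeath.isAffineCurve_Z2,
    FrickeMacbeath.isBirationalIso_L1star⟩, ⟨FrickeMacbeath.isAnticonformalInvolution_J,
    FrickeMacbeath.isAnticonformalInvolution_T, FrickeMacbeath.generically_isGood.mono
      fun _ => FrickeMacbeath.T_L1star⟩, ?_, FrickeMacbeath.isBirationalIso_Phi2, fun _ =>
    ⟨?_, FrickeMacbeath.definedOver_W, FrickeMacbeath.isBirationalIso_Psi2,
      FrickeMacbeath.isBirationalIso_L2, FrickeMacbeath.isBirationalIso_L⟩⟩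
  · obtain ⟨g, h⟩ := FrickeMacbeath.exists_isWeilDatum
    exact ⟨FrickeMacbeath.conjF, g, FrickeMacbeath.coe_conjF, FrickeMacbeath.conjF_ne_one,
      FrickeMacbeath.eq_one_or_eq_conjF, h⟩
  · rw [FrickeMacbeath.W_eq]
    exact FrickeMacbeath.isAffineCurve_closedImage_paramW
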